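/- Identify the letters of a 4-letter alphabet with $\mathbb{Z}_4=\{0,1,2,3\}$. For $n\ge 1$ let $Q_n^4$ be the graph whose vertices are the words of length $n$ over $\mathbb{Z}_4$, two words $u,v$ being adjacent if and only if they differ at exactly one position $i$ and $u[i]=v[i]\pm 1 \bmod 4$. For a word $f$ over $\mathbb{Z}_4$ let $Q_n^4(f)$ be the graph obtained from $Q_n^4$ by deleting all vertices that contain $f$ as a factor (a block of consecutive letters). The word $f$ is called Lee-isometric if for every $n\ge 1$ the graph $Q_n^4(f)$ is an isometric subgraph of $Q_n^4$, that is, any two vertices of $Q_n^4(f)$ have the same distance in $Q_n^4(f)$ as in $Q_n^4$ (the distance between vertices in different connected components being infinite). It can be checked in linear time and space whether a word over a 4-letter alphabet is Lee-isometric. Precisely: there is a word-RAM program which, given any word $f$ over $\mathbb{Z}_4$, of length $n$ say, halts after $O(n+1)$ elementary steps, using $O(n+1)$ memory cells, each of which holds $O(\log (n+2))$ bits, and outputs $1$ if $f$ is Lee-isometric and $0$ otherwise. The program and the constants in the $O$'s do not depend on $f$. (Elementary steps of unit cost are: accesses to registers and to array cells with computed index, addition, truncated subtraction, multiplication, division with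 remainder, comparison, and conditional branching.) -/

import Mathlib

/-! ## Lee-isometric words -/

/-- The `d`-ary `n`-cube: its vertices are the words of length `n` over `ℤ/d`, and two distinct
words are adjacent iff they agree at all positions but one, where they differ by `±1` mod `d`. -/
def leeCube (d n : ℕ) : SimpleGraph (Fin n → ZMod d) where
  Adj u v := u ≠ v ∧ ∃ i, (u i = v i + 1 ∨ u i = v i - 1) ∧ ∀ j, j ≠ i → u j = v j
  symm := ⟨by
    rintro u v ⟨hne, i, h, hj⟩
    refine ⟨hne.symm, i, ?_, fun j hji => (hj j hji).symm⟩
    rcases h with h | h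
    · right; rw [h]; ring
    · left; rw [h]; ring⟩
  loopless := ⟨fun _ h => h.1 rfl⟩

/-- The word `u` is `f`-free: `f` is not a factor (a block of consecutive letters) of `u`. -/
def FactorFree {d n : ℕ} (f : List (ZMod d)) (u : Fin n → ZMod d) : Prop :=
  ¬ f <:+: List.ofFn u

/-- The `d`-ary `n`-cube avoiding `f`: the vertices containing `f` as a factor are deleted. -/
def leeCubeAvoiding (d n : ℕ) (f : List (ZMod d)) :
    SimpleGraph {u : Fin n → ZMod d | FactorFree f u} :=
  (leeCube d n).induce {u | FactorFree f u}

/-- `f` is Lee-isometric: for all `n ≥ 1`, the cube avoiding `f` is an isometric subgraph of the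
cube. The distances are extended ones (infinite between different connected components). -/
def LeeIsometric {d : ℕ} (f : List (ZMod d)) : Prop :=
  ∀ n : ℕ, 1 ≤ n → ∀ u v : {u : Fin n → ZMod d | FactorFree f u},
    (leeCubeAvoiding d n f).edist u v = (leeCube d n).edist u.1 v.1

/-! ## A word RAM with structured programs

A machine state has registers, addressed by constants of the program, and random-access arrays,
named by constants of the program and addressed by computed indices. All cells hold natural
numbers. A program mentions only finitely many registers and arrays. -/

namespace WordRAM

/-- A state of the machine: contents of the registers and of the arrays. -/
structure State where
  reg : ℕ → ℕ
  arr : ℕ → ℕ → ℕ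

/-- `s` with the value `v` written into register `x`. -/
def State.setReg (s : State) (x v : ℕ) : State :=
  { s with reg := Function.update s.reg x v }

/-- `s` with the value `v` written into cell `i` of array `a`. -/
def State.setArr (s : State) (a i v : ℕ) : State :=
  { s with arr := Function.update s.arr a (Function.update (s.arr a) i v) }

/-- The binary operations on machine words. -/
inductive Op where
  | add | sub | mul | div | mod | lt | eq

/-- Subtraction is truncated at `0`, `x / 0 = 0`, `x % 0 = x`, and the comparisons return
`1` (true) or `0` (false). -/
def Op.eval : Op → ℕ → ℕ → ℕ
  | .add, x, y => x + y
  | .sub, x, y => x - y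
  | .mul, x, y => x * y
  | .div, x, y => x / y
  | .mod, x, y => x % y
  | .lt, x, y => if x < y then 1 else 0
  | .eq, x, y => if x = y then 1 else 0

/-- Expressions: constants, registers, array cells, binary operations. -/
inductive Expr where
  | const (k : ℕ)
  | reg (x : ℕ)
  | read (a : ℕ) (i : Expr)
  | bin (o : Op) (e₁ e₂ : Expr)

/-- The value of an expression. -/
def Expr.eval (s : State) : Expr → ℕ
  | .const k => k
  | .reg x => s.reg x
  | .read a i => s.arr a (i.eval s)
  | .bin o e₁ e₂ => o.eval (e₁.eval s) (e₂.eval s)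

/-- The time for evaluating an expression: one unit for each constant, register, array access
and operation in it. -/
def Expr.cost : Expr → ℕ
  | .const _ => 1
  | .reg _ => 1
  | .read _ i => i.cost + 1
  | .bin _ e₁ e₂ => e₁.cost + e₂.cost + 1

/-- The evaluation of an expression respects the limits of the machine: every array index that
it uses is less than `S`, and every value that occurs, intermediate ones included, is less
than `W`. -/
def Expr.Fits (S W : ℕ) (s : State) : Expr → Prop
  | .const k => k < W
  | .reg x => s.reg x < W
  | .read a i => i.Fits S W s ∧ i.eval s < S ∧ s.arr a (i.eval s) < W
  | .bin o e₁ e₂ => e₁.Fits S W s ∧ e₂.Fits S W s ∧ o.eval (e₁.eval s) (e₂.eval s) < W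

/-- Programs. Tests count as true iff their value is not `0`. -/
inductive Prog where
  | skip
  | assign (x : ℕ) (e : Expr)
  | store (a : ℕ) (i e : Expr)
  | seq (p q : Prog)
  | cond (e : Expr) (p q : Prog)
  | loop (e : Expr) (p : Prog)

/-- `Exec S W p s s' t`: on a machine with `S` cells in each array and with words that hold the
numbers less than `W`, the program `p`, started in state `s`, halts in state `s'` after `t` units
of time. A run that exceeds these limits is stuck: it does not count as an execution. -/
inductive Exec (S W : ℕ) : Prog → State → State → ℕ → Prop where
  | skip (s : State) : Exec S W .skip s s 1
  | assign (x : ℕ) (e : Expr) (s : State) (he : e.Fits S W s) :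
      Exec S W (.assign x e) s (s.setReg x (e.eval s)) (e.cost + 1)
  | store (a : ℕ) (i e : Expr) (s : State) (hi : i.Fits S W s) (hS : i.eval s < S)
      (he : e.Fits S W s) :
      Exec S W (.store a i e) s (s.setArr a (i.eval s) (e.eval s)) (i.cost + e.cost + 1)
  | seq {p q : Prog} {s s₁ s₂ : State} {t₁ t₂ : ℕ} (hp : Exec S W p s s₁ t₁)
      (hq : Exec S W q s₁ s₂ t₂) : Exec S W (.seq p q) s s₂ (t₁ + t₂)
  | condTrue {e : Expr} {p q : Prog} {s s₁ : State} {t : ℕ} (he : e.Fits S W s)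
      (h : e.eval s ≠ 0) (hp : Exec S W p s s₁ t) :
      Exec S W (.cond e p q) s s₁ (e.cost + 1 + t)
  | condFalse {e : Expr} {p q : Prog} {s s₁ : State} {t : ℕ} (he : e.Fits S W s)
      (h : e.eval s = 0) (hq : Exec S W q s s₁ t) :
      Exec S W (.cond e p q) s s₁ (e.cost + 1 + t)
  | loopTrue {e : Expr} {p : Prog} {s s₁ s₂ : State} {t₁ t₂ : ℕ} (he : e.Fits S W s)
      (h : e.eval s ≠ 0) (hp : Exec S W p s s₁ t₁) (hl : Exec S W (.loop e p) s₁ s₂ t₂) :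
      Exec S W (.loop e p) s s₂ (e.cost + 1 + t₁ + t₂)
  | loopFalse {e : Expr} {p : Prog} {s : State} (he : e.Fits S W s) (h : e.eval s = 0) :
      Exec S W (.loop e p) s s (e.cost + 1)

/-- The machine is deterministic: final state and running time are determined by the program and
the initial state. -/
theorem Exec.deterministic {S W : ℕ} {p : Prog} {s s₁ s₂ : State} {t₁ t₂ : ℕ}
    (h₁ : Exec S W p s s₁ t₁) (h₂ : Exec S W p s s₂ t₂) : s₁ = s₂ ∧ t₁ = t₂ := by
  induction h₁ generalizing s₂ t₂ with
  | skip => cases h₂; exact ⟨rfl, rfl⟩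
  | assign => cases h₂; exact ⟨rfl, rfl⟩
  | store => cases h₂; exact ⟨rfl, rfl⟩
  | seq _ _ ih₁ ih₂ =>
    cases h₂ with
    | seq hp hq =>
      obtain ⟨rfl, rfl⟩ := ih₁ hp
      obtain ⟨rfl, rfl⟩ := ih₂ hq
      exact ⟨rfl, rfl⟩
  | condTrue _ h _ ih =>
    cases h₂ with
    | condTrue _ _ hp => obtain ⟨rfl, rfl⟩ := ih hp; exact ⟨rfl, rfl⟩
    | condFalse _ h' _ => exact absurd h' h
  | condFalse _ h _ ih =>
    cases h₂ with
    | condTrue _ h' _ => exact absurd h h'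
    | condFalse _ _ hp => obtain ⟨rfl, rfl⟩ := ih hp; exact ⟨rfl, rfl⟩
  | loopTrue _ h _ _ ih₁ ih₂ =>
    cases h₂ with
    | loopTrue _ _ hp hl =>
      obtain ⟨rfl, rfl⟩ := ih₁ hp
      obtain ⟨rfl, rfl⟩ := ih₂ hl
      exact ⟨rfl, rfl⟩
    | loopFalse _ h' => exact absurd h' h
  | loopFalse _ h =>
    cases h₂ with
    | loopTrue _ h' _ _ => exact absurd h h'
    | loopFalse _ _ => exact ⟨rfl, rfl⟩

/-- The initial state on the input `w`: register `0` holds the length of `w`, the first cells of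
array `0` hold the letters of `w`, and everything else is `0`. -/
def State.init (w : List ℕ) : State where
  reg x := if x = 0 then w.length else 0
  arr a i := if a = 0 then w.getD i 0 else 0

end WordRAM

open WordRAM in
/-- The property `P` of words over `ℤ/d` can be checked in linear time and space on a word RAM:
there are one program and one constant `C` such that, on every input word `f` of length `n`,
the program halts within time `C(n+1)`, using only the first `C(n+1)` cells of each of its (finitely
many) arrays and words of `O(log n)` bits (values less than `C(n+1)^C`), and then register `0`
holds `1` if `P f` and `0` otherwise. -/
def CheckableInLinearTimeAndSpace {d : ℕ} (P : List (ZMod d) → Prop) : Prop :=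
  ∃ (p : Prog) (C : ℕ), ∀ f : List (ZMod d), ∃ (s : State) (t : ℕ),
    Exec (C * (f.length + 1)) (C * (f.length + 1) ^ C) p (State.init (f.map ZMod.val)) s t ∧
      t ≤ C * (f.length + 1) ∧ (P f → s.reg 0 = 1) ∧ (¬ P f → s.reg 0 = 0)

/-! ## Binary words: occurrences at even offsets, borders with two errors -/

namespace BitWord

/-! Combinatorics. The Gray map turns a letter into two bits, an edge of the cube into the inversion
of one bit, and a factor into an occurrence at an even offset; the distance in the cube becomes the
Hamming distance (`edist_leeCube`). So a word fails to be isometric exactly when there are distinct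
`u`, `v` avoiding it such that every inversion at a difference of `u` and `v` creates a copy of it
in `u` (`Stuck`). The core is `stuck_iff_err2`: this happens iff some even shift of the bit word
disagrees with it in exactly two places. If `u`, `v` are stuck, then two suitable consecutive
differences lie in both of the copies that they create, and these copies conflict just there.
Conversely, superpose two copies at the distance of the shift and resolve the two conflicts in the
two mixed ways; this gives a stuck pair unless one of the mixed words contains the word by accident.
An accident forces the half of the shift to have a single error, so the word is periodic up to this
error; then a multiple of the half shift works, or, in one remaining case, an explicit pair with
three differences.

Algorithm. Every shift `p` has to be tested for errors of total Lee weight two (`TwoErr`). Longest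
common prefixes of the word, and of its reversal, with their suffixes give the first and the last
disagreement for each `p`. If these are different, both have to be of weight one, and the stretch
between them has to equal its translate by `p` (`twoErr_iff`). What is needed is therefore a test,
in constant time after linear preprocessing, whether a block equals its translate.

Naming all blocks whose lengths are powers of two would cost `n log n`. Instead, blocks are named
only at sampled positions: the multiples of `d`, and the positions whose residue mod `d²` is less
than `d`. These are `O(n/d)` many, and for all `x`, `p` some `δ < d²` moves `x` to a sample of the
first kind and `x + p` to one of the second kind (`exists_sampled`). Two scales are used. With `d`
about the square root of `log n`, a few doublings lead from length `d²` to `d⁴`; with `d²` in place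
of `d`, at most about `log n` doublings lead from `d⁴` to all lengths. Both produce `O(n)` names.
Blocks shorter than `2 d²` are compared by their base `4` codes, which are `O(n)` as numbers. Pairs
of names are renamed in linear time by a counting sort (`nameP_spec`). -/

/-- The word `g` of length `N` occurs in the word `u` of length `M` at offset `o`. -/
def Occ (g : ℕ → Bool) (N : ℕ) (u : ℕ → Bool) (M o : ℕ) : Prop :=
  o + N ≤ M ∧ ∀ t < N, u (o + t) = g t

/-- `g` occurs in `u` at an even offset. -/
def Contains (g : ℕ → Bool) (N : ℕ) (u : ℕ → Bool) (M : ℕ) : Prop :=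
  ∃ o, Even o ∧ Occ g N u M o

/-- The word `u` with the bit at position `b` inverted. -/
def flip (u : ℕ → Bool) (b : ℕ) : ℕ → Bool := fun t => if t = b then !u t else u t

/-- Some even shift of `g` disagrees with `g` at exactly two positions of the overlap. -/
def Err2 (g : ℕ → Bool) (N : ℕ) : Prop :=
  ∃ p e₁ e₂, Even p ∧ 0 < p ∧ e₁ < e₂ ∧ e₂ + p < N ∧
    ∀ t, t + p < N → (g t ≠ g (t + p) ↔ t = e₁ ∨ t = e₂)

/-- There are distinct words `u`, `v` avoiding `g` such that no first step of a geodesic from `u`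
to `v` avoids `g`. -/
def Stuck (g : ℕ → Bool) (N : ℕ) : Prop :=
  ∃ (M : ℕ) (u v : ℕ → Bool), Even M ∧ ¬ Contains g N u M ∧ ¬ Contains g N v M ∧
    (∃ b < M, u b ≠ v b) ∧ ∀ b < M, u b ≠ v b → Contains g N (flip u b) M

theorem flip_self (u : ℕ → Bool) (b : ℕ) : flip u b b = !u b := by simp [flip]

theorem flip_ne (u : ℕ → Bool) {b t : ℕ} (h : t ≠ b) : flip u b t = u t := by simp [flip, h]

/-- Both windows contain both inverted positions, and elsewhere the two copies read the same bits of
`u`. Hence they conflict exactly at `b` and `b'`, and the difference of their offsets is the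
required shift. Equal offsets are impossible, as `g` does not conflict with itself. -/
theorem err2_of_occ_flip {g u : ℕ → Bool} {N M b b' o o' : ℕ} (hbb : b < b')
    (ho : Even o) (ho' : Even o') (h : Occ g N (flip u b) M o) (h' : Occ g N (flip u b') M o')
    (h1 : o ≤ b) (h2 : b' < o + N) (h3 : o' ≤ b) (h4 : b' < o' + N) : Err2 g N := by
  have key : ∀ t, o ≤ t → t < o + N → o' ≤ t → t < o' + N →
      (g (t - o) ≠ g (t - o') ↔ t = b ∨ t = b') := by
    intro t k1 k2 k3 k4
    have e1 := h.2 (t - o) (by omega)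
    have e2 := h'.2 (t - o') (by omega)
    rw [show o + (t - o) = t by omega] at e1
    rw [show o' + (t - o') = t by omega] at e2
    rw [← e1, ← e2]
    unfold flip
    by_cases q1 : t = b
    · have : t ≠ b' := by omega
      simp [q1, hbb.ne]
    · by_cases q2 : t = b'
      · simp [q2, hbb.ne']
      · simp [q1, q2]
  rcases lt_trichotomy o o' with hlt | heq | hgt
  · refine ⟨o' - o, b - o', b' - o', ?_, by omega, by omega, by omega, ?_⟩
    · exact (Nat.even_sub hlt.le).2 (by simp [ho, ho'])
    · intro t ht
      have := key (t + o') (by omega) (by omega) (by omega) (by omega)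
      rw [show t + o' - o = t + (o' - o) by omega, show t + o' - o' = t by omega] at this
      rw [ne_comm, this]
      omega
  · subst heq
    have := key b (by omega) (by omega) (by omega) (by omega)
    simp at this
  · refine ⟨o - o', b - o, b' - o, ?_, by omega, by omega, by omega, ?_⟩
    · exact (Nat.even_sub hgt.le).2 (by simp [ho, ho'])
    · intro t ht
      have := key (t + o) (by omega) (by omega) (by omega) (by omega)
      rw [show t + o - o' = t + (o - o') by omega, show t + o - o = t by omega] at this
      rw [this]
      omega

/-- Each difference creates a copy that contains it, since `u` is free of `g`, and that contains a
further difference, since `v` is. The first difference must reach forward and the last one must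
reach back, so somewhere a difference that reaches forward is followed by one that reaches back; the
two copies of these neighbours contain both of them. -/
theorem Stuck.err2 {g : ℕ → Bool} {N : ℕ} (h : Stuck g N) : Err2 g N := by
  classical
  obtain ⟨M, u, v, -, hu, hv, ⟨b₀, hb₀, hd₀⟩, hD⟩ := h
  choose! o ho using hD
  have win : ∀ b < M, u b ≠ v b → o b ≤ b ∧ b < o b + N := by
    intro b hb hd
    obtain ⟨he, hM, hocc⟩ := ho b hb hd
    by_contra hcon
    refine hu ⟨o b, he, hM, fun t ht => ?_⟩
    rw [← hocc t ht, flip_ne]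
    omega
  have other : ∀ b < M, u b ≠ v b → ∃ d, d ≠ b ∧ o b ≤ d ∧ d < o b + N ∧ u d ≠ v d := by
    intro b hb hd
    obtain ⟨he, hM, hocc⟩ := ho b hb hd
    by_contra! hcon
    refine hv ⟨o b, he, hM, fun t ht => ?_⟩
    rw [← hocc t ht]
    by_cases htb : o b + t = b
    · rw [htb, flip_self]
      revert hd
      cases u b <;> cases v b <;> simp
    · rw [flip_ne _ htb, hcon _ htb (by omega) (by omega)]
  have hMb : ∀ b < M, u b ≠ v b → o b + N ≤ M := fun b hb hd => (ho b hb hd).2.1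
  let D := (Finset.range M).filter (fun b => u b ≠ v b)
  have hDmem : ∀ b, b ∈ D ↔ b < M ∧ u b ≠ v b := by intro b; simp [D]
  -- The differences whose copy contains a later difference. Take `b` as the last of them and `b'`
  -- as the next difference after `b`.
  let R := D.filter (fun b => ∃ d ∈ D, b < d ∧ d < o b + N)
  have hDne : D.Nonempty := ⟨b₀, (hDmem _).2 ⟨hb₀, hd₀⟩⟩
  have hRne : R.Nonempty := by
    refine ⟨D.min' hDne, ?_⟩
    have hm := D.min'_mem hDne
    obtain ⟨d, hne, k1, k2, k3⟩ := other _ ((hDmem _).1 hm).1 ((hDmem _).1 hm).2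
    have hMm := hMb _ ((hDmem _).1 hm).1 ((hDmem _).1 hm).2
    have hdD : d ∈ D := (hDmem _).2 ⟨by omega, k3⟩
    have := D.min'_le d hdD
    exact Finset.mem_filter.2 ⟨hm, d, hdD, by omega, k2⟩
  set b := R.max' hRne with hbdef
  have hbR := R.max'_mem hRne
  rw [← hbdef] at hbR
  obtain ⟨hbD, d, hdD, hbd, hdw⟩ := Finset.mem_filter.1 hbR
  have hne' : (D.filter (fun x => b < x)).Nonempty := ⟨d, Finset.mem_filter.2 ⟨hdD, hbd⟩⟩
  set b' := (D.filter (fun x => b < x)).min' hne' with hb'def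
  have hb'mem := (D.filter (fun x => b < x)).min'_mem hne'
  rw [← hb'def] at hb'mem
  obtain ⟨hb'D, hbb'⟩ := Finset.mem_filter.1 hb'mem
  have hb'd : b' ≤ d := Finset.min'_le _ d (Finset.mem_filter.2 ⟨hdD, hbd⟩)
  have hbM := (hDmem _).1 hbD
  have hb'M := (hDmem _).1 hb'D
  obtain ⟨d', hne2, k1, k2, k3⟩ := other b' hb'M.1 hb'M.2
  have hMb' := hMb b' hb'M.1 hb'M.2
  have hd'D : d' ∈ D := (hDmem _).2 ⟨by omega, k3⟩
  -- As `b'` lies beyond the last element of `R`, its copy has to reach back, and the nearest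
  -- earlier difference is `b`.
  have hd'lt : d' ≤ b := by
    by_contra hcon
    have h1 : b' ≤ d' := Finset.min'_le _ d' (Finset.mem_filter.2 ⟨hd'D, by omega⟩)
    have h2 : b' ∈ R := Finset.mem_filter.2 ⟨hb'D, d', hd'D, by omega, k2⟩
    have h3 : b' ≤ b := Finset.le_max' _ _ h2
    omega
  have w := win b hbM.1 hbM.2
  have w' := win b' hb'M.1 hb'M.2
  exact err2_of_occ_flip hbb' (ho b hbM.1 hbM.2).1 (ho b' hb'M.1 hb'M.2).1 (ho b hbM.1 hbM.2).2
    (ho b' hb'M.1 hb'M.2).2 w.1 (by omega) (by omega) w'.2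

/-- Two overlapping copies of `g` at distance `p` with one of the two conflicts resolved in favour
of the second copy: an occurrence of `g` forces the positions of the conflicts. -/
theorem overlap_contains {g : ℕ → Bool} {N p e e' : ℕ} (hee : e ≠ e')
    (he : e + p < N) (he' : e' + p < N)
    (h : ∀ t, t + p < N → (g t ≠ g (t + p) ↔ t = e ∨ t = e'))
    (hc : Contains g N (flip (fun t => if t < N then g t else g (t - p)) (e + p)) (N + p)) :
    ∃ q, Even q ∧ p = 2 * q ∧ e' = e + q ∧ ∀ t, t + q < N → (g t ≠ g (t + q) ↔ t = e') := by
  obtain ⟨o, hoe, hoM, ho⟩ := hc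
  set W : ℕ → Bool := fun t => if t < N then g t else g (t - p) with hW
  have hWg : ∀ t < N, W t = g t := fun t ht => by simp [hW, ht]
  have hWp : ∀ t < N, (W (p + t) ≠ g t ↔ t = e ∨ t = e') := by
    intro t ht
    by_cases h1 : p + t < N
    · rw [hWg _ h1, ne_comm, add_comm p t, h t (by omega)]
    · have : W (p + t) = g t := by simp [hW, h1]
      simp only [this, ne_eq, not_true_eq_false, false_iff]
      omega
  have hUp : ∀ t < N, (flip W (e + p) (p + t) ≠ g t ↔ t = e') := by
    intro t ht
    have := hWp t ht
    by_cases h1 : t = e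
    · subst h1
      rw [add_comm p t, flip_self]
      rw [add_comm p t] at this
      have h2 : W (t + p) ≠ g t := this.2 (Or.inl rfl)
      revert h2
      cases W (t + p) <;> cases g t <;> simp [hee]
    · rw [flip_ne _ (by omega), this]
      simp [h1]
  have hU0 : ∀ t < N, (flip W (e + p) t ≠ g t ↔ t = e + p) := by
    intro t ht
    by_cases h1 : t = e + p
    · subst h1
      rw [flip_self, hWg _ ht]; simp
    · rw [flip_ne _ h1, hWg _ ht]; simp [h1]
  have ho0 : 0 < o := by
    rcases Nat.eq_zero_or_pos o with h0 | h0
    · subst h0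
      have := ho (e + p) he
      rw [zero_add] at this
      exact absurd this ((hU0 _ he).2 rfl)
    · exact h0
  have hop : o < p := by
    rcases Nat.lt_or_ge o p with h0 | h0
    · exact h0
    · have : o = p := by omega
      subst this
      have h2 := ho e' (by omega)
      exact absurd h2 ((hUp _ (by omega)).2 rfl)
  -- The occurrence at `o` overlaps the near-copies at `0` and at `p`, each of which has just one
  -- wrong bit: so the shifts by `o` and by `p - o` have at most one error each.
  have E1 : ∀ t, t + o < N → (g t ≠ g (t + o) ↔ t + o = e + p) := by
    intro t ht
    rw [← ho t (by omega), add_comm o t, hU0 _ ht]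
  have E2 : ∀ t, t + (p - o) < N → (g t ≠ g (t + (p - o)) ↔ t = e') := by
    intro t ht
    rw [← hUp t (by omega), ← ho (t + (p - o)) ht, show o + (t + (p - o)) = p + t by omega, ne_comm]
  -- The errors of the shift by `p` form the symmetric difference of the errors of the shift by `o`
  -- and the translated errors of the shift by `p - o`. Comparison at `e` and `e'` leaves only `o =
  -- p - o` and `e' = e + o`.
  have comm : ∀ t, t + p < N → ((t = e ∨ t = e') ↔ ¬ (t + o = e + p ↔ t + o = e')) := by
    intro t ht
    rw [← h t ht, ← E1 t (by omega), ← E2 (t + o) (by omega),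
      show t + o + (p - o) = t + p by omega]
    cases g t <;> cases g (t + o) <;> cases g (t + p) <;> simp
  have c1 := comm e he
  have c2 := comm e' he'
  refine ⟨o, hoe, by omega, by omega, fun t ht => ?_⟩
  rw [E1 t ht]
  omega

theorem flip_flip (u : ℕ → Bool) (a : ℕ) : flip (flip u a) a = u := by
  funext t
  simp only [flip]
  split_ifs <;> simp

theorem flip_ne_flip {u : ℕ → Bool} {a b : ℕ} (hab : a ≠ b) (t : ℕ) :
    flip u a t ≠ flip u b t ↔ t = a ∨ t = b := by
  simp only [flip]
  by_cases h1 : t = a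
  · subst h1; simp [hab]
  · by_cases h2 : t = b
    · subst h2; simp [Ne.symm hab]
    · simp [h1, h2]

/-- A border with two errors makes the word stuck, or the border is half a border with one error. -/
theorem stuck_or_of_err2 {g : ℕ → Bool} {N p e₁ e₂ : ℕ} (hN : Even N) (hp : Even p) (h12 : e₁ < e₂)
    (he : e₂ + p < N) (h : ∀ t, t + p < N → (g t ≠ g (t + p) ↔ t = e₁ ∨ t = e₂)) :
    Stuck g N ∨ ∃ q, Even q ∧ p = 2 * q ∧ e₂ = e₁ + q ∧
      ∀ t, t + q < N → (g t ≠ g (t + q) ↔ t = e₂) := by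
  set W : ℕ → Bool := fun t => if t < N then g t else g (t - p) with hW
  by_cases hu : Contains g N (flip W (e₁ + p)) (N + p)
  · exact Or.inr (overlap_contains h12.ne (by omega) he h hu)
  by_cases hv : Contains g N (flip W (e₂ + p)) (N + p)
  -- With the roles of the conflicts exchanged the exception would say `e₁ = e₂ + q`, against their
  -- order.
  · obtain ⟨q, -, -, h3, -⟩ := overlap_contains h12.ne' he (by omega)
      (fun t ht => (h t ht).trans or_comm) hv
    omega
  -- The two words differ just at the conflicts. From the first one, undoing its inversion restores
  -- the copy at `0`, and inverting the other conflict as well completes the copy at `p`.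
  refine Or.inl ⟨N + p, flip W (e₁ + p), flip W (e₂ + p), hN.add hp, hu, hv, ⟨e₁ + p, by omega, ?_⟩,
    ?_⟩
  · exact (flip_ne_flip (by omega) _).2 (Or.inl rfl)
  · intro b _ hb
    rcases (flip_ne_flip (by omega) _).1 hb with rfl | rfl
    · rw [flip_flip]
      exact ⟨0, Even.zero, by omega, fun t ht => by simp [hW, ht]⟩
    · refine ⟨p, hp, by omega, fun t ht => ?_⟩
      simp only [flip, hW]
      by_cases hlt : p + t < N
      · have := h t (by omega)
        rw [add_comm t p] at this
        by_cases k1 : t = e₁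
        · subst k1
          have k2 := this.2 (Or.inl rfl)
          rw [if_neg (by omega), if_pos (by omega), if_pos hlt]
          revert k2
          cases g t <;> cases g (p + t) <;> simp
        · by_cases k3 : t = e₂
          · subst k3
            have k2 := this.2 (Or.inr rfl)
            rw [if_pos (by omega), if_neg (by omega), if_pos hlt]
            revert k2
            cases g t <;> cases g (p + t) <;> simp
          · rw [if_neg (by omega), if_neg (by omega), if_pos hlt]
            by_contra hcon
            exact absurd (this.1 (Ne.symm hcon)) (by omega)
      · rw [if_neg (by omega), if_neg (by omega), if_neg hlt]
        congr 1
        omega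

/-- If the shift by `q` has its only error at `c`, then the shift by `k q` has its errors at
`c`, `c - q`, …, `c - (k-1) q`. -/
theorem errors_mul {g : ℕ → Bool} {N q c : ℕ} (h : ∀ t, t + q < N → (g t ≠ g (t + q) ↔ t = c))
    (hq : 0 < q) (k : ℕ) : ∀ t, t + k * q < N → (g t ≠ g (t + k * q) ↔ ∃ i < k, t + i * q = c) := by
  induction k with
  | zero => intro t _; simp
  | succ k ih =>
    intro t ht
    rw [Nat.succ_mul] at ht
    have h1 := ih t (by omega)
    have h2 := h (t + k * q) (by omega)
    rw [Nat.succ_mul, ← add_assoc]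
    -- The two alternatives exclude each other because `q > 0`, so their disjunction is an exclusive
    -- one, as is the composition of errors.
    have h3 : (∃ i < k + 1, t + i * q = c) ↔ ¬ ((∃ i < k, t + i * q = c) ↔ t + k * q = c) := by
      constructor
      · rintro ⟨i, hi, hic⟩
        rcases Nat.lt_succ_iff_lt_or_eq.1 hi with hik | rfl
        · intro hcon
          have h4 := hcon.1 ⟨i, hik, hic⟩
          have h5 : i * q < k * q := Nat.mul_lt_mul_of_pos_right hik hq
          omega
        · intro hcon
          obtain ⟨j, hj, hjc⟩ := hcon.2 hic
          have h5 : j * q < i * q := Nat.mul_lt_mul_of_pos_right hj hq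
          omega
      · intro hn
        by_cases h4 : t + k * q = c
        · exact ⟨k, Nat.lt_succ_self k, h4⟩
        · have : ∃ i < k, t + i * q = c := by
            by_contra h5
            exact hn ⟨fun h => absurd h h5, fun h => absurd h h4⟩
          obtain ⟨i, hi, hic⟩ := this
          exact ⟨i, by omega, hic⟩
    rw [h3, ← h1, ← h2]
    cases g t <;> cases g (t + k * q) <;> cases g (t + k * q + q) <;> simp

/-- A shift shorter than `q` cannot have at most one error. -/
theorem no_short_shift {g : ℕ → Bool} {N q c r K β : ℕ}
    (h : ∀ t, t + q < N → (g t ≠ g (t + q) ↔ t = c)) (hc : q ≤ c) (hcN : c + 2 * q < N)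
    (hr : 0 < r) (hrq : r < q)
    (hE : ∀ t, t + r < N → (g t ≠ g (t + r) ↔ t + K = β)) : False := by
  -- The shifts by `q` and `r` are composed in both orders. At `t = c` and at `t = c - r` the parity
  -- forces an error of the shift by `r` in each of the disjoint pairs `{c, c + q}` and `{c - r, c -
  -- r + q}`, hence two errors.
  have comm : ∀ t, t + q + r < N → ((t = c ↔ t + q + K = β) ↔ (t + K = β ↔ t + r = c)) := by
    intro t ht
    rw [← h t (by omega), ← hE (t + q) (by omega), ← hE t (by omega), ← h (t + r) (by omega),
      show t + r + q = t + q + r by omega]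
    cases g t <;> cases g (t + q) <;> cases g (t + r) <;> cases g (t + q + r) <;> simp
  have c1 := comm (c - r) (by omega)
  have c2 := comm c (by omega)
  omega

/-- No occurrence of `g` at an offset that is at distance less than `q` from a near-occurrence. -/
theorem no_occ_near {g U : ℕ → Bool} {N M q c o k β : ℕ}
    (h : ∀ t, t + q < N → (g t ≠ g (t + q) ↔ t = c)) (hc : q ≤ c) (hcN : c + 2 * q < N)
    (ho : Occ g N U M o) (hk : ∀ t < N, (U (k + t) ≠ g t ↔ k + t = β))
    (hok : o ≠ k) (h1 : o < k + q) (h2 : k < o + q) : False := by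
  rcases lt_or_gt_of_ne hok with hlt | hgt
  · refine no_short_shift (r := k - o) (K := k) (β := β) h hc hcN (by omega) (by omega) fun t ht => ?_
    rw [← ho.2 (t + (k - o)) ht, show o + (t + (k - o)) = k + t by omega, ne_comm,
      hk t (by omega), add_comm]
  · refine no_short_shift (r := o - k) (K := o) (β := β) h hc hcN (by omega) (by omega) fun t ht => ?_
    rw [← ho.2 t (by omega), show o + t = k + (t + (o - k)) by omega, hk _ ht]
    omega

end BitWord


/-! ### The exceptional case: words that are periodic up to one error -/

namespace BitWord

/-- The word `g` of length `N`, continued with period `q`. -/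
def perExt (g : ℕ → Bool) (N q : ℕ) : ℕ → Bool := fun t =>
  if t < N then g t else if t < N + q then g (t - q) else if t < N + 2 * q then g (t - 2 * q)
    else g (t - 3 * q)

/-- Every bit that involves the extension is copied from `q` places earlier, so the only error is
still that of `g`, at `c`. -/
theorem perExt_err {g : ℕ → Bool} {N q c : ℕ} (hcN : c + 2 * q < N)
    (h : ∀ t, t + q < N → (g t ≠ g (t + q) ↔ t = c)) (t : ℕ) (ht : t + q < N + 3 * q) :
    perExt g N q t ≠ perExt g N q (t + q) ↔ t = c := by
  have aux : N ≤ t + q → perExt g N q t = perExt g N q (t + q) := by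
    intro h1
    unfold perExt
    split_ifs <;> first | omega | (congr 1; omega)
  by_cases h1 : t + q < N
  · rw [← h t h1]
    simp [perExt, h1, show t < N by omega]
  · rw [aux (by omega)]
    simp only [ne_eq, not_true_eq_false, false_iff]
    omega

/-- Let `X` be `g` continued by three periods. Compared with `X`, the copies of `g` placed at `0`,
`q`, `2q`, `3q` are wrong at no position, at `c+q`, at `c+q, c+2q`, and at `c+2q, c+3q`. Inverting
`c+2q` in `X` gives `u`; inverting `c+q` and `c+3q` gives `v`. Then `u` has exactly one wrong bit at
each of the offsets `0`, `2q`, `3q`, namely `c+2q`, `c+q`, `c+3q`, which are the three differences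
of `u` and `v`. No copy remains in `v` at a multiple of `q`, nor in `u`; other offsets are closer
than `q` to a near-occurrence and are excluded by `no_occ_near`. -/
theorem stuck_of_short {g : ℕ → Bool} {N q c : ℕ} (hN : Even N) (hq : Even q) (hq0 : 0 < q)
    (hc : q ≤ c) (hc2 : c < 2 * q) (hcN : c + 2 * q < N) (hNc : N ≤ c + 3 * q)
    (h : ∀ t, t + q < N → (g t ≠ g (t + q) ↔ t = c)) : Stuck g N := by
  set X := perExt g N q with hX
  have hE := perExt_err hcN h
  have hm := fun k => errors_mul hE hq0 k
  have hXg : ∀ t < N, X t = g t := fun t ht => by simp [hX, perExt, ht]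
  have X0 : ∀ t < N, X (0 + t) = g t := by intro t ht; rw [zero_add, hXg t ht]
  have X1 : ∀ t < N, (X (q + t) ≠ g t ↔ t = c) := by
    intro t ht
    have := hm 1 t (by omega)
    rw [← hX, one_mul, hXg t ht, ne_comm, add_comm t q] at this
    rw [this]
    constructor
    · rintro ⟨i, hi, rfl⟩; interval_cases i; omega
    · rintro rfl; exact ⟨0, by omega, by omega⟩
  have X2 : ∀ t < N, (X (2 * q + t) ≠ g t ↔ t = c ∨ t + q = c) := by
    intro t ht
    have := hm 2 t (by omega)
    rw [← hX, hXg t ht, ne_comm, add_comm t (2 * q)] at this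
    rw [this]
    constructor
    · rintro ⟨i, hi, rfl⟩; interval_cases i <;> omega
    · rintro (rfl | h1)
      exacts [⟨0, by omega, by omega⟩, ⟨1, by omega, by omega⟩]
  have X3 : ∀ t < N, (X (3 * q + t) ≠ g t ↔ t = c ∨ t + q = c) := by
    intro t ht
    have := hm 3 t (by omega)
    rw [← hX, hXg t ht, ne_comm, add_comm t (3 * q)] at this
    rw [this]
    constructor
    · rintro ⟨i, hi, rfl⟩; interval_cases i <;> omega
    · rintro (rfl | h1)
      exacts [⟨0, by omega, by omega⟩, ⟨1, by omega, by omega⟩]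
  -- Inverting a position toggles whether it is wrong, and nothing else; all the tables of wrong
  -- positions below follow from this.
  have fl : ∀ (U : ℕ → Bool) (b t : ℕ) (x : Bool) (P : Prop), (U t ≠ x ↔ P) →
      (flip U b t ≠ x ↔ ¬ (P ↔ t = b)) := by
    intro U b t x P hP
    rw [← hP]
    by_cases htb : t = b
    · subst htb
      rw [flip_self]
      cases U t <;> cases x <;> simp
    · rw [flip_ne _ htb]
      cases U t <;> cases x <;> simp [htb]
  have X0' : ∀ t < N, (X (0 + t) ≠ g t ↔ False) := fun t ht => by
    rw [X0 t ht]; simp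
  set u := flip X (c + 2 * q) with hu
  set v := flip (flip X (c + q)) (c + 3 * q) with hv
  have u0 : ∀ t < N, (u (0 + t) ≠ g t ↔ 0 + t = c + 2 * q) := by
    intro t ht; rw [hu, fl _ _ _ _ _ (X0' t ht)]; simp only [false_iff, not_not]
  have u1 : u (q + c) ≠ g c := by
    rw [hu, fl _ _ _ _ _ (X1 c (by omega))]; omega
  have u2 : ∀ t < N, (u (2 * q + t) ≠ g t ↔ 2 * q + t = c + q) := by
    intro t ht; rw [hu, fl _ _ _ _ _ (X2 t ht)]; omega
  have u3 : ∀ t < N, (u (3 * q + t) ≠ g t ↔ 3 * q + t = c + 3 * q) := by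
    intro t ht; rw [hu, fl _ _ _ _ _ (X3 t ht)]; omega
  have v0 : ∀ t < N, (v (0 + t) ≠ g t ↔ 0 + t = c + q) := by
    intro t ht; rw [hv, fl _ _ _ _ _ (fl _ _ _ _ _ (X0' t ht))]
    simp only [false_iff, not_not]; omega
  have v1 : ∀ t < N, (v (q + t) ≠ g t ↔ q + t = c + 3 * q) := by
    intro t ht; rw [hv, fl _ _ _ _ _ (fl _ _ _ _ _ (X1 t ht))]; omega
  have v2 : v (2 * q + c) ≠ g c := by
    rw [hv, fl _ _ _ _ _ (fl _ _ _ _ _ (X2 c (by omega)))]; omega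
  have v3 : ∀ t < N, (v (3 * q + t) ≠ g t ↔ 3 * q + t = c + 2 * q) := by
    intro t ht; rw [hv, fl _ _ _ _ _ (fl _ _ _ _ _ (X3 t ht))]; omega
  have hE3 : Even (3 * q) := hq.mul_left 3
  have hdiff : ∀ b, u b ≠ v b ↔ b = c + q ∨ b = c + 2 * q ∨ b = c + 3 * q := by
    intro b
    rw [hu, fl X _ _ _ (b = c + q ∨ b = c + 3 * q)]
    · omega
    · rw [hv, ne_comm, fl _ _ _ _ _ (fl X (c + q) b (X b) False (by simp))]
      simp only [false_iff, not_not]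
      omega
  refine ⟨N + 3 * q, u, v, hN.add hE3, ?_, ?_, ⟨c + q, by omega, (hdiff _).2 (Or.inl rfl)⟩, ?_⟩
  · rintro ⟨o, -, ho⟩
    have hoM := ho.1
    rcases Nat.lt_or_ge o q with h1 | h1
    · rcases Nat.eq_zero_or_pos o with h0 | h0
      · subst h0
        exact (u0 (c + 2 * q) hcN).2 (by omega) (ho.2 _ hcN)
      · exact no_occ_near h hc hcN ho u0 (by omega) (by omega) (by omega)
    · rcases Nat.eq_or_lt_of_le h1 with h2 | h2
      · subst h2
        exact u1 (ho.2 _ (by omega))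
      · by_cases h3 : o = 2 * q
        · subst h3
          exact (u2 (c - q) (by omega)).2 (by omega) (ho.2 _ (by omega))
        · by_cases h4 : o = 3 * q
          · subst h4
            exact (u3 c (by omega)).2 (by omega) (ho.2 _ (by omega))
          · exact no_occ_near h hc hcN ho u2 h3 (by omega) (by omega)
  · rintro ⟨o, -, ho⟩
    have hoM := ho.1
    by_cases h0 : o = 0
    · subst h0
      exact (v0 (c + q) (by omega)).2 (by omega) (ho.2 _ (by omega))
    by_cases h1 : o = q
    · subst h1
      exact (v1 (c + 2 * o) (by omega)).2 (by omega) (ho.2 _ (by omega))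
    by_cases h2 : o = 2 * q
    · subst h2
      exact v2 (ho.2 _ (by omega))
    by_cases h3 : o = 3 * q
    · subst h3
      exact (v3 (c - q) (by omega)).2 (by omega) (ho.2 _ (by omega))
    rcases Nat.lt_or_ge o (2 * q) with h4 | h4
    · exact no_occ_near h hc hcN ho v1 h1 (by omega) (by omega)
    · exact no_occ_near h hc hcN ho v3 h3 (by omega) (by omega)
  · intro b _ hb
    rcases (hdiff b).1 hb with rfl | rfl | rfl
    · refine ⟨2 * q, hq.mul_left 2, by omega, fun t ht => ?_⟩
      by_contra hcon
      rw [← ne_eq, fl _ _ _ _ _ (u2 t ht)] at hcon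
      omega
    · refine ⟨0, Even.zero, by omega, fun t ht => ?_⟩
      by_contra hcon
      rw [← ne_eq, fl _ _ _ _ _ (u0 t ht)] at hcon
      omega
    · refine ⟨3 * q, hE3, by omega, fun t ht => ?_⟩
      by_contra hcon
      rw [← ne_eq, fl _ _ _ _ _ (u3 t ht)] at hcon
      omega

/-- In the exception the shift by `q` has `c` as its only error, so the errors of its multiples lie
in the residue class of `c`. If `t₀`, …, `t₀ + m q` are the positions of this class, the shift by
`(m - 1) q` compares only two pairs of the class, and each of them has `c` between its ends: again
exactly two errors. This border is exceptional in its turn only if `m - 1 = 2`, and then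
`stuck_of_short` applies. -/
theorem Err2.stuck {g : ℕ → Bool} {N : ℕ} (hN : Even N) (h : Err2 g N) : Stuck g N := by
  obtain ⟨p, e₁, c, hp, hp0, h12, he, h⟩ := h
  rcases stuck_or_of_err2 hN hp h12 he h with hs | ⟨q, hq, rfl, rfl, h1⟩
  · exact hs
  set c := e₁ + q with hc
  have hq0 : 0 < q := by omega
  set t₀ := c % q with ht₀
  obtain ⟨m, hm⟩ : ∃ m, m = (N - 1 - t₀) / q := ⟨_, rfl⟩
  have ht₀q : t₀ < q := Nat.mod_lt _ hq0
  have hmN : t₀ + m * q < N := by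
    have := Nat.div_mul_le_self (N - 1 - t₀) q
    rw [← hm] at this
    omega
  have hmN' : N ≤ t₀ + (m + 1) * q := by
    have := Nat.lt_div_mul_add (a := N - 1 - t₀) hq0
    rw [← hm] at this
    rw [Nat.succ_mul]
    omega
  obtain ⟨A, hA⟩ : ∃ A, c = t₀ + A * q := ⟨c / q, by
    have := Nat.mod_add_div c q
    rw [mul_comm]; omega⟩
  have hA1 : 1 ≤ A := by
    by_contra hcon
    have : A = 0 := by omega
    subst this
    omega
  -- The original border has errors at `c - q` and `c`, with `c + 2 q < N`, so the class contains at
  -- least one position before `c` and two after it.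
  have hAm : A + 2 ≤ m := by
    by_contra hcon
    have : (m + 1) * q ≤ (A + 2) * q := Nat.mul_le_mul_right q (by omega)
    rw [Nat.add_mul A] at this
    omega
  by_cases hm3 : m = 3
  · have hA1' : A = 1 := by omega
    rw [hA1'] at hA
    rw [hm3] at hmN'
    exact stuck_of_short hN hq hq0 (by omega) (by omega) (by omega) (by omega) h1
  · have hs : t₀ + q + (m - 1) * q < N := by
      obtain ⟨m', hm'⟩ : ∃ m', m = m' + 1 := ⟨m - 1, by omega⟩
      rw [hm'] at hmN
      rw [hm', Nat.add_sub_cancel]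
      rw [Nat.succ_mul] at hmN
      omega
    have hP : ∀ t, t + (m - 1) * q < N →
        (g t ≠ g (t + (m - 1) * q) ↔ t = t₀ ∨ t = t₀ + q) := by
      intro t ht
      rw [errors_mul h1 hq0 (m - 1) t ht]
      constructor
      · rintro ⟨i, hi, hic⟩
        have hiA : i ≤ A := by
          by_contra hcon
          have : (A + 1) * q ≤ i * q := Nat.mul_le_mul_right q (by omega)
          rw [Nat.succ_mul] at this
          omega
        obtain ⟨j, rfl⟩ : ∃ j, A = i + j := ⟨A - i, by omega⟩
        rw [Nat.add_mul] at hA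
        have htj : t = t₀ + j * q := by omega
        have hj : j ≤ 1 := by
          by_contra hcon
          have h2 : (m - 1 + 2) * q ≤ (m - 1 + j) * q := Nat.mul_le_mul_right q (by omega)
          rw [show m - 1 + 2 = m + 1 by omega, Nat.add_mul (m - 1)] at h2
          omega
        interval_cases j
        · left; omega
        · right; omega
      · rintro (rfl | rfl)
        · exact ⟨A, by omega, hA.symm⟩
        · refine ⟨A - 1, by omega, ?_⟩
          obtain ⟨A', rfl⟩ : ∃ A', A = A' + 1 := ⟨A - 1, by omega⟩
          rw [Nat.succ_mul] at hA
          simp only [Nat.add_sub_cancel]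
          omega
    rcases stuck_or_of_err2 hN (hq.mul_left (m - 1)) (show t₀ < t₀ + q by omega) hs hP with
      hs | ⟨q', -, h2, h3, -⟩
    · exact hs
    · have : q' = q := by omega
      subst this
      have := Nat.eq_of_mul_eq_mul_right hq0 h2
      omega

theorem stuck_iff_err2 {g : ℕ → Bool} {N : ℕ} (hN : Even N) : Stuck g N ↔ Err2 g N :=
  ⟨Stuck.err2, Err2.stuck hN⟩

end BitWord


/-! ## The Gray map -/

namespace BitWord

/-- The two bits of a letter under the Gray map `0, 1, 2, 3 ↦ 00, 01, 11, 10`. -/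
def gray (a : ZMod 4) (s : ℕ) : Bool :=
  if s = 0 then decide (2 ≤ a.val) else decide (a.val = 1 ∨ a.val = 2)

/-- The inverse of the Gray map. -/
def ungray (x y : Bool) : ZMod 4 :=
  if x then (if y then 2 else 3) else (if y then 1 else 0)

theorem gray_ungray_zero (x y : Bool) : gray (ungray x y) 0 = x := by
  revert x y; decide

theorem gray_ungray_one (x y : Bool) : gray (ungray x y) 1 = y := by
  revert x y; decide

theorem gray_inj {a c : ZMod 4} (h0 : gray a 0 = gray c 0) (h1 : gray a 1 = gray c 1) : a = c := by
  revert a c; decide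

/-- The Gray code lists the four pairs of bits cyclically so that exactly the cyclic neighbours
differ in one bit. -/
theorem gray_step (a c : ZMod 4) : (a = c + 1 ∨ a = c - 1) ↔
    (gray a 0 = gray c 0 ∧ gray a 1 = !gray c 1) ∨ (gray a 0 = (!gray c 0) ∧ gray a 1 = gray c 1) := by
  revert a c; decide

/-- The bits of a sequence of letters. -/
def seqBits (F : ℕ → ZMod 4) : ℕ → Bool := fun b => gray (F (b / 2)) (b % 2)

/-- A word of length `n`, continued by zeros. -/
def ext {n : ℕ} (u : Fin n → ZMod 4) : ℕ → ZMod 4 := fun t => if h : t < n then u ⟨t, h⟩ else 0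

/-- The word of length `n` with the given bits. -/
def toWord (n : ℕ) (u : ℕ → Bool) : Fin n → ZMod 4 := fun i => ungray (u (2 * i)) (u (2 * i + 1))

theorem seqBits_toWord {n : ℕ} (u : ℕ → Bool) {b : ℕ} (hb : b < 2 * n) :
    seqBits (ext (toWord n u)) b = u b := by
  unfold seqBits ext toWord
  rw [dif_pos (by omega)]
  rcases Nat.mod_two_eq_zero_or_one b with h | h
  · rw [h, gray_ungray_zero]; congr 1; simp only; omega
  · rw [h, gray_ungray_one]; congr 1; simp only; omega

theorem seqBits_two_mul (F : ℕ → ZMod 4) (t : ℕ) : seqBits F (2 * t) = gray (F t) 0 := by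
  unfold seqBits
  rw [show 2 * t / 2 = t by omega, show 2 * t % 2 = 0 by omega]

theorem seqBits_two_mul_add_one (F : ℕ → ZMod 4) (t : ℕ) :
    seqBits F (2 * t + 1) = gray (F t) 1 := by
  unfold seqBits
  rw [show (2 * t + 1) / 2 = t by omega, show (2 * t + 1) % 2 = 1 by omega]

theorem eq_of_seqBits {F G : ℕ → ZMod 4} {t t' : ℕ} (h0 : seqBits F (2 * t) = seqBits G (2 * t'))
    (h1 : seqBits F (2 * t + 1) = seqBits G (2 * t' + 1)) : F t = G t' := by
  rw [seqBits_two_mul, seqBits_two_mul] at h0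
  rw [seqBits_two_mul_add_one, seqBits_two_mul_add_one] at h1
  exact gray_inj h0 h1

theorem seqBits_congr {F G : ℕ → ZMod 4} {b b' : ℕ} (h : F (b / 2) = G (b' / 2))
    (h2 : b % 2 = b' % 2) : seqBits F b = seqBits G b' := by
  unfold seqBits; rw [h, h2]

theorem Contains.congr {g u v : ℕ → Bool} {N M : ℕ} (h : ∀ t < M, u t = v t)
    (hu : Contains g N u M) : Contains g N v M := by
  obtain ⟨o, he, hM, ho⟩ := hu
  exact ⟨o, he, hM, fun t ht => by rw [← h _ (by omega), ho t ht]⟩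

theorem factor_iff {n : ℕ} (f : List (ZMod 4)) (u : Fin n → ZMod 4) :
    f <:+: List.ofFn u ↔ ∃ o, o + f.length ≤ n ∧ ∀ t < f.length, ext u (o + t) = f.getD t 0 := by
  rw [List.infix_iff_getElem?]
  constructor
  · rintro ⟨k, hk, h⟩
    rw [List.length_ofFn] at hk
    refine ⟨k, by omega, fun t ht => ?_⟩
    have := h t ht
    rw [List.getElem?_eq_getElem (by rw [List.length_ofFn]; omega), Option.some_inj,
      List.getElem_ofFn] at this
    unfold ext
    rw [dif_pos (by omega), List.getD_eq_getElem _ _ ht, ← this]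
    congr 2; omega
  · rintro ⟨o, ho, h⟩
    refine ⟨o, by rw [List.length_ofFn]; omega, fun t ht => ?_⟩
    have := h t ht
    rw [List.getElem?_eq_getElem (by rw [List.length_ofFn]; omega), Option.some_inj,
      List.getElem_ofFn]
    unfold ext at this
    rw [dif_pos (by omega), List.getD_eq_getElem _ _ ht] at this
    rw [← this]
    congr 2; omega

/-- Letters start at even bit positions. This is why all occurrences and shifts of bit words are
required to be even. -/
theorem factorFree_iff {n : ℕ} (f : List (ZMod 4)) (u : Fin n → ZMod 4) :
    FactorFree f u ↔
      ¬ Contains (seqBits (fun t => f.getD t 0)) (2 * f.length) (seqBits (ext u)) (2 * n) := by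
  unfold FactorFree
  rw [not_iff_not, factor_iff]
  constructor
  · rintro ⟨o, ho, h⟩
    refine ⟨2 * o, even_two_mul o, by omega, fun t ht => seqBits_congr ?_ (by omega)⟩
    rw [show (2 * o + t) / 2 = o + t / 2 by omega, h _ (by omega)]
  · rintro ⟨o', ⟨o, rfl⟩, ho, h⟩
    refine ⟨o, by omega, fun t ht => eq_of_seqBits (G := fun t => f.getD t 0) ?_ ?_⟩
    · rw [← h _ (by omega)]; congr 1; omega
    · rw [← h _ (by omega)]; congr 1; omega

/-- The number of bits in which two words differ. -/
def ham {n : ℕ} (u v : Fin n → ZMod 4) : ℕ :=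
  ((Finset.range (2 * n)).filter fun b => seqBits (ext u) b ≠ seqBits (ext v) b).card

theorem ext_apply {n : ℕ} (u : Fin n → ZMod 4) (i : Fin n) : ext u i = u i := by
  simp [ext]

theorem word_ext {n : ℕ} {u v : Fin n → ZMod 4}
    (h : ∀ b < 2 * n, seqBits (ext u) b = seqBits (ext v) b) : u = v := by
  funext i
  rw [← ext_apply u, ← ext_apply v]
  exact eq_of_seqBits (h _ (by omega)) (h _ (by omega))

theorem ham_eq_zero {n : ℕ} {u v : Fin n → ZMod 4} : ham u v = 0 ↔ u = v := by
  constructor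
  · intro h
    refine word_ext fun b hb => ?_
    by_contra hcon
    have : b ∈ (∅ : Finset ℕ) := by
      rw [← Finset.card_eq_zero.1 h]
      exact Finset.mem_filter.2 ⟨Finset.mem_range.2 hb, hcon⟩
    simp at this
  · rintro rfl; simp [ham]

theorem adj_iff {n : ℕ} {u v : Fin n → ZMod 4} : (leeCube 4 n).Adj u v ↔
    ∃ b < 2 * n, ∀ t < 2 * n, seqBits (ext v) t = flip (seqBits (ext u)) b t := by
  constructor
  · rintro ⟨-, i, hi, h⟩
    have hi' : ext v i = ext u i + 1 ∨ ext v i = ext u i - 1 := by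
      rw [ext_apply, ext_apply]
      rcases hi with hi | hi
      · right; rw [hi]; ring
      · left; rw [hi]; ring
    have hrest : ∀ t < 2 * n, t / 2 ≠ i → seqBits (ext v) t = seqBits (ext u) t := by
      intro t ht hti
      refine seqBits_congr ?_ rfl
      have := h ⟨t / 2, by omega⟩ (by intro hc; exact hti (by rw [← hc]))
      rw [← ext_apply u, ← ext_apply v] at this
      exact this.symm
    rw [gray_step, ← seqBits_two_mul, ← seqBits_two_mul, ← seqBits_two_mul_add_one,
      ← seqBits_two_mul_add_one] at hi'
    rcases hi' with ⟨h0, h1⟩ | ⟨h0, h1⟩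
    · refine ⟨2 * i + 1, by omega, fun t ht => ?_⟩
      by_cases ht1 : t = 2 * i + 1
      · rw [ht1, flip_self, h1]
      · rw [flip_ne _ ht1]
        by_cases ht2 : t = 2 * i
        · rw [ht2, h0]
        · exact hrest t ht (by omega)
    · refine ⟨2 * i, by omega, fun t ht => ?_⟩
      by_cases ht1 : t = 2 * i
      · rw [ht1, flip_self, h0]
      · rw [flip_ne _ ht1]
        by_cases ht2 : t = 2 * i + 1
        · rw [ht2, h1]
        · exact hrest t ht (by omega)
  · rintro ⟨b, hb, h⟩
    refine ⟨?_, ⟨b / 2, by omega⟩, ?_, ?_⟩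
    · rintro rfl
      have := h b hb
      rw [flip_self] at this
      revert this
      cases seqBits (ext u) b <;> simp
    · have h0 := h (2 * (b / 2)) (by omega)
      have h1 := h (2 * (b / 2) + 1) (by omega)
      have : ext u (b / 2) = ext v (b / 2) + 1 ∨ ext u (b / 2) = ext v (b / 2) - 1 := by
        rw [gray_step, ← seqBits_two_mul, ← seqBits_two_mul, ← seqBits_two_mul_add_one,
          ← seqBits_two_mul_add_one, h0, h1]
        rcases Nat.mod_two_eq_zero_or_one b with hb2 | hb2
        · right
          rw [show 2 * (b / 2) = b by omega, flip_self, flip_ne _ (by omega), Bool.not_not]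
          exact ⟨rfl, rfl⟩
        · left
          rw [show 2 * (b / 2) + 1 = b by omega, flip_self, flip_ne _ (by omega), Bool.not_not]
          exact ⟨rfl, rfl⟩
      simpa [ext, show b / 2 < n by omega] using this
    · intro j hj
      have hjb : (j : ℕ) ≠ b / 2 := fun hc => hj (Fin.ext hc)
      rw [← ext_apply u, ← ext_apply v]
      refine eq_of_seqBits ?_ ?_
      · rw [h _ (by omega), flip_ne _ (by omega)]
      · rw [h _ (by omega), flip_ne _ (by omega)]

theorem ham_flip {n : ℕ} {u v w : Fin n → ZMod 4} {b : ℕ} (hb : b < 2 * n)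
    (h : ∀ t < 2 * n, seqBits (ext w) t = flip (seqBits (ext u)) b t) :
    (seqBits (ext u) b ≠ seqBits (ext v) b → ham w v + 1 = ham u v) ∧
      (seqBits (ext u) b = seqBits (ext v) b → ham w v = ham u v + 1) := by
  constructor
  · intro hne
    unfold ham
    rw [← Finset.card_erase_add_one (s := Finset.filter (fun b => seqBits (ext u) b ≠ _) _) (a := b)
      (Finset.mem_filter.2 ⟨Finset.mem_range.2 hb, hne⟩)]
    congr 2
    ext t
    simp only [Finset.mem_filter, Finset.mem_range, Finset.mem_erase]
    by_cases htb : t = b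
    · subst htb
      simp only [hb, true_and, ne_eq, not_true_eq_false, false_and, iff_false, not_not]
      rw [h _ hb, flip_self]
      revert hne
      cases seqBits (ext u) t <;> cases seqBits (ext v) t <;> simp
    · constructor
      · rintro ⟨h1, h2⟩
        rw [h t h1, flip_ne _ htb] at h2
        exact ⟨htb, h1, h2⟩
      · rintro ⟨-, h1, h2⟩
        rw [h t h1, flip_ne _ htb]
        exact ⟨h1, h2⟩
  · intro he
    unfold ham
    have hb' : seqBits (ext w) b ≠ seqBits (ext v) b := by
      rw [h b hb, flip_self, he]
      cases seqBits (ext v) b <;> simp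
    rw [← Finset.card_erase_add_one (s := Finset.filter (fun b => seqBits (ext w) b ≠ _) _) (a := b)
      (Finset.mem_filter.2 ⟨Finset.mem_range.2 hb, hb'⟩)]
    congr 2
    ext t
    simp only [Finset.mem_filter, Finset.mem_range, Finset.mem_erase]
    by_cases htb : t = b
    · subst htb
      simp [he]
    · constructor
      · rintro ⟨-, h1, h2⟩
        rw [h t h1, flip_ne _ htb] at h2
        exact ⟨h1, h2⟩
      · rintro ⟨h1, h2⟩
        rw [h t h1, flip_ne _ htb]
        exact ⟨htb, h1, h2⟩

/-! ### Distances in the cube and geodesics in induced subgraphs -/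

theorem ham_le_length {n : ℕ} {u v : Fin n → ZMod 4} (p : (leeCube 4 n).Walk u v) :
    ham u v ≤ p.length := by
  induction p with
  | nil => simp [ham_eq_zero.2]
  | @cons u w v hadj p ih =>
    obtain ⟨b, hb, h⟩ := adj_iff.1 hadj
    have := ham_flip (v := v) hb h
    rw [SimpleGraph.Walk.length_cons]
    by_cases hc : seqBits (ext u) b = seqBits (ext v) b
    · have := this.2 hc; omega
    · have := this.1 hc; omega

theorem ham_le_length_induce {n : ℕ} {S : Set (Fin n → ZMod 4)} {u v : S}
    (p : ((leeCube 4 n).induce S).Walk u v) : ham u.1 v.1 ≤ p.length := by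
  have := ham_le_length (p.map (SimpleGraph.Embedding.induce S).toHom)
  rwa [SimpleGraph.Walk.length_map] at this

/-- Isometry is a local matter: if one can always make a step inside `S` that brings the target
nearer, iteration gives a walk as short as the Hamming distance allows. -/
theorem exists_walk_of_steps {n : ℕ} (S : Set (Fin n → ZMod 4))
    (hS : ∀ u ∈ S, ∀ v ∈ S, u ≠ v → ∃ w ∈ S, (leeCube 4 n).Adj u w ∧ ham w v + 1 = ham u v)
    (k : ℕ) : ∀ u v : S, ham u.1 v.1 = k →
      ∃ p : ((leeCube 4 n).induce S).Walk u v, p.length = k := by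
  induction k with
  | zero =>
    intro u v h
    obtain rfl : u = v := Subtype.ext (ham_eq_zero.1 h)
    exact ⟨.nil, rfl⟩
  | succ k ih =>
    intro u v h
    obtain ⟨w, hw, hadj, hham⟩ := hS u.1 u.2 v.1 v.2 (by
      intro hc
      rw [ham_eq_zero.2 hc] at h
      omega)
    obtain ⟨p, hp⟩ := ih ⟨w, hw⟩ v (by simp only; omega)
    exact ⟨.cons (show ((leeCube 4 n).induce S).Adj u ⟨w, hw⟩ from hadj) p, by simp [hp]⟩

theorem exists_flip {n : ℕ} (u : Fin n → ZMod 4) {b : ℕ} (hb : b < 2 * n) :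
    ∃ w : Fin n → ZMod 4, (leeCube 4 n).Adj u w ∧
      ∀ t < 2 * n, seqBits (ext w) t = flip (seqBits (ext u)) b t := by
  refine ⟨toWord n (flip (seqBits (ext u)) b), adj_iff.2 ⟨b, hb, ?_⟩, ?_⟩ <;>
  exact fun t ht => seqBits_toWord _ ht

theorem exists_diff {n : ℕ} {u v : Fin n → ZMod 4} (h : u ≠ v) :
    ∃ b < 2 * n, seqBits (ext u) b ≠ seqBits (ext v) b := by
  by_contra! hcon
  exact h (word_ext hcon)

theorem edist_leeCube {n : ℕ} (u v : Fin n → ZMod 4) : (leeCube 4 n).edist u v = ham u v := by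
  apply le_antisymm
  · obtain ⟨p, hp⟩ := exists_walk_of_steps (n := n) Set.univ (by
      intro u _ v _ huv
      obtain ⟨b, hb, hd⟩ := exists_diff huv
      obtain ⟨w, hw, hfl⟩ := exists_flip u hb
      exact ⟨w, trivial, hw, (ham_flip hb hfl).1 hd⟩) _ ⟨u, trivial⟩ ⟨v, trivial⟩ rfl
    have := SimpleGraph.edist_le (p.map (SimpleGraph.Embedding.induce Set.univ).toHom)
    rw [SimpleGraph.Walk.length_map, hp] at this
    exact this
  · by_contra hcon
    rw [not_le] at hcon
    obtain ⟨p, hp⟩ := SimpleGraph.exists_walk_of_edist_ne_top hcon.ne_top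
    rw [← hp] at hcon
    exact absurd (ham_le_length p) (by exact_mod_cast hcon.not_ge)

/-- Isometry would give a walk from `u` to `v` of length equal to their Hamming distance. Its first
step must invert a difference, as otherwise the rest would be too short; but this creates a copy of
the word. -/
theorem not_leeIsometric_of_stuck {f : List (ZMod 4)}
    (h : Stuck (seqBits fun t => f.getD t 0) (2 * f.length)) : ¬ LeeIsometric f := by
  intro hiso
  obtain ⟨M, u, v, ⟨n, hn⟩, hu, hv, ⟨b₀, hb₀, hd₀⟩, hD⟩ := h
  obtain rfl : M = 2 * n := by omega
  have hub : ∀ b < 2 * n, seqBits (ext (toWord n u)) b = u b := fun b hb => seqBits_toWord u hb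
  have hvb : ∀ b < 2 * n, seqBits (ext (toWord n v)) b = v b := fun b hb => seqBits_toWord v hb
  have hU : FactorFree f (toWord n u) := by
    rw [factorFree_iff]; exact fun hc => hu (hc.congr hub)
  have hV : FactorFree f (toWord n v) := by
    rw [factorFree_iff]; exact fun hc => hv (hc.congr hvb)
  have hne : toWord n u ≠ toWord n v := by
    intro hc
    apply hd₀
    rw [← hub _ hb₀, ← hvb _ hb₀, hc]
  have hdist := hiso n (by omega) ⟨_, hU⟩ ⟨_, hV⟩
  rw [edist_leeCube] at hdist
  obtain ⟨p, hp⟩ := SimpleGraph.exists_walk_of_edist_ne_top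
    (by rw [hdist]; exact ENat.natCast_ne_top _)
  rw [hdist, Nat.cast_inj] at hp
  simp only at hp
  generalize toWord n u = U at *
  generalize toWord n v = V at *
  cases p with
  | nil => exact hne rfl
  | @cons _ w _ hadj p =>
    have hadj' : (leeCube 4 n).Adj U w.1 := hadj
    obtain ⟨b, hb, hfl⟩ := adj_iff.1 hadj'
    have hbe : seqBits (ext U) b = seqBits (ext V) b := by
      by_contra hc
      rw [hub _ hb, hvb _ hb] at hc
      refine (factorFree_iff f w.1).1 w.2 ((hD b hb hc).congr fun t ht => ?_)
      rw [hfl t ht]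
      simp only [flip, hub t ht]
    have h1 := (ham_flip hb hfl).2 hbe
    rw [SimpleGraph.Walk.length_cons] at hp
    have h3 : ham w.1 V ≤ p.length := ham_le_length_induce p
    omega

/-- A pair without a first geodesic step would be stuck, so such steps always exist and
`exists_walk_of_steps` applies. -/
theorem leeIsometric_of_not_stuck {f : List (ZMod 4)}
    (h : ¬ Stuck (seqBits fun t => f.getD t 0) (2 * f.length)) : LeeIsometric f := by
  intro n _ u v
  rw [edist_leeCube]
  apply le_antisymm
  · obtain ⟨p, hp⟩ := exists_walk_of_steps (n := n) {u | FactorFree f u} (by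
      intro u hu v hv huv
      by_contra hcon
      apply h
      refine ⟨2 * n, seqBits (ext u), seqBits (ext v), even_two_mul n, (factorFree_iff f u).1 hu,
        (factorFree_iff f v).1 hv, exists_diff huv, fun b hb hd => ?_⟩
      obtain ⟨w, hw, hfl⟩ := exists_flip u hb
      by_contra hc
      refine hcon ⟨w, ?_, hw, (ham_flip hb hfl).1 hd⟩
      exact (factorFree_iff f w).2 fun hc' => hc (hc'.congr hfl)) _ u v rfl
    rw [← hp]
    exact SimpleGraph.edist_le p
  · by_contra hcon
    rw [not_le] at hcon
    obtain ⟨p, hp⟩ := SimpleGraph.exists_walk_of_edist_ne_top hcon.ne_top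
    rw [← hp] at hcon
    have h2 : ham u.1 v.1 ≤ p.length := ham_le_length_induce p
    exact absurd h2 (by exact_mod_cast hcon.not_ge)

/-- A word over `ℤ/4` is Lee-isometric iff it has no border with two Lee errors. -/
theorem leeIsometric_iff (f : List (ZMod 4)) :
    LeeIsometric f ↔ ¬ Err2 (seqBits fun t => f.getD t 0) (2 * f.length) := by
  rw [← stuck_iff_err2 (even_two_mul _)]
  exact ⟨fun h hs => not_leeIsometric_of_stuck hs h, leeIsometric_of_not_stuck⟩

end BitWord


/-! ## Reasoning about programs of the word RAM -/

namespace WordRAM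

instance : Add Expr := ⟨.bin .add⟩
instance : Sub Expr := ⟨.bin .sub⟩
instance : Mul Expr := ⟨.bin .mul⟩
instance : Div Expr := ⟨.bin .div⟩
instance : Mod Expr := ⟨.bin .mod⟩

/-- The comparison `e₁ < e₂`. -/
def Expr.lt (e₁ e₂ : Expr) : Expr := .bin .lt e₁ e₂

/-- The comparison `e₁ = e₂`. -/
def Expr.eq (e₁ e₂ : Expr) : Expr := .bin .eq e₁ e₂

/-- All array indices used in the evaluation of the expression are less than `L`. -/
def Expr.Safe (L : ℕ) (s : State) : Expr → Prop
  | .const _ => True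
  | .reg _ => True
  | .read _ i => i.Safe L s ∧ i.eval s < L
  | .bin _ e₁ e₂ => e₁.Safe L s ∧ e₂.Safe L s

section
variable (L : ℕ) (s : State) (e₁ e₂ : Expr)

@[simp] theorem Expr.eval_add : (e₁ + e₂).eval s = e₁.eval s + e₂.eval s := rfl
@[simp] theorem Expr.eval_sub : (e₁ - e₂).eval s = e₁.eval s - e₂.eval s := rfl
@[simp] theorem Expr.eval_mul : (e₁ * e₂).eval s = e₁.eval s * e₂.eval s := rfl
@[simp] theorem Expr.eval_div : (e₁ / e₂).eval s = e₁.eval s / e₂.eval s := rfl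
@[simp] theorem Expr.eval_mod : (e₁ % e₂).eval s = e₁.eval s % e₂.eval s := rfl
@[simp] theorem Expr.eval_lt :
    (e₁.lt e₂).eval s = if e₁.eval s < e₂.eval s then 1 else 0 := rfl
@[simp] theorem Expr.eval_eq :
    (e₁.eq e₂).eval s = if e₁.eval s = e₂.eval s then 1 else 0 := rfl
@[simp] theorem Expr.eval_const (k : ℕ) : (Expr.const k).eval s = k := rfl
@[simp] theorem Expr.eval_reg (x : ℕ) : (Expr.reg x).eval s = s.reg x := rfl
@[simp] theorem Expr.eval_read (a : ℕ) : (Expr.read a e₁).eval s = s.arr a (e₁.eval s) := rfl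
@[simp] theorem Expr.safe_add : (e₁ + e₂).Safe L s ↔ e₁.Safe L s ∧ e₂.Safe L s := Iff.rfl
@[simp] theorem Expr.safe_sub : (e₁ - e₂).Safe L s ↔ e₁.Safe L s ∧ e₂.Safe L s := Iff.rfl
@[simp] theorem Expr.safe_mul : (e₁ * e₂).Safe L s ↔ e₁.Safe L s ∧ e₂.Safe L s := Iff.rfl
@[simp] theorem Expr.safe_div : (e₁ / e₂).Safe L s ↔ e₁.Safe L s ∧ e₂.Safe L s := Iff.rfl
@[simp] theorem Expr.safe_mod : (e₁ % e₂).Safe L s ↔ e₁.Safe L s ∧ e₂.Safe L s := Iff.rfl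
@[simp] theorem Expr.safe_lt : (e₁.lt e₂).Safe L s ↔ e₁.Safe L s ∧ e₂.Safe L s := Iff.rfl
@[simp] theorem Expr.safe_eq : (e₁.eq e₂).Safe L s ↔ e₁.Safe L s ∧ e₂.Safe L s := Iff.rfl
@[simp] theorem Expr.safe_const (k : ℕ) : (Expr.const k).Safe L s ↔ True := Iff.rfl
@[simp] theorem Expr.safe_reg (x : ℕ) : (Expr.reg x).Safe L s ↔ True := Iff.rfl
@[simp] theorem Expr.safe_read (a : ℕ) :
    (Expr.read a e₁).Safe L s ↔ e₁.Safe L s ∧ e₁.eval s < L := Iff.rfl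

@[simp] theorem State.setReg_reg (x v y : ℕ) :
    (s.setReg x v).reg y = if y = x then v else s.reg y := by
  simp [State.setReg, Function.update_apply]
@[simp] theorem State.setReg_arr (x v : ℕ) : (s.setReg x v).arr = s.arr := rfl
@[simp] theorem State.setArr_reg (a i v : ℕ) : (s.setArr a i v).reg = s.reg := rfl
@[simp] theorem State.setArr_arr (a i v c j : ℕ) :
    (s.setArr a i v).arr c j = if c = a then (if j = i then v else s.arr a j) else s.arr c j := by
  simp only [State.setArr, Function.update_apply]
  split_ifs <;> simp_all

theorem State.setArr_arr_of_ne {a c : ℕ} (h : c ≠ a) (i v : ℕ) : (s.setArr a i v).arr c = s.arr c := by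
  simp [State.setArr, Function.update_of_ne h]

end

/-- All cells of the state hold values at most `L`. -/
def Bdd (L : ℕ) (s : State) : Prop := (∀ x, s.reg x ≤ L) ∧ ∀ a i, s.arr a i ≤ L

/-- All constants in the expression are at most `4`. -/
def Expr.smallConst : Expr → Bool
  | .const k => decide (k ≤ 4)
  | .reg _ => true
  | .read _ i => i.smallConst
  | .bin _ e₁ e₂ => e₁.smallConst && e₂.smallConst

/-- The expressions of the program have cost at most `M` and constants at most `4`. -/
def Prog.small (M : ℕ) : Prog → Bool
  | .skip => true
  | .assign _ e => decide (e.cost ≤ M) && e.smallConst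
  | .store _ i e => decide (i.cost + e.cost ≤ M) && i.smallConst && e.smallConst
  | .seq p q => p.small M && q.small M
  | .cond e p q => decide (e.cost ≤ M) && e.smallConst && p.small M && q.small M
  | .loop e p => decide (e.cost ≤ M) && e.smallConst && p.small M

/-- The program contains an assignment to the register. -/
def Prog.writesReg (x : ℕ) : Prog → Bool
  | .skip => false
  | .assign y _ => y == x
  | .store _ _ _ => false
  | .seq p q => p.writesReg x || q.writesReg x
  | .cond _ p q => p.writesReg x || q.writesReg x
  | .loop _ p => p.writesReg x

/-- The program contains a store into the array. -/
def Prog.writesArr (a : ℕ) : Prog → Bool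
  | .skip => false
  | .assign _ _ => false
  | .store c _ _ => c == a
  | .seq p q => p.writesArr a || q.writesArr a
  | .cond _ p q => p.writesArr a || q.writesArr a
  | .loop _ p => p.writesArr a

/-- The states differ only in places that the program writes to. -/
structure Frame (p : Prog) (s s' : State) : Prop where
  reg : ∀ x, p.writesReg x = false → s'.reg x = s.reg x
  arr : ∀ a, p.writesArr a = false → s'.arr a = s.arr a

theorem Frame.refl (p : Prog) (s : State) : Frame p s s := ⟨fun _ _ => rfl, fun _ _ => rfl⟩

theorem Frame.trans {p : Prog} {s₁ s₂ s₃ : State} (h : Frame p s₁ s₂) (h' : Frame p s₂ s₃) :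
    Frame p s₁ s₃ :=
  ⟨fun x hx => (h'.reg x hx).trans (h.reg x hx), fun x hx => (h'.arr x hx).trans (h.arr x hx)⟩

theorem Frame.mono {p q : Prog} {s s' : State} (h : Frame p s s')
    (hr : ∀ x, q.writesReg x = false → p.writesReg x = false)
    (ha : ∀ x, q.writesArr x = false → p.writesArr x = false) : Frame q s s' :=
  ⟨fun x hx => h.reg x (hr x hx), fun x hx => h.arr x (ha x hx)⟩

theorem Exec.frame {S W : ℕ} {p : Prog} {s s' : State} {t : ℕ} (h : Exec S W p s s' t) :
    Frame p s s' := by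
  induction h with
  | skip => exact Frame.refl _ _
  | assign x e s he =>
    refine ⟨fun y hy => ?_, fun a _ => rfl⟩
    have : y ≠ x := by
      rintro rfl
      simp [Prog.writesReg] at hy
    simp [this]
  | store a i e s hi hS he =>
    refine ⟨fun y _ => rfl, fun c hc => ?_⟩
    have : c ≠ a := by
      rintro rfl
      simp [Prog.writesArr] at hc
    funext j
    simp [this]
  | seq _ _ ih₁ ih₂ =>
    refine (ih₁.mono ?_ ?_).trans (ih₂.mono ?_ ?_) <;>
      simp +contextual [Prog.writesReg, Prog.writesArr]
  | condTrue _ _ _ ih => refine ih.mono ?_ ?_ <;> simp +contextual [Prog.writesReg, Prog.writesArr]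
  | condFalse _ _ _ ih => refine ih.mono ?_ ?_ <;> simp +contextual [Prog.writesReg, Prog.writesArr]
  | loopTrue _ _ _ _ ih₁ ih₂ =>
    refine (ih₁.mono ?_ ?_).trans ih₂ <;> simp +contextual [Prog.writesReg, Prog.writesArr]
  | loopFalse => exact Frame.refl _ _

theorem Op.eval_le_of_le {o : Op} {x y X Y A : ℕ} (hA : 4 ≤ A) (hX : 1 ≤ X) (hY : 1 ≤ Y)
    (hx : x ≤ X) (hy : y ≤ Y) : o.eval x y ≤ X * Y * A := by
  have hXY : 1 ≤ X * Y := Nat.mul_pos hX hY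
  have hXl : X ≤ X * Y := Nat.le_mul_of_pos_right _ hY
  have hYl : Y ≤ X * Y := Nat.le_mul_of_pos_left _ hX
  have hm : x * y ≤ X * Y := Nat.mul_le_mul hx hy
  have hA' : X * Y * 4 ≤ X * Y * A := Nat.mul_le_mul_left _ hA
  cases o with
  | add => simp only [Op.eval]; omega
  | sub => simp only [Op.eval]; omega
  | mul => simp only [Op.eval]; omega
  | div =>
    have := Nat.div_le_self x y
    simp only [Op.eval]; omega
  | mod =>
    have := Nat.mod_le x y
    simp only [Op.eval]; omega
  | lt => simp only [Op.eval]; split_ifs <;> omega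
  | eq => simp only [Op.eval]; split_ifs <;> omega

/-- No operation grows faster than the product of bounds for its arguments times a small constant.
So the bounds multiply along an expression, the exponent being its cost; for expressions of bounded
cost, intermediate values stay polynomial in `L`. -/
theorem Expr.eval_le {L : ℕ} {s : State} (hs : Bdd L s) {e : Expr} (he : e.smallConst = true) :
    e.eval s ≤ (L + 4) ^ e.cost := by
  induction e with
  | const k =>
    simp only [smallConst, decide_eq_true_eq] at he
    simp only [eval, cost, pow_one]; omega
  | reg x =>
    have := hs.1 x
    simp only [eval, cost, pow_one]; omega
  | read a i ih =>
    have := hs.2 a (i.eval s)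
    simp only [eval, cost, pow_succ]
    have h1 : 1 ≤ (L + 4) ^ i.cost := Nat.one_le_pow _ _ (by omega)
    have h2 : 1 * (L + 4) ≤ (L + 4) ^ i.cost * (L + 4) := Nat.mul_le_mul_right _ h1
    omega
  | bin o e₁ e₂ ih₁ ih₂ =>
    simp only [smallConst, Bool.and_eq_true] at he
    simp only [eval, cost, pow_succ, pow_add]
    exact Op.eval_le_of_le (by omega) (Nat.one_le_pow _ _ (by omega))
      (Nat.one_le_pow _ _ (by omega)) (ih₁ he.1) (ih₂ he.2)

/-- Disposes of all word-size conditions at once: for small expressions only the array indices are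
left to check. -/
theorem Expr.fits {L M W : ℕ} {s : State} (hs : Bdd L s) (hW : (L + 4) ^ M < W) {e : Expr}
    (hc : e.cost ≤ M) (he : e.smallConst = true) (hsafe : e.Safe L s) : e.Fits L W s := by
  have key : ∀ e : Expr, e.cost ≤ M → e.smallConst = true → e.eval s < W := fun e h1 h2 =>
    ((Expr.eval_le hs h2).trans (Nat.pow_le_pow_right (by omega) h1)).trans_lt hW
  induction e with
  | const k => exact key _ hc he
  | reg x => exact key _ hc he
  | read a i ih =>
    exact ⟨ih ((Nat.le_succ _).trans hc) he hsafe.1, hsafe.2, key (.read a i) hc he⟩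
  | bin o e₁ e₂ ih₁ ih₂ =>
    have h1 := key _ hc he
    simp only [smallConst, Bool.and_eq_true] at he
    simp only [cost] at hc
    exact ⟨ih₁ (by omega) he.1 hsafe.1, ih₂ (by omega) he.2 hsafe.2, h1⟩

/-! ### A calculus of total correctness with step counts and resource bounds -/

/-- Started in `s`, the program halts after at most `k` elementary statements in a state with the
property `Q`, using only indices less than `L` and storing only values at most `L`. -/
def Wp (L : ℕ) (p : Prog) (s : State) (k : ℕ) (Q : State → Prop) : Prop :=
  ∀ M W, p.small M = true → (L + 4) ^ M < W → Bdd L s →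
    ∃ s' t, Exec L W p s s' t ∧ t ≤ (M + 1) * k ∧ Bdd L s' ∧ Q s'

section
variable {L : ℕ} {p q : Prog} {s : State} {k k' : ℕ} {Q Q' : State → Prop}

theorem Wp.mono (h : Wp L p s k Q) (hk : k ≤ k') (hQ : ∀ s', Frame p s s' → Q s' → Q' s') :
    Wp L p s k' Q' := by
  intro M W hM hW hs
  obtain ⟨s', t, he, ht, hb, hq⟩ := h M W hM hW hs
  exact ⟨s', t, he, ht.trans (Nat.mul_le_mul_left _ hk), hb, hQ _ he.frame hq⟩

theorem Wp.seq (h : Wp L p s k (fun s' => Wp L q s' k' Q)) :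
    Wp L (.seq p q) s (k + k') Q := by
  intro M W hM hW hs
  simp only [Prog.small, Bool.and_eq_true] at hM
  obtain ⟨s₁, t₁, he₁, ht₁, hb₁, hq₁⟩ := h M W hM.1 hW hs
  obtain ⟨s₂, t₂, he₂, ht₂, hb₂, hq₂⟩ := hq₁ M W hM.2 hW hb₁
  refine ⟨s₂, _, he₁.seq he₂, ?_, hb₂, hq₂⟩
  rw [Nat.mul_add]
  exact Nat.add_le_add ht₁ ht₂

/-- `h` describes the first part, `hq` continues from the states that it can reach. -/
theorem Wp.andThen {R : State → Prop} (h : Wp L p s k R)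
    (hq : ∀ s', Frame p s s' → R s' → Wp L q s' k' Q) : Wp L (.seq p q) s (k + k') Q :=
  Wp.seq (h.mono le_rfl hq)

theorem Bdd.setReg (hs : Bdd L s) {x v : ℕ} (hv : v ≤ L) : Bdd L (s.setReg x v) := by
  refine ⟨fun y => ?_, hs.2⟩
  rw [State.setReg_reg]
  split_ifs
  exacts [hv, hs.1 y]

theorem Bdd.setArr (hs : Bdd L s) {a i v : ℕ} (hv : v ≤ L) : Bdd L (s.setArr a i v) := by
  refine ⟨hs.1, fun c j => ?_⟩
  rw [State.setArr_arr]
  split_ifs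
  exacts [hv, hs.2 a j, hs.2 c j]

theorem Wp.skip (hQ : Q s) : Wp L .skip s 1 Q := by
  intro M W _ _ hs
  exact ⟨s, 1, .skip s, by omega, hs, hQ⟩

theorem Wp.assign {x : ℕ} {e : Expr} (h1 : e.Safe L s) (h2 : e.eval s ≤ L)
    (hQ : Q (s.setReg x (e.eval s))) : Wp L (.assign x e) s 1 Q := by
  intro M W hM hW hs
  simp only [Prog.small, Bool.and_eq_true, decide_eq_true_eq] at hM
  exact ⟨_, _, .assign x e s (Expr.fits hs hW hM.1 hM.2 h1), by omega, hs.setReg h2, hQ⟩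

theorem Wp.store {a : ℕ} {i e : Expr} (h1 : i.Safe L s) (h2 : i.eval s < L) (h3 : e.Safe L s)
    (h4 : e.eval s ≤ L) (hQ : Q (s.setArr a (i.eval s) (e.eval s))) :
    Wp L (.store a i e) s 1 Q := by
  intro M W hM hW hs
  simp only [Prog.small, Bool.and_eq_true, decide_eq_true_eq] at hM
  exact ⟨_, _, .store a i e s (Expr.fits hs hW (by omega) hM.1.2 h1) h2
    (Expr.fits hs hW (by omega) hM.2 h3), by omega, hs.setArr h4, hQ⟩

theorem Wp.cond {e : Expr} (h1 : e.Safe L s) (hp : e.eval s ≠ 0 → Wp L p s k Q)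
    (hq : e.eval s = 0 → Wp L q s k' Q) : Wp L (.cond e p q) s (max k k' + 1) Q := by
  intro M W hM hW hs
  simp only [Prog.small, Bool.and_eq_true, decide_eq_true_eq] at hM
  have hf := Expr.fits hs hW hM.1.1.1 hM.1.1.2 h1
  by_cases h : e.eval s = 0
  · obtain ⟨s', t, he, ht, hb, hQ⟩ := hq h M W hM.2 hW hs
    refine ⟨s', _, .condFalse hf h he, ?_, hb, hQ⟩
    have : (M + 1) * k' ≤ (M + 1) * max k k' := Nat.mul_le_mul_left _ (le_max_right _ _)
    rw [Nat.mul_succ]; omega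
  · obtain ⟨s', t, he, ht, hb, hQ⟩ := hp h M W hM.1.2 hW hs
    refine ⟨s', _, .condTrue hf h he, ?_, hb, hQ⟩
    have : (M + 1) * k ≤ (M + 1) * max k k' := Nat.mul_le_mul_left _ (le_max_left _ _)
    rw [Nat.mul_succ]; omega

end

/-- The verification condition of a program without loops. -/
def Prog.vc (L : ℕ) : Prog → State → (State → Prop) → Prop
  | .skip, s, Q => Q s
  | .assign x e, s, Q => e.Safe L s ∧ e.eval s ≤ L ∧ Q (s.setReg x (e.eval s))
  | .store a i e, s, Q => (i.Safe L s ∧ i.eval s < L) ∧ (e.Safe L s ∧ e.eval s ≤ L) ∧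
      Q (s.setArr a (i.eval s) (e.eval s))
  | .seq p q, s, Q => p.vc L s (fun s' => q.vc L s' Q)
  | .cond e p q, s, Q =>
      e.Safe L s ∧ (e.eval s ≠ 0 → p.vc L s Q) ∧ (e.eval s = 0 → q.vc L s Q)
  | .loop _ _, _, _ => False

/-- A bound on the number of steps of a program without loops. -/
def Prog.size : Prog → ℕ
  | .skip => 1
  | .assign _ _ => 1
  | .store _ _ _ => 1
  | .seq p q => p.size + q.size
  | .cond _ p q => max p.size q.size + 1
  | .loop _ _ => 0

theorem Wp.of_vc {L : ℕ} {p : Prog} {s : State} {Q : State → Prop} (h : p.vc L s Q) :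
    Wp L p s p.size Q := by
  induction p generalizing s Q with
  | skip => exact Wp.skip h
  | assign x e => exact Wp.assign h.1 h.2.1 h.2.2
  | store a i e => exact Wp.store h.1.1 h.1.2 h.2.1.1 h.2.1.2 h.2.2
  | seq p q ihp ihq =>
    refine Wp.seq ((ihp (Q := fun s' => q.vc L s' Q) h).mono le_rfl fun s' _ hs' => ihq hs')
  | cond e p q ihp ihq => exact Wp.cond h.1 (fun h1 => ihp (h.2.1 h1)) fun h1 => ihq (h.2.2 h1)
  | loop => exact h.elim

theorem Wp.of_vc' {L : ℕ} {p : Prog} {s : State} {k : ℕ} {Q : State → Prop} (h : p.vc L s Q)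
    (hk : p.size ≤ k) : Wp L p s k Q := (Wp.of_vc h).mono hk fun _ _ h => h

/-- Run the program with the register `x` counting up from `0` while it is less than `e`. -/
def Prog.forTo (x : ℕ) (e : Expr) (p : Prog) : Prog :=
  .seq (.assign x (.const 0)) (.loop ((Expr.reg x).lt e) (.seq p (.assign x (.reg x + .const 1))))

theorem writesReg_forTo {x y : ℕ} {e : Expr} {p : Prog} :
    (Prog.forTo x e p).writesReg y = ((x == y) || p.writesReg y) := by
  simp only [Prog.forTo, Prog.writesReg]
  cases x == y <;> cases p.writesReg y <;> rfl

theorem writesArr_forTo {x y : ℕ} {e : Expr} {p : Prog} :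
    (Prog.forTo x e p).writesArr y = p.writesArr y := by
  simp [Prog.forTo, Prog.writesArr]

/-- Besides the invariant, `hstep` and `hQ` may use `Frame`, that is, that whatever the loop never
writes is unchanged; so invariants need to mention only what changes. Each round pays for the test,
the body and the increment, whence `k + 2`; the final `2` pays for the initialization and the last
test. -/
theorem Wp.forTo {L x N k : ℕ} {e : Expr} {p : Prog} {s₀ : State} {Q : State → Prop}
    (I : ℕ → State → Prop) (hN : N ≤ L) (hx : p.writesReg x = false)
    (he : ∀ s, Frame (.forTo x e p) s₀ s → e.Safe L s ∧ e.eval s = N)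
    (h0 : I 0 (s₀.setReg x 0))
    (hstep : ∀ j s, j < N → Frame (.forTo x e p) s₀ s → s.reg x = j → I j s →
      Wp L p s k (fun s' => I (j + 1) (s'.setReg x (j + 1))))
    (hQ : ∀ s, Frame (.forTo x e p) s₀ s → s.reg x = N → I N s → Q s) :
    Wp L (.forTo x e p) s₀ (N * (k + 2) + 2) Q := by
  have hfr : ∀ s v, Frame (.forTo x e p) s₀ s → Frame (.forTo x e p) s₀ (s.setReg x v) := by
    intro s v h
    refine ⟨fun y hy => ?_, h.arr⟩
    have : y ≠ x := by
      rintro rfl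
      simp [writesReg_forTo] at hy
    rw [State.setReg_reg, if_neg this, h.reg y hy]
  have loop : ∀ m j s, j + m = N → Frame (.forTo x e p) s₀ s → s.reg x = j → I j s →
      Wp L (.loop ((Expr.reg x).lt e) (.seq p (.assign x (.reg x + .const 1)))) s
        (m * (k + 2) + 1) Q := by
    intro m
    induction m with
    | zero =>
      intro j s hj hf hxs hI M W hM hW hs
      simp only [Prog.small, Bool.and_eq_true, decide_eq_true_eq] at hM
      obtain ⟨h1, h2⟩ := he s hf
      refine ⟨s, _, .loopFalse (Expr.fits hs hW hM.1.1 hM.1.2 ⟨trivial, h1⟩) ?_, ?_, hs, ?_⟩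
      · simp [h2, hxs]; omega
      · omega
      · obtain rfl : j = N := by omega
        exact hQ s hf hxs hI
    | succ m ih =>
      intro j s hj hf hxs hI M W hM hW hs
      have hM0 := hM
      simp only [Prog.small, Bool.and_eq_true, decide_eq_true_eq] at hM
      obtain ⟨h1, h2⟩ := he s hf
      obtain ⟨s₁, t₁, he₁, ht₁, hb₁, hI₁⟩ := hstep j s (by omega) hf hxs hI M W hM.2.1 hW hs
      have hf₁ : Frame (.forTo x e p) s₀ s₁ := hf.trans (he₁.frame.mono
        (fun y hy => by rw [writesReg_forTo, Bool.or_eq_false_iff] at hy; exact hy.2)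
        (fun y hy => by rwa [writesArr_forTo] at hy))
      have hxs₁ : s₁.reg x = j := by rw [he₁.frame.reg x hx, hxs]
      obtain ⟨s₂, t₂, he₂, ht₂, hb₂, hQ₂⟩ := ih (j + 1) (s₁.setReg x (j + 1)) (by omega)
        (hfr _ _ hf₁) (by simp) hI₁ M W hM0 hW (hb₁.setReg (by omega))
      have hinc := Exec.assign x (.reg x + .const 1) s₁
          (Expr.fits hb₁ hW hM.2.2.1 hM.2.2.2 (by simp))
      have hev : (Expr.reg x + .const 1 : Expr).eval s₁ = j + 1 := by simp [hxs₁]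
      rw [hev] at hinc
      refine ⟨s₂, _, .loopTrue (Expr.fits hs hW hM.1.1 hM.1.2 ⟨trivial, h1⟩) ?_
        (he₁.seq hinc) he₂, ?_, hb₂, hQ₂⟩
      · simp [h2, hxs]; omega
      · have e1 : (M + 1) * ((m + 1) * (k + 2) + 1) =
            (M + 1) * (m * (k + 2) + 1) + (M + 1) * k + (M + 1) * 2 := by ring
        rw [e1]
        omega
  have h2 : N * (k + 2) + 2 = 1 + (N * (k + 2) + 1) := by omega
  rw [h2]
  refine Wp.seq (Wp.assign trivial (by simp) ?_)
  exact loop N 0 _ (by omega) (hfr _ _ (Frame.refl _ _)) (by simp) h0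

end WordRAM


/-! ## Parameters and tables -/

namespace WordRAM

infixr:60 " ;; " => Prog.seq

/-- Compute `2^a`, `4^a`, `2a` in registers `1`, `2`, `3`, where `4^a` is about `log n`. -/
def paramP : Prog :=
  .assign 7 (.const 1) ;; .assign 8 (.const 0) ;;
  .forTo 6 (.reg 0) (.cond ((.reg 0 + .const 1 : Expr).lt (.const 4 * .reg 7)) .skip
    (.assign 7 (.const 4 * .reg 7) ;; .assign 8 (.reg 8 + .const 1))) ;;
  .assign 1 (.const 1) ;; .assign 2 (.const 1) ;; .assign 3 (.const 0) ;;
  .forTo 6 (.reg 0) (.cond ((Expr.reg 8).lt (.const 4 * .reg 2)) .skip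
    (.assign 2 (.const 4 * .reg 2) ;; .assign 1 (.const 2 * .reg 1) ;;
      .assign 3 (.reg 3 + .const 2)))

/-- The integer logarithm to base `4` is taken twice: `l` of `n + 1`, then `a` of `l`, with `a = 0`
if `l = 0`. The loops make `n` rounds and idle once the power cannot be multiplied by `4` any more.
The last bound combines `n + 1 < 4 ^ (l + 1)` with `l + 1 ≤ 4 * 4 ^ a`. -/
theorem paramP_spec {L n : ℕ} {s : State} (hn : s.reg 0 = n) (hL : 4 * (n + 1) ≤ L) :
    Wp L paramP s (20 * (n + 1)) (fun s' => ∃ a, s'.reg 1 = 2 ^ a ∧ s'.reg 2 = 4 ^ a ∧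
      s'.reg 3 = 2 * a ∧ (a = 0 ∨ 4 ^ 4 ^ a ≤ n + 1) ∧ n + 1 < 4 ^ (4 * 4 ^ a)) := by
  unfold paramP
  refine Wp.mono (k := 1 + (1 + ((n * (3 + 2) + 2) + (1 + (1 + (1 + (n * (4 + 2) + 2))))))) ?_
    (by omega) fun _ _ h => h
  refine Wp.seq (Wp.assign (by simp) (by simp; omega) (Wp.seq (Wp.assign (by simp) (by simp) ?_)))
  refine Wp.andThen (R := fun s' => ∃ l, s'.reg 8 = l ∧ 4 ^ l ≤ n + 1 ∧ n + 1 < 4 ^ (l + 1))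
    (Wp.forTo (N := n) (fun j s' => ∃ l, s'.reg 8 = l ∧ s'.reg 7 = 4 ^ l ∧ 4 ^ l ≤ n + 1 ∧
      (l = j ∨ n + 1 < 4 ^ (l + 1))) (by omega) rfl ?_ ?_ ?_ ?_) ?_
  · intro s' hf
    simp [hf.reg 0 rfl, hn]
  · exact ⟨0, by simp⟩
  · rintro j s' hj hf hs ⟨l, h8, h7, hl, hor⟩
    refine Wp.of_vc' ?_ le_rfl
    have h0 : s'.reg 0 = n := by rw [hf.reg 0 rfl]; simp [hn]
    simp only [Prog.vc, Expr.eval_lt, Expr.eval_add, Expr.eval_mul, Expr.eval_const, Expr.eval_reg,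
      h0, h7, Expr.safe_lt, Expr.safe_add, Expr.safe_mul, Expr.safe_reg, Expr.safe_const]
    refine ⟨by simp, fun hc => ⟨l, ?_⟩, fun hc => ?_⟩
    · have : n + 1 < 4 * 4 ^ l := by by_contra h; simp [h] at hc
      simp [h8, h7, hl, pow_succ]; omega
    · have : 4 * 4 ^ l ≤ n + 1 := by by_contra h; simp [show n + 1 < 4 * 4 ^ l by omega] at hc
      have hll : l < 4 ^ l := Nat.lt_pow_self (by omega)
      simp only [State.setReg_reg, h8]
      refine ⟨by simp, by omega, by simp, by simp; omega, l + 1, ?_⟩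
      rw [pow_succ] at *
      simp
      omega
  · rintro s' hf hs ⟨l, h8, h7, hl, hor⟩
    refine ⟨l, h8, hl, ?_⟩
    rcases hor with rfl | h
    · have hll : l < 4 ^ l := Nat.lt_pow_self (by omega)
      omega
    · exact h
  rintro s₁ hf₁ ⟨l, h8, hl, hl'⟩
  have hn₁ : s₁.reg 0 = n := by rw [hf₁.reg 0 rfl]; simp [hn]
  have hll : l < 4 ^ l := Nat.lt_pow_self (by omega)
  refine Wp.seq (Wp.assign (by simp) (by simp; omega) (Wp.seq (Wp.assign (by simp) (by simp; omega)
    (Wp.seq (Wp.assign (by simp) (by simp) ?_)))))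
  refine Wp.forTo (N := n) (fun j s' => ∃ a, s'.reg 1 = 2 ^ a ∧ s'.reg 2 = 4 ^ a ∧
      s'.reg 3 = 2 * a ∧ (a = 0 ∨ 4 ^ a ≤ l) ∧ (a = j ∨ l < 4 ^ (a + 1))) (by omega) rfl ?_ ?_ ?_ ?_
  · intro s' hf
    simp [hf.reg 0 rfl, hn₁]
  · exact ⟨0, by simp⟩
  · rintro j s' hj hf hs ⟨a, h1, h2, h3, hal, hor⟩
    refine Wp.of_vc' ?_ le_rfl
    have h8' : s'.reg 8 = l := by rw [hf.reg 8 rfl]; simp [h8]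
    simp only [Prog.vc, Expr.eval_lt, Expr.eval_mul, Expr.eval_const, Expr.eval_reg,
      h8', h2, Expr.safe_lt, Expr.safe_mul, Expr.safe_reg, Expr.safe_const]
    refine ⟨by simp, fun hc => ⟨a, ?_⟩, fun hc => ?_⟩
    · have : l < 4 * 4 ^ a := by by_contra h; simp [h] at hc
      simp [h1, h2, h3, hal, pow_succ]; omega
    · have : 4 * 4 ^ a ≤ l := by by_contra h; simp [show l < 4 * 4 ^ a by omega] at hc
      have h24 : 2 ^ a ≤ 4 ^ a := Nat.pow_le_pow_left (by omega) a
      have ha4 : a < 4 ^ a := Nat.lt_pow_self (by omega)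
      simp only [State.setReg_reg]
      refine ⟨by simp, by omega, by simp, by simp [h1]; omega, by simp, by simp [h3]; omega, a + 1, ?_⟩
      simp [h1, h3, pow_succ]
      omega
  · rintro s' hf hs ⟨a, h1, h2, h3, hal, hor⟩
    refine ⟨a, h1, h2, h3, ?_, ?_⟩
    · refine hal.imp_right fun h => (Nat.pow_le_pow_right (by omega) h).trans hl
    · refine hl'.trans_le (Nat.pow_le_pow_right (by omega) ?_)
      rw [pow_succ] at hor
      have ha4 : a < 4 ^ a := Nat.lt_pow_self (by omega)
      rcases hor with rfl | h
      · rcases hal with h | h <;> omega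
      · omega

end WordRAM


/-! ### Block codes and lookup tables -/

namespace WordRAM

/-- The block of length `b` at position `t` of `F`, read as a number in base `4`. -/
def code (F : ℕ → ℕ) : ℕ → ℕ → ℕ
  | 0, _ => 0
  | b + 1, t => F t + 4 * code F b (t + 1)

section
variable {F : ℕ → ℕ} (hF : ∀ t, F t < 4)
include hF

theorem code_lt (b t : ℕ) : code F b t < 4 ^ b := by
  induction b generalizing t with
  | zero => simp [code]
  | succ b ih =>
    have h1 := ih (t + 1)
    have h2 := hF t
    simp only [code, pow_succ]
    omega

theorem code_eq_iff (b x y : ℕ) : code F b x = code F b y ↔ ∀ i < b, F (x + i) = F (y + i) := by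
  induction b generalizing x y with
  | zero => simp [code]
  | succ b ih =>
    have h1 := hF x
    have h2 := hF y
    simp only [code]
    constructor
    · intro h
      have h3 := (ih (x + 1) (y + 1)).1 (by omega)
      intro i hi
      rcases i with _ | i
      · simp only [add_zero]; omega
      · have := h3 i (by omega)
        rwa [Nat.add_right_comm, Nat.add_right_comm y] at this
    · intro h
      have h3 := (ih (x + 1) (y + 1)).2 fun i hi => by
        have := h (i + 1) (by omega)
        rwa [← add_assoc, ← add_assoc, Nat.add_right_comm, Nat.add_right_comm y] at this
      have h4 := h 0 (by omega)
      simp only [add_zero] at h4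
      omega

/-- The first letter is the least significant digit, so a remainder truncates a block to a prefix.
-/
theorem code_mod {b l : ℕ} (h : l ≤ b) (x : ℕ) : code F b x % 4 ^ l = code F l x := by
  induction l generalizing b x with
  | zero => simp [code, Nat.mod_one]
  | succ l ih =>
    obtain ⟨b, rfl⟩ : ∃ c, b = c + 1 := ⟨b - 1, by omega⟩
    have h1 := hF x
    have h2 := code_lt hF l (x + 1)
    have h3 := ih (b := b) (by omega) (x + 1)
    simp only [code]
    have h4 := Nat.div_add_mod (code F b (x + 1)) (4 ^ l)
    rw [h3] at h4
    rw [← h4, pow_succ, show F x + 4 * (4 ^ l * (code F b (x + 1) / 4 ^ l) + code F l (x + 1)) =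
      (F x + 4 * code F l (x + 1)) + (4 ^ l * 4) * (code F b (x + 1) / 4 ^ l) by ring,
      Nat.add_mul_mod_self_left]
    exact Nat.mod_eq_of_lt (by omega)

end

theorem code_eq_zero {F : ℕ → ℕ} {n : ℕ} (h : ∀ t, n ≤ t → F t = 0) (b : ℕ) {t : ℕ} (ht : n ≤ t) :
    code F b t = 0 := by
  induction b generalizing t with
  | zero => rfl
  | succ b ih => simp [code, h t ht, ih (show n ≤ t + 1 by omega)]

/-- Tabulate powers of `4`, binary logarithms and the powers of `2` below a number, block codes, and
the reversed word. -/
def tableP : Prog :=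
  (.store 5 (.const 0) (.const 1) ;;
    .forTo 6 (.reg 2) (.store 5 (.reg 6 + .const 1) (.const 4 * .read 5 (.reg 6)))) ;;
  .forTo 6 (.reg 0 + .const 1) (.cond ((Expr.reg 6).lt (.const 2))
    (.store 6 (.reg 6) (.const 0) ;; .store 7 (.reg 6) (.const 1))
    (.store 6 (.reg 6) (.read 6 (.reg 6 / .const 2) + .const 1) ;;
      .store 7 (.reg 6) (.const 2 * .read 7 (.reg 6 / .const 2)))) ;;
  .forTo 6 (.reg 0) (.assign 7 (.reg 0 - .const 1 - .reg 6) ;;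
    .store 4 (.reg 7)
      (.read 0 (.reg 7) + .const 4 * (.read 4 (.reg 7 + .const 1) % .read 5 (.reg 2 - .const 1)))) ;;
  .forTo 6 (.reg 0) (.store 1 (.reg 6) (.read 0 (.reg 0 - .const 1 - .reg 6)))

/-- The codes are filled in from right to left: the code at `t` is the letter at `t` followed by the
code at `t + 1` without its last digit. Letters and codes beyond the end are `0`, which agrees with
the initial content of the array. The logarithm of `q` comes from that of `q / 2`. -/
theorem tableP_spec {L n b : ℕ} {F : ℕ → ℕ} {s : State} (hF : ∀ t, F t < 4)
    (hF0 : ∀ t, n ≤ t → F t = 0) (hn : s.reg 0 = n) (hb : s.reg 2 = b) (hb1 : 1 ≤ b)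
    (h4 : 4 ^ b ≤ 4 * (n + 1)) (hL : 4 * (n + 1) < L) (h0 : s.arr 0 = F)
    (hz : ∀ a, a ≠ 0 → ∀ i, s.arr a i = 0) :
    Wp L tableP s (40 * (n + 1)) (fun s' => (∀ i ≤ b, s'.arr 5 i = 4 ^ i) ∧
      (∀ q ≤ n, s'.arr 6 q = Nat.log 2 q ∧ s'.arr 7 q = 2 ^ Nat.log 2 q) ∧
      (∀ t, s'.arr 4 t = code F b t) ∧ ∀ t < n, s'.arr 1 t = F (n - 1 - t)) := by
  have hbn : b ≤ 4 * n + 3 := by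
    have := Nat.lt_pow_self (n := b) (show 1 < 4 by omega)
    omega
  have hpow : ∀ i ≤ b, 4 ^ i ≤ 4 * (n + 1) := fun i hi =>
    (Nat.pow_le_pow_right (by omega) hi).trans h4
  unfold tableP
  refine Wp.mono (k := (1 + (b * (1 + 2) + 2)) + (((n + 1) * (3 + 2) + 2) +
    ((n * (2 + 2) + 2) + (n * (1 + 2) + 2)))) ?_ (by omega) fun _ _ h => h
  refine Wp.andThen (R := fun s' => (∀ i ≤ b, s'.arr 5 i = 4 ^ i)) ?_ ?_
  · refine Wp.seq (Wp.store (by simp) (by simp; omega) (by simp) (by simp; omega) ?_)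
    refine Wp.forTo (N := b) (fun j s' => ∀ i ≤ j, s'.arr 5 i = 4 ^ i) (by omega) rfl ?_ ?_ ?_ ?_
    · intro s' hf
      simp [hf.reg 2 rfl, hb]
    · intro i hi
      obtain rfl : i = 0 := by omega
      simp
    · intro j s' hj hf hs hI
      refine Wp.of_vc' ?_ le_rfl
      have hp := hpow (j + 1) (by omega)
      rw [pow_succ] at hp
      have hj4 := hI j le_rfl
      simp only [Prog.vc, Expr.eval_add, Expr.eval_mul, Expr.eval_const, Expr.eval_reg,
        Expr.eval_read, hs, hj4, Expr.safe_add, Expr.safe_mul, Expr.safe_reg, Expr.safe_const,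
        Expr.safe_read]
      refine ⟨⟨by simp, by omega⟩, ⟨⟨by simp, by simp, by omega⟩, by omega⟩, fun i hi => ?_⟩
      simp only [State.setReg_arr, State.setArr_arr, if_true]
      split_ifs with h
      · rw [h, pow_succ]; ring
      · exact hI i (by omega)
    · intro s' hf hs hI
      exact hI
  intro s₁ hf₁ h5
  have hn₁ : s₁.reg 0 = n := by rw [hf₁.reg 0 rfl, hn]
  have hb₁ : s₁.reg 2 = b := by rw [hf₁.reg 2 rfl, hb]
  have h0₁ : s₁.arr 0 = F := by rw [hf₁.arr 0 rfl, h0]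
  have hz₁ : ∀ i, s₁.arr 4 i = 0 := by intro i; rw [hf₁.arr 4 rfl, hz 4 (by omega)]
  clear hf₁ hz h0 hb hn
  refine Wp.andThen (R := fun s' => ∀ q ≤ n, s'.arr 6 q = Nat.log 2 q ∧
    s'.arr 7 q = 2 ^ Nat.log 2 q) ?_ ?_
  · refine Wp.forTo (N := n + 1) (fun j s' => ∀ q < j, s'.arr 6 q = Nat.log 2 q ∧
      s'.arr 7 q = 2 ^ Nat.log 2 q) (by omega) rfl ?_ ?_ ?_ ?_
    · intro s' hf
      simp [hf.reg 0 rfl, hn₁]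
    · intro q hq; omega
    · intro j s' hj hf hs hI
      refine Wp.of_vc' ?_ le_rfl
      simp only [Prog.vc, Expr.eval_lt, Expr.eval_reg, Expr.eval_const, hs, Expr.safe_lt,
        Expr.safe_reg, Expr.safe_const, Expr.eval_add, Expr.eval_mul, Expr.eval_div, Expr.eval_read,
        Expr.safe_add, Expr.safe_mul, Expr.safe_div, Expr.safe_read, State.setArr_reg,
        State.setArr_arr]
      refine ⟨by simp, fun hc => ?_, fun hc => ?_⟩
      · have hj2 : j < 2 := by by_contra h; simp [h] at hc
        refine ⟨⟨by simp, by omega⟩, by simp, ⟨by simp, by omega⟩, ⟨by simp, by omega⟩, ?_⟩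
        intro q hq
        have hl : Nat.log 2 q = 0 := Nat.log_of_lt (by omega)
        simp only [State.setReg_arr, State.setArr_arr]
        by_cases hqj : q = j
        · subst hqj; simp [hl]
        · simpa [hqj] using hI q (by omega)
      · have hj2 : 2 ≤ j := by by_contra h; simp [show j < 2 by omega] at hc
        obtain ⟨e6, e7⟩ := hI (j / 2) (by omega)
        have hl : Nat.log 2 j = Nat.log 2 (j / 2) + 1 := Nat.log_of_one_lt_of_le (by omega) hj2
        have hlj : 2 ^ Nat.log 2 j ≤ j := Nat.pow_log_le_self 2 (by omega)
        have hll := Nat.lt_pow_self (n := Nat.log 2 j) (show 1 < 2 by omega)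
        have hjj : j / 2 ≠ j := by omega
        simp only [e6, e7, hjj, if_false, ← hl, show (7 : ℕ) ≠ 6 by omega]
        rw [show 2 * 2 ^ Nat.log 2 (j / 2) = 2 ^ Nat.log 2 j by rw [hl, pow_succ]; ring]
        refine ⟨⟨by simp, by omega⟩, ⟨⟨⟨by simp, by omega⟩, by simp⟩, by omega⟩,
          ⟨by simp, by omega⟩, ⟨⟨by simp, by simp, by omega⟩, by omega⟩, ?_⟩
        intro q hq
        by_cases hqj : q = j
        · subst hqj; simp
        · simpa [hqj] using hI q (by omega)
    · intro s' hf hs hI q hq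
      exact hI q (by omega)
  intro s₂ hf₂ h67
  rw [← hf₂.reg 0 rfl] at hn₁
  rw [← hf₂.reg 2 rfl] at hb₁
  rw [← hf₂.arr 0 rfl] at h0₁
  rw [← hf₂.arr 4 rfl] at hz₁
  rw [← hf₂.arr 5 rfl] at h5
  clear hf₂
  refine Wp.andThen (R := fun s' => ∀ t, s'.arr 4 t = code F b t) ?_ ?_
  · refine Wp.forTo (N := n) (fun j s' => (∀ t, t + j < n → s'.arr 4 t = 0) ∧
      ∀ t, n ≤ t + j → s'.arr 4 t = code F b t) (by omega) rfl ?_ ?_ ?_ ?_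
    · intro s' hf
      simp [hf.reg 0 rfl, hn₁]
    · refine ⟨fun t _ => hz₁ t, fun t ht => ?_⟩
      rw [code_eq_zero hF0 b (by omega)]
      exact hz₁ t
    · intro j s' hj hf hs ⟨hI1, hI2⟩
      refine Wp.of_vc' ?_ le_rfl
      have e0 : s'.reg 0 = n := by rw [hf.reg 0 rfl, hn₁]
      have e2 : s'.reg 2 = b := by rw [hf.reg 2 rfl, hb₁]
      have e5 : s'.arr 5 (b - 1) = 4 ^ (b - 1) := by rw [hf.arr 5 rfl, h5 _ (by omega)]
      have e00 : s'.arr 0 = F := by rw [hf.arr 0 rfl, h0₁]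
      have e4 := hI2 (n - 1 - j + 1) (by omega)
      have hcode : F (n - 1 - j) + 4 * (code F b (n - 1 - j + 1) % 4 ^ (b - 1)) =
          code F b (n - 1 - j) := by
        rw [code_mod hF (by omega)]
        obtain ⟨b, rfl⟩ : ∃ c, b = c + 1 := ⟨b - 1, by omega⟩
        rfl
      have hcl := code_lt hF b (n - 1 - j)
      simp only [Prog.vc, Expr.eval_sub, Expr.eval_reg, Expr.eval_const, hs, Expr.safe_sub,
        Expr.safe_reg, Expr.safe_const, Expr.eval_add, Expr.eval_mul, Expr.eval_mod, Expr.eval_read,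
        Expr.safe_add, Expr.safe_mul, Expr.safe_mod, Expr.safe_read, State.setReg_reg,
        State.setReg_arr, e0, e2, e5, e00, e4, hcode, if_true, show (2 : ℕ) ≠ 7 by omega, if_false]
      refine ⟨by simp, by omega, ⟨by simp, by omega⟩, ⟨⟨⟨by simp, by omega⟩, by simp,
        ⟨by simp, by omega⟩, by simp, by omega⟩, by omega⟩, ?_, ?_⟩
      · intro t ht
        have : t ≠ n - 1 - j := by omega
        simpa [this] using hI1 t (by omega)
      · intro t ht
        by_cases htj : t = n - 1 - j
        · simp [htj]
        · simpa [htj] using hI2 t (by omega)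
    · intro s' hf hs hI t
      exact hI.2 t (by omega)
  intro s₃ hf₃ h4'
  rw [← hf₃.reg 0 rfl] at hn₁
  rw [← hf₃.arr 0 rfl] at h0₁
  rw [← hf₃.arr 5 rfl] at h5
  rw [← hf₃.arr 6 rfl, ← hf₃.arr 7 rfl] at h67
  clear hf₃
  refine Wp.forTo (N := n) (fun j s' => ∀ t < j, s'.arr 1 t = F (n - 1 - t)) (by omega) rfl ?_ ?_
    ?_ ?_
  · intro s' hf
    simp [hf.reg 0 rfl, hn₁]
  · intro t ht; omega
  · intro j s' hj hf hs hI
    refine Wp.of_vc' ?_ le_rfl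
    have e0 : s'.reg 0 = n := by rw [hf.reg 0 rfl, hn₁]
    have e00 : s'.arr 0 = F := by rw [hf.arr 0 rfl, h0₁]
    have := hF (n - 1 - j)
    simp only [Prog.vc, Expr.eval_sub, Expr.eval_reg, Expr.eval_const, hs, Expr.safe_sub,
      Expr.safe_reg, Expr.safe_const, Expr.eval_read, Expr.safe_read, e0, e00]
    refine ⟨⟨by simp, by omega⟩, ⟨⟨by simp, by omega⟩, by omega⟩, ?_⟩
    intro t ht
    by_cases htj : t = j
    · simp [htj]
    · simpa [htj] using hI t (by omega)
  · intro s' hf hs hI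
    refine ⟨?_, ?_, ?_, hI⟩
    · rw [hf.arr 5 rfl]; exact h5
    · rw [hf.arr 6 rfl, hf.arr 7 rfl]; exact h67
    · rw [hf.arr 4 rfl]; exact h4'

end WordRAM


/-! ## Naming pairs -/

namespace WordRAM

/-- The number of keys less than `v`. -/
def below (P : ℕ → ℕ) (T v : ℕ) : ℕ := Nat.count (fun i => P i < v) T

/-- The place of item `j` in the stable order of the items by their keys. -/
def place (P : ℕ → ℕ) (T j : ℕ) : ℕ := below P T (P j) + Nat.count (fun i => P i = P j) j

theorem below_succ (P : ℕ → ℕ) (T v : ℕ) :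
    below P T (v + 1) = below P T v + Nat.count (fun i => P i = v) T := by
  unfold below
  induction T with
  | zero => simp
  | succ T ih =>
    simp only [Nat.count_succ, ih]
    split_ifs <;> omega

theorem below_mono (P : ℕ → ℕ) (T : ℕ) {v w : ℕ} (h : v ≤ w) : below P T v ≤ below P T w :=
  Nat.count_mono_left fun i hi => by omega

theorem place_lt_below (P : ℕ → ℕ) {T j : ℕ} (hj : j < T) :
    place P T j < below P T (P j + 1) := by
  rw [below_succ]
  have : Nat.count (fun i => P i = P j) j < Nat.count (fun i => P i = P j) T :=
    Nat.count_strict_mono rfl hj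
  unfold place
  omega

theorem place_lt (P : ℕ → ℕ) {T j : ℕ} (hj : j < T) : place P T j < T :=
  (place_lt_below P hj).trans_le (Nat.count_le _)

theorem place_lt_place (P : ℕ → ℕ) {T j j' : ℕ} (hj : j < T) (h : P j < P j') :
    place P T j < place P T j' :=
  (place_lt_below P hj).trans_le ((below_mono P T h).trans (Nat.le_add_right _ _))

theorem place_inj (P : ℕ → ℕ) {T j j' : ℕ} (hj : j < T) (hj' : j' < T)
    (h : place P T j = place P T j') : j = j' := by
  rcases lt_trichotomy (P j) (P j') with h1 | h1 | h1
  · exact absurd h (place_lt_place P hj h1).ne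
  · unfold place at h
    rw [h1] at h
    rcases lt_trichotomy j j' with h2 | h2 | h2
    · have : Nat.count (fun i => P i = P j') j < Nat.count (fun i => P i = P j') j' :=
        Nat.count_strict_mono h1 h2
      omega
    · exact h2
    · have : Nat.count (fun i => P i = P j') j' < Nat.count (fun i => P i = P j') j :=
        Nat.count_strict_mono rfl h2
      omega
  · exact absurd h (place_lt_place P hj' h1).ne'

theorem exists_place (P : ℕ → ℕ) {T i : ℕ} (hi : i < T) : ∃ j < T, place P T j = i := by
  have h := Finset.surj_on_of_inj_on_of_card_le (s := Finset.range T) (t := Finset.range T)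
    (fun j _ => place P T j) (fun j hj => Finset.mem_range.2 (place_lt P (Finset.mem_range.1 hj)))
    (fun j j' hj hj' h => place_inj P (Finset.mem_range.1 hj) (Finset.mem_range.1 hj') h) le_rfl
    i (Finset.mem_range.2 hi)
  obtain ⟨j, hj, h⟩ := h
  exact ⟨j, Finset.mem_range.1 hj, h.symm⟩

/-- Sort the items `0, …, T - 1`, where `T` is the content of register `12`, by their keys in
array `8`: the order is written into array `11`. -/
def sortP : Prog :=
  .forTo 6 (.reg 12 + .const 2) (.store 10 (.reg 6) (.const 0)) ;;
  .forTo 6 (.reg 12) (.assign 7 (.read 8 (.reg 6) + .const 1) ;;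
    .store 10 (.reg 7) (.read 10 (.reg 7) + .const 1)) ;;
  .forTo 6 (.reg 12 + .const 1)
    (.store 10 (.reg 6 + .const 1) (.read 10 (.reg 6 + .const 1) + .read 10 (.reg 6))) ;;
  .forTo 6 (.reg 12) (.assign 7 (.read 8 (.reg 6)) ;; .store 11 (.read 10 (.reg 7)) (.reg 6) ;;
    .store 10 (.reg 7) (.read 10 (.reg 7) + .const 1))

/-- Counting sort. Keys `v` are counted in cell `v + 1`, so that the prefix sums are the numbers of
strictly smaller keys, the places where the groups begin. In the last loop the cell of a key points
to the next free place of its group. -/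
theorem sortP_spec {L T : ℕ} {P : ℕ → ℕ} {s : State} (hT : s.reg 12 = T) (hP : s.arr 8 = P)
    (hPT : ∀ j < T, P j ≤ T) (hL : T + 2 < L) :
    Wp L sortP s (20 * (T + 1)) (fun s' => ∀ j < T, s'.arr 11 (place P T j) = j) := by
  unfold sortP
  refine Wp.mono (k := ((T + 2) * (1 + 2) + 2) + ((T * (2 + 2) + 2) + (((T + 1) * (1 + 2) + 2) +
    (T * (3 + 2) + 2)))) ?_ (by omega) fun _ _ h => h
  refine Wp.andThen (R := fun s' => ∀ v < T + 2, s'.arr 10 v = 0) ?_ ?_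
  · refine Wp.forTo (N := T + 2) (fun j s' => ∀ v < j, s'.arr 10 v = 0) (by omega) rfl ?_ ?_ ?_ ?_
    · intro s' hf
      simp [hf.reg 12 rfl, hT]
    · intro v hv; omega
    · intro j s' hj hf hs hI
      refine Wp.of_vc' ?_ le_rfl
      refine ⟨⟨by simp, by simp [hs]; omega⟩, ⟨by simp, by simp⟩, fun v hv => ?_⟩
      by_cases hvj : v = j
      · simp [hs, hvj]
      · simpa [hs, hvj] using hI v (by omega)
    · intro s' hf hs hI
      exact hI
  intro s₁ hf₁ h10
  rw [← hf₁.reg 12 rfl] at hT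
  rw [← hf₁.arr 8 rfl] at hP
  clear hf₁
  refine Wp.andThen (R := fun s' => ∀ v < T + 2,
    s'.arr 10 v = Nat.count (fun i => P i + 1 = v) T) ?_ ?_
  · refine Wp.forTo (N := T) (fun j s' => ∀ v < T + 2, s'.arr 10 v =
      Nat.count (fun i => P i + 1 = v) j) (by omega) rfl ?_ ?_ ?_ ?_
    · intro s' hf
      simp [hf.reg 12 rfl, hT]
    · intro v hv
      simp [h10 v hv]
    · intro j s' hj hf hs hI
      refine Wp.of_vc' ?_ le_rfl
      have e8 : s'.arr 8 = P := by rw [hf.arr 8 rfl, hP]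
      have hPj := hPT j hj
      have hv := hI (P j + 1) (by omega)
      have hcl : Nat.count (fun i => P i + 1 = P j + 1) j ≤ j := Nat.count_le _
      simp only [Prog.vc, Expr.eval_add, Expr.eval_read, Expr.eval_reg, Expr.eval_const, hs, e8,
        Expr.safe_add, Expr.safe_read, Expr.safe_reg, Expr.safe_const, State.setReg_reg,
        State.setReg_arr, if_true, hv]
      refine ⟨⟨⟨by simp, by omega⟩, by simp⟩, by omega, ⟨by simp, by omega⟩,
        ⟨⟨⟨by simp, by omega⟩, by simp⟩, by omega⟩, fun v hv' => ?_⟩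
      by_cases hvj : v = P j + 1
      · subst hvj
        simp [Nat.count_succ]
      · have := hI v hv'
        simp [Nat.count_succ, hvj, Ne.symm hvj, this]
    · intro s' hf hs hI
      exact hI
  intro s₂ hf₂ h10
  rw [← hf₂.reg 12 rfl] at hT
  rw [← hf₂.arr 8 rfl] at hP
  clear hf₂
  refine Wp.andThen (R := fun s' => ∀ v < T + 2, s'.arr 10 v = below P T v) ?_ ?_
  · refine Wp.forTo (N := T + 1) (fun j s' => (∀ v ≤ j, s'.arr 10 v = below P T v) ∧
      ∀ v < T + 2, j < v → s'.arr 10 v = Nat.count (fun i => P i + 1 = v) T) (by omega) rfl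
      ?_ ?_ ?_ ?_
    · intro s' hf
      simp [hf.reg 12 rfl, hT]
    · refine ⟨fun v hv => ?_, fun v hv _ => h10 v hv⟩
      obtain rfl : v = 0 := by omega
      have := h10 0 (by omega)
      simp only [State.setReg_arr, this, below]
      simp
    · intro j s' hj hf hs ⟨hI1, hI2⟩
      refine Wp.of_vc' ?_ le_rfl
      have h1 := hI1 j le_rfl
      have h2 := hI2 (j + 1) (by omega) (by omega)
      have h3 := below_succ P T j
      have h4 : below P T (j + 1) ≤ T := Nat.count_le _
      have h5 : Nat.count (fun i => P i + 1 = j + 1) T = Nat.count (fun i => P i = j) T := by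
        simp
      simp only [Prog.vc, Expr.eval_add, Expr.eval_read, Expr.eval_reg, Expr.eval_const, hs,
        Expr.safe_add, Expr.safe_read, Expr.safe_reg, Expr.safe_const, h1, h2]
      refine ⟨⟨by simp, by omega⟩, ⟨⟨⟨by simp, by omega⟩, by simp, by omega⟩, by omega⟩,
        fun v hv => ?_, fun v hv hv' => ?_⟩
      · by_cases hvj : v = j + 1
        · simp only [State.setReg_arr, State.setArr_arr, hvj, if_true]
          omega
        · simpa [hvj] using hI1 v (by omega)
      · have : v ≠ j + 1 := by omega
        simpa [this] using hI2 v hv (by omega)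
    · intro s' hf hs hI v hv
      exact hI.1 v (by omega)
  intro s₃ hf₃ h10
  rw [← hf₃.reg 12 rfl] at hT
  rw [← hf₃.arr 8 rfl] at hP
  clear hf₃
  refine Wp.forTo (N := T) (fun j s' => (∀ v < T + 2, s'.arr 10 v = below P T v +
      Nat.count (fun i => P i = v) j) ∧ ∀ i < j, s'.arr 11 (place P T i) = i) (by omega) rfl
      ?_ ?_ ?_ ?_
  · intro s' hf
    simp [hf.reg 12 rfl, hT]
  · refine ⟨fun v hv => ?_, fun i hi => by omega⟩
    simp [h10 v hv]
  · intro j s' hj hf hs ⟨hI1, hI2⟩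
    refine Wp.of_vc' ?_ le_rfl
    have e8 : s'.arr 8 = P := by rw [hf.arr 8 rfl, hP]
    have hPj := hPT j hj
    have hv := hI1 (P j) (by omega)
    have hpl := place_lt P hj
    have hpd : below P T (P j) + Nat.count (fun i => P i = P j) j = place P T j := rfl
    rw [hpd] at hv
    simp only [Prog.vc, Expr.eval_add, Expr.eval_read, Expr.eval_reg, Expr.eval_const, hs, e8,
      Expr.safe_add, Expr.safe_read, Expr.safe_reg, Expr.safe_const, State.setReg_reg,
      State.setReg_arr, State.setArr_arr, State.setArr_reg, if_true, hv,
      show (6 : ℕ) ≠ 7 by omega, show (10 : ℕ) ≠ 11 by omega, if_false]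
    refine ⟨⟨by simp, by omega⟩, by omega, ⟨⟨by simp, by omega⟩, by omega⟩, ⟨by simp, by omega⟩,
      ⟨by simp, by omega⟩, ⟨⟨⟨by simp, by omega⟩, by simp⟩, by omega⟩, fun v hv' => ?_,
      fun i hi => ?_⟩
    · by_cases hvj : v = P j
      · subst hvj
        simp [Nat.count_succ, ← hpd]; omega
      · have := hI1 v hv'
        simp [Nat.count_succ, hvj, Ne.symm hvj, this]
    · by_cases hij : i = j
      · simp [hij]
      · have : place P T i ≠ place P T j := fun h => hij (place_inj P (by omega) hj h)
        simpa [this] using hI2 i (by omega)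
  · intro s' hf hs hI
    exact hI.2

end WordRAM


/-! ### Names for pairs of keys -/

namespace WordRAM

/-- Give names to the pairs of entries of the arrays `8` and `9` at the same place: the names are
written into array `o`, shifted by the content of register `13`. -/
def nameP (o : ℕ) : Prog :=
  sortP ;; .assign 8 (.reg 14) ;; .assign 10 (.reg 14) ;; .assign 9 (.reg 12 + .const 1) ;;
  .forTo 6 (.reg 12)
    ((.assign 7 (.read 11 (.reg 6)) ;; .cond ((Expr.read 8 (.reg 7)).eq (.reg 9)) .skip
      (.assign 8 (.reg 14) ;; .assign 9 (.read 8 (.reg 7)))) ;;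
    .cond ((Expr.reg 8).lt (.read 12 (.read 9 (.reg 7)))) .skip
      (.assign 14 (.reg 14 + .const 1) ;; .store 12 (.read 9 (.reg 7)) (.reg 14)) ;;
    .store o (.reg 13 + .reg 7) (.read 12 (.read 9 (.reg 7)) - .reg 10))

/-- The invariant of the naming loop: `ord` is the order in which the items are visited, the first
`i` of which have got names `nm`; `c` counts all names ever given, `c₀` those given before, `g` those
given before the present group, that is, the items with the key `v`; `slot` remembers the names. -/
structure NameInv (P Q ord : ℕ → ℕ) (c₀ i c g v : ℕ) (slot nm : ℕ → ℕ) : Prop where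
  le_g : c₀ ≤ g
  g_le : g ≤ c
  c_le : c ≤ c₀ + i
  slot_le : ∀ q, slot q ≤ c
  one_le : ∀ i' < i, 1 ≤ nm (ord i')
  nm_le : ∀ i' < i, nm (ord i') + c₀ ≤ c
  nm_eq : ∀ i' < i, ∀ i'' < i, nm (ord i') = nm (ord i'') ↔
    P (ord i') = P (ord i'') ∧ Q (ord i') = Q (ord i'')
  group : ∀ i' < i, P (ord i') = v → g < nm (ord i') + c₀ ∧ slot (Q (ord i')) = nm (ord i') + c₀
  old : ∀ i' < i, P (ord i') ≠ v → nm (ord i') + c₀ ≤ g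
  slot_gt : ∀ q, g < slot q → ∃ i' < i, P (ord i') = v ∧ Q (ord i') = q

/-- Raising the threshold to the current counter makes every remembered slot obsolete at once, so
slots need not be cleared between groups. -/
theorem NameInv.newGroup {P Q ord : ℕ → ℕ} {c₀ i c g v v' : ℕ} {slot nm : ℕ → ℕ}
    (h : NameInv P Q ord c₀ i c g v slot nm) (hv : ∀ i' < i, P (ord i') ≠ v') :
    NameInv P Q ord c₀ i c c v' slot nm where
  le_g := h.le_g.trans h.g_le
  g_le := le_rfl
  c_le := h.c_le
  slot_le := h.slot_le
  one_le := h.one_le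
  nm_le := h.nm_le
  nm_eq := h.nm_eq
  group i' hi' he := absurd he (hv i' hi')
  old i' hi' _ := h.nm_le i' hi'
  slot_gt q hq := absurd (h.slot_le q) (by omega)

/-- A slot above the threshold was written within the present group, hence by an item with the same
pair of keys, and its name is reused. -/
theorem NameInv.known {P Q ord : ℕ → ℕ} {c₀ i c g : ℕ} {slot nm : ℕ → ℕ}
    (h : NameInv P Q ord c₀ i c g (P (ord i)) slot nm) (hord : ∀ i' < i, ord i' ≠ ord i)
    (hs : g < slot (Q (ord i))) {nm' : ℕ → ℕ} (hnm : nm' (ord i) = slot (Q (ord i)) - c₀)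
    (hnm' : ∀ j ≠ ord i, nm' j = nm j) :
    NameInv P Q ord c₀ (i + 1) c g (P (ord i)) slot nm' := by
  obtain ⟨k, hk, hkP, hkQ⟩ := h.slot_gt _ hs
  have hkg := h.group k hk hkP
  rw [hkQ] at hkg
  have e1 : nm' (ord i) = nm (ord k) := by omega
  have e2 : ∀ i' < i, nm' (ord i') = nm (ord i') := fun i' hi' => hnm' _ (hord i' hi')
  refine ⟨h.le_g, h.g_le, h.c_le.trans (by omega), h.slot_le, ?_, ?_, ?_, ?_, ?_, ?_⟩
  · intro i' hi'
    rcases Nat.lt_succ_iff_lt_or_eq.1 hi' with hlt | rfl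
    · rw [e2 _ hlt]; exact h.one_le _ hlt
    · rw [e1]; exact h.one_le _ hk
  · intro i' hi'
    rcases Nat.lt_succ_iff_lt_or_eq.1 hi' with hlt | rfl
    · rw [e2 _ hlt]; exact h.nm_le _ hlt
    · rw [e1]; exact h.nm_le _ hk
  · intro i' hi' i'' hi''
    rcases Nat.lt_succ_iff_lt_or_eq.1 hi' with hlt | rfl
    · rcases Nat.lt_succ_iff_lt_or_eq.1 hi'' with hlt' | rfl
      · rw [e2 _ hlt, e2 _ hlt', h.nm_eq _ hlt _ hlt']
      · rw [e2 _ hlt, e1, h.nm_eq _ hlt _ hk, hkP, hkQ]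
    · rcases Nat.lt_succ_iff_lt_or_eq.1 hi'' with hlt' | rfl
      · rw [e1, e2 _ hlt', h.nm_eq _ hk _ hlt', hkP, hkQ]
      · simp
  · intro i' hi' he
    rcases Nat.lt_succ_iff_lt_or_eq.1 hi' with hlt | rfl
    · rw [e2 _ hlt]; exact h.group _ hlt he
    · rw [e1]; exact hkg
  · intro i' hi' he
    rcases Nat.lt_succ_iff_lt_or_eq.1 hi' with hlt | rfl
    · rw [e2 _ hlt]; exact h.old _ hlt he
    · exact absurd rfl he
  · intro q hq
    obtain ⟨i', hi', h'⟩ := h.slot_gt q hq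
    exact ⟨i', by omega, h'⟩

/-- A slot not above the threshold shows that no earlier item of the group has this second key, so
the counter supplies a new name. -/
theorem NameInv.fresh {P Q ord : ℕ → ℕ} {c₀ i c g : ℕ} {slot nm : ℕ → ℕ}
    (h : NameInv P Q ord c₀ i c g (P (ord i)) slot nm) (hord : ∀ i' < i, ord i' ≠ ord i)
    (hs : slot (Q (ord i)) ≤ g) {nm' slot' : ℕ → ℕ} (hnm : nm' (ord i) = c + 1 - c₀)
    (hnm' : ∀ j ≠ ord i, nm' j = nm j) (hsl : slot' (Q (ord i)) = c + 1)
    (hsl' : ∀ q ≠ Q (ord i), slot' q = slot q) :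
    NameInv P Q ord c₀ (i + 1) (c + 1) g (P (ord i)) slot' nm' := by
  have h1 := h.le_g
  have h2 := h.g_le
  have e1 : nm' (ord i) + c₀ = c + 1 := by omega
  have e2 : ∀ i' < i, nm' (ord i') = nm (ord i') := fun i' hi' => hnm' _ (hord i' hi')
  have hne : ∀ i' < i, ¬ (P (ord i') = P (ord i) ∧ Q (ord i') = Q (ord i)) := by
    rintro i' hi' ⟨k1, k2⟩
    have := h.group i' hi' k1
    rw [k2] at this
    omega
  refine ⟨h.le_g, h.g_le.trans (by omega), by have := h.c_le; omega, ?_, ?_, ?_, ?_, ?_, ?_, ?_⟩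
  · intro q
    by_cases hq : q = Q (ord i)
    · rw [hq, hsl]
    · rw [hsl' q hq]; exact (h.slot_le q).trans (by omega)
  · intro i' hi'
    rcases Nat.lt_succ_iff_lt_or_eq.1 hi' with hlt | rfl
    · rw [e2 _ hlt]; exact h.one_le _ hlt
    · omega
  · intro i' hi'
    rcases Nat.lt_succ_iff_lt_or_eq.1 hi' with hlt | rfl
    · rw [e2 _ hlt]; exact (h.nm_le _ hlt).trans (by omega)
    · omega
  · intro i' hi' i'' hi''
    rcases Nat.lt_succ_iff_lt_or_eq.1 hi' with hlt | rfl
    · rcases Nat.lt_succ_iff_lt_or_eq.1 hi'' with hlt' | rfl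
      · rw [e2 _ hlt, e2 _ hlt', h.nm_eq _ hlt _ hlt']
      · have := h.nm_le _ hlt
        have := hne _ hlt
        rw [e2 _ hlt]
        constructor
        · intro; omega
        · intro hc; exact absurd hc this
    · rcases Nat.lt_succ_iff_lt_or_eq.1 hi'' with hlt' | rfl
      · have := h.nm_le _ hlt'
        have := hne _ hlt'
        rw [e2 _ hlt']
        constructor
        · intro; omega
        · rintro ⟨k1, k2⟩; exact absurd ⟨k1.symm, k2.symm⟩ this
      · simp
  · intro i' hi' he
    rcases Nat.lt_succ_iff_lt_or_eq.1 hi' with hlt | rfl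
    · rw [e2 _ hlt, hsl' _ fun hq => hne i' hlt ⟨he, hq⟩]; exact h.group _ hlt he
    · rw [hsl]; omega
  · intro i' hi' he
    rcases Nat.lt_succ_iff_lt_or_eq.1 hi' with hlt | rfl
    · rw [e2 _ hlt]; exact h.old _ hlt he
    · exact absurd rfl he
  · intro q hq
    by_cases hqi : q = Q (ord i)
    · exact ⟨i, by omega, rfl, hqi.symm⟩
    · rw [hsl' q hqi] at hq
      obtain ⟨i', hi', h'⟩ := h.slot_gt q hq
      exact ⟨i', by omega, h'⟩

/-- Only the first keys are sorted; within a group of equal first keys, the second key addresses a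
slot directly. The counter in register `14` and the slots persist through all namings, so the time
is linear in `T` although second keys may be as large as `L`. Subtracting `c₀` brings the names back
to `1, …, T`, so that they can serve as keys again. -/
theorem nameP_spec {L T off c₀ o : ℕ} {P Q : ℕ → ℕ} {s : State} (hT : s.reg 12 = T)
    (hoff : s.reg 13 = off) (hc₀ : s.reg 14 = c₀) (hP : s.arr 8 = P) (hQ : s.arr 9 = Q)
    (hPT : ∀ j < T, P j ≤ T) (hQL : ∀ j < T, Q j < L) (hslot : ∀ q, s.arr 12 q ≤ c₀)
    (ho : 12 < o) (hL : T + 2 < L) (hcL : c₀ + T ≤ L) (hoL : off + T ≤ L) :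
    Wp L (nameP o) s (40 * (T + 1)) (fun s' =>
      (∀ j < T, 1 ≤ s'.arr o (off + j) ∧ s'.arr o (off + j) ≤ T) ∧
      (∀ j < T, ∀ j' < T, s'.arr o (off + j) = s'.arr o (off + j') ↔ P j = P j' ∧ Q j = Q j') ∧
      (∀ i, i < off ∨ off + T ≤ i → s'.arr o i = s.arr o i) ∧
      s'.reg 14 ≤ c₀ + T ∧ ∀ q, s'.arr 12 q ≤ s'.reg 14) := by
  have no8 : o ≠ 8 := by omega
  have no9 : o ≠ 9 := by omega
  have no10 : o ≠ 10 := by omega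
  have no11 : o ≠ 11 := by omega
  have no12 : o ≠ 12 := by omega
  have on8 : (8 : ℕ) ≠ o := by omega
  have on9 : (9 : ℕ) ≠ o := by omega
  have on11 : (11 : ℕ) ≠ o := by omega
  have on12 : (12 : ℕ) ≠ o := by omega
  unfold nameP
  refine Wp.mono (k := 20 * (T + 1) + (1 + (1 + (1 + (T * (8 + 2) + 2))))) ?_ (by omega)
    fun _ _ h => h
  refine Wp.andThen (sortP_spec hT hP hPT hL) ?_
  intro s₁ hf₁ hord
  rw [← hf₁.reg 12 rfl] at hT
  rw [← hf₁.reg 13 rfl] at hoff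
  rw [← hf₁.reg 14 rfl] at hc₀
  rw [← hf₁.arr 8 rfl] at hP
  rw [← hf₁.arr 9 rfl] at hQ
  have ho₁ : s₁.arr o = s.arr o := hf₁.arr o (by
    simp [sortP, Prog.writesArr, writesArr_forTo]; omega)
  rw [← ho₁]
  have hslot₁ : ∀ q, s₁.arr 12 q ≤ c₀ := by rw [hf₁.arr 12 rfl]; exact hslot
  clear hf₁ hslot ho₁ s
  set ord := s₁.arr 11 with hordd
  have hsurj : ∀ j < T, ∃ i < T, ord i = j := fun j hj => ⟨_, place_lt P hj, hord j hj⟩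
  have hordT : ∀ i < T, ord i < T := by
    intro i hi
    obtain ⟨j, hj, rfl⟩ := exists_place P hi
    rwa [hord j hj]
  have hinj : ∀ i < T, ∀ i' < T, ord i = ord i' → i = i' := by
    intro i hi i' hi' h
    obtain ⟨j, hj, rfl⟩ := exists_place P hi
    obtain ⟨j', hj', rfl⟩ := exists_place P hi'
    rw [hord j hj, hord j' hj'] at h
    rw [h]
  have hmono : ∀ i < T, ∀ i' < T, i ≤ i' → P (ord i) ≤ P (ord i') := by
    intro i hi i' hi' h
    obtain ⟨j, hj, rfl⟩ := exists_place P hi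
    obtain ⟨j', hj', rfl⟩ := exists_place P hi'
    rw [hord j hj, hord j' hj']
    by_contra hcon
    have := place_lt_place P hj' (show P j' < P j by omega)
    omega
  -- The initial group key `T + 1` is larger than all keys, so the first item opens a group.
  refine Wp.seq (Wp.assign (by simp) (by simp; omega) (Wp.seq (Wp.assign (by simp) (by simp; omega)
    (Wp.seq (Wp.assign (by simp) (by simp; omega) ?_)))))
  refine Wp.forTo (N := T) (fun i s' =>
    NameInv P Q ord c₀ i (s'.reg 14) (s'.reg 8) (s'.reg 9) (s'.arr 12) (fun j => s'.arr o (off + j)) ∧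
    s'.reg 9 = (if i = 0 then T + 1 else P (ord (i - 1))) ∧
    ∀ i, i < off ∨ off + T ≤ i → s'.arr o i = s₁.arr o i) (by omega) rfl ?_ ?_ ?_ ?_
  · intro s' hf
    simp [hf.reg 12 rfl, hT]
  · refine ⟨?_, ?_, ?_⟩
    · have h0 : NameInv P Q ord c₀ 0 c₀ c₀ (T + 1) (s₁.arr 12) (fun j => s₁.arr o (off + j)) :=
        ⟨le_rfl, le_rfl, le_rfl, hslot₁, by omega, by omega, by omega, by omega, by omega,
          fun q hq => absurd (hslot₁ q) (by omega)⟩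
      simpa [hc₀, hT] using h0
    · simp [hT]
    · intro i hi; rfl
  · rintro i s' hi hf hs ⟨hI, h9, hout⟩
    have e11 : s'.arr 11 = ord := by rw [hf.arr 11 (by simp [writesArr_forTo, Prog.writesArr, no11])]; rfl
    have e8 : s'.arr 8 = P := by rw [hf.arr 8 (by simp [writesArr_forTo, Prog.writesArr, no8])]; exact hP
    have e9 : s'.arr 9 = Q := by rw [hf.arr 9 (by simp [writesArr_forTo, Prog.writesArr, no9])]; exact hQ
    have e10 : s'.reg 10 = c₀ := by rw [hf.reg 10 rfl]; simp [hc₀]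
    have e13 : s'.reg 13 = off := by rw [hf.reg 13 rfl]; simp [hoff]
    have hoi := hordT i hi
    have hordi : ∀ i' < i, ord i' ≠ ord i := fun i' hi' h => by
      have := hinj i' (by omega) i hi h; omega
    have hPi := hPT _ hoi
    have hQi := hQL _ hoi
    have hcle := hI.c_le
    refine Wp.mono (k := 4 + 4) ?_ le_rfl fun _ _ h => h
    refine Wp.andThen (R := fun s'' => s''.reg 7 = ord i ∧ s''.reg 9 = P (ord i) ∧
      s''.reg 14 = s'.reg 14 ∧ s''.arr = s'.arr ∧ s''.reg 10 = c₀ ∧ s''.reg 13 = off ∧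
      NameInv P Q ord c₀ i (s'.reg 14) (s''.reg 8) (s''.reg 9) (s'.arr 12)
        (fun j => s'.arr o (off + j))) (Wp.of_vc' ?_ le_rfl) ?_
    · simp only [Prog.vc, Expr.eval_read, Expr.eval_reg, Expr.eval_eq, hs, e8, e11,
        Expr.safe_read, Expr.safe_reg, Expr.safe_eq, State.setReg_reg, State.setReg_arr, if_true,
        show (9 : ℕ) ≠ 7 by omega, show (14 : ℕ) ≠ 7 by omega, show (7 : ℕ) ≠ 8 by omega,
        show (7 : ℕ) ≠ 9 by omega, show (14 : ℕ) ≠ 9 by omega, show (14 : ℕ) ≠ 8 by omega,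
        show (8 : ℕ) ≠ 9 by omega, show (10 : ℕ) ≠ 7 by omega, show (10 : ℕ) ≠ 8 by omega,
        show (10 : ℕ) ≠ 9 by omega, show (13 : ℕ) ≠ 7 by omega, show (13 : ℕ) ≠ 8 by omega,
        show (13 : ℕ) ≠ 9 by omega, show (8 : ℕ) ≠ 7 by omega, if_false, e10, e13, true_and]
      refine ⟨by omega, by omega, ⟨by omega, trivial⟩, fun hc => ?_, fun hc => ?_⟩
      · have : P (ord i) = s'.reg 9 := by by_contra h; simp [h] at hc
        exact ⟨this.symm, hI⟩
      · have hne : P (ord i) ≠ s'.reg 9 := by intro h; simp [h] at hc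
        refine ⟨by omega, by omega, by omega, hI.newGroup fun i' hi' he => ?_⟩
        rw [h9, if_neg (by omega)] at hne
        have h1 := hmono i' (by omega) (i - 1) (by omega) (by omega)
        have h2 := hmono (i - 1) (by omega) i hi (by omega)
        omega
    · rintro s'' - ⟨k7, k9, k14, karr, k10, k13, kI⟩
      rw [k9] at kI
      refine Wp.of_vc' ?_ le_rfl
      have hsl := kI.slot_le (Q (ord i))
      have hlg := kI.le_g
      simp only [Prog.vc, Expr.eval_read, Expr.eval_reg, Expr.eval_lt, Expr.eval_add, Expr.eval_sub,
        Expr.eval_const, karr, e9, k7, k14, k10, k13,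
        Expr.safe_read, Expr.safe_reg, Expr.safe_lt, Expr.safe_add, Expr.safe_sub,
        Expr.safe_const, State.setReg_reg, State.setReg_arr, State.setArr_arr, State.setArr_reg,
        if_true, show (9 : ℕ) ≠ 12 by omega, show (7 : ℕ) ≠ 14 by omega, show (13 : ℕ) ≠ 14 by omega,
        show (10 : ℕ) ≠ 14 by omega, show (14 : ℕ) ≠ 6 by omega, show (8 : ℕ) ≠ 6 by omega,
        show (9 : ℕ) ≠ 6 by omega, show (8 : ℕ) ≠ 14 by omega, show (9 : ℕ) ≠ 14 by omega,
        State.setArr_arr_of_ne _ on12, no12, if_false, k9, true_and, and_true]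
      have houtr : ∀ i', i' < off ∨ off + T ≤ i' → i' ≠ off + ord i := by omega
      refine ⟨⟨by omega, by omega⟩, fun hc => ?_, fun hc => ?_⟩
      · have hlt : s''.reg 8 < s'.arr 12 (Q (ord i)) := by by_contra h; simp [h] at hc
        refine ⟨by omega, ⟨⟨by omega, by omega⟩, by omega⟩, ?_, by simp, ?_⟩
        · refine kI.known hordi hlt ?_ ?_
          · simp
          · intro j hj; simp [hj]
        · intro i' hi'
          rw [if_neg (houtr i' hi')]
          exact hout i' hi'
      · have hle : s'.arr 12 (Q (ord i)) ≤ s''.reg 8 := by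
          by_contra h; simp [show s''.reg 8 < s'.arr 12 (Q (ord i)) by omega] at hc
        refine ⟨by omega, ⟨by omega, by omega⟩, by omega, by omega, ⟨⟨by omega, by omega⟩,
          by omega⟩, ?_, by simp, ?_⟩
        · refine kI.fresh hordi hle ?_ ?_ ?_ ?_
          · simp
          · intro j hj; simp [hj]
          · simp
          · intro q hq; simp [hq, karr]
        · intro i' hi'
          rw [if_neg (houtr i' hi')]
          exact hout i' hi'
  · rintro s' hf hs ⟨hI, h9, hout⟩
    have hcle := hI.c_le
    refine ⟨fun j hj => ?_, fun j hj j' hj' => ?_, hout, hcle, hI.slot_le⟩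
    · obtain ⟨i, hi, rfl⟩ := hsurj j hj
      have h1 := hI.one_le i hi
      have h2 := hI.nm_le i hi
      constructor
      · exact h1
      · omega
    · obtain ⟨i, hi, rfl⟩ := hsurj j hj
      obtain ⟨i', hi', rfl⟩ := hsurj j' hj'
      exact hI.nm_eq i hi i' hi'

end WordRAM


/-! ## Names of blocks at sampled positions -/

namespace WordRAM

/-- The sampled positions: the first `M` items are the multiples of `d`, the next ones are the
positions whose residue mod `d²` is less than `d`. -/
def pos (M d j : ℕ) : ℕ := if j < M then j * d else (j - M) / d * (d * d) + (j - M) % d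

/-- For samples of either kind, `d` items further on means `d²` positions further on: multiples of
`d` advance by `d` each, and the second kind has `d` samples in every period `d²`. The number `M` is
large enough for the item to stay in its half of the list. -/
theorem pos_add {M d n j i : ℕ} (hd : 1 ≤ d) (hM : n / d + d < M) (hj : j < 2 * M)
    (h : pos M d j + i * (d * d) < n) :
    j + d * i < 2 * M ∧ pos M d (j + d * i) = pos M d j + i * (d * d) := by
  unfold pos at *
  split_ifs at h with h1
  · have h2 : (j + d * i) * d = j * d + i * (d * d) := by ring
    have h3 : j + d * i < M := by
      rw [← h2] at h
      have := (Nat.le_div_iff_mul_le hd).2 h.le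
      omega
    rw [if_pos h3, if_pos h1]
    exact ⟨by omega, h2⟩
  · obtain ⟨l, rfl⟩ : ∃ l, j = M + l := ⟨j - M, by omega⟩
    rw [if_neg (by omega), if_neg (by omega)]
    simp only [Nat.add_sub_cancel_left] at *
    rw [show M + l + d * i - M = l + d * i by omega, Nat.add_mul_div_left _ _ hd,
      Nat.add_mul_mod_self_left]
    constructor
    · have h4 : (l / d + i) * d * d < n := by
        have : (l / d + i) * d * d = l / d * (d * d) + i * (d * d) := by ring
        omega
      have h5 := (Nat.le_div_iff_mul_le hd).2 h4.le
      have h6 := Nat.div_add_mod l d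
      have h7 := Nat.mod_lt l hd
      have h8 : (l / d + i) * d = d * (l / d) + d * i := by ring
      omega
    · ring

theorem pos_le {M d j : ℕ} (hd : 1 ≤ d) (hj : j < 2 * M) : pos M d j ≤ M * d + d := by
  unfold pos
  split_ifs with h
  · have : j * d ≤ M * d := Nat.mul_le_mul_right _ h.le
    omega
  · have h1 := Nat.mod_lt (j - M) hd
    have h2 : (j - M) / d * d ≤ M := (Nat.div_mul_le_self _ _).trans (by omega)
    have h3 : (j - M) / d * (d * d) ≤ M * d := by
      rw [← mul_assoc]; exact Nat.mul_le_mul_right _ h2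
    omega

/-- Continue the names in array `o` by the codes of the blocks that are `i` blocks further, for all
`i` less than register `17`. -/
def foldP (o : ℕ) : Prog :=
  .forTo 20 (.reg 17) (.assign 21 (.reg 20 * .reg 2) ;;
    .forTo 6 (.reg 19) (.store 8 (.reg 6) (.read o (.reg 6)) ;;
      .store 9 (.reg 6) (.read 4 (.reg 6 * .reg 15 + .reg 21)) ;;
      .assign 7 (.reg 19 + .reg 6) ;; .store 8 (.reg 7) (.read o (.reg 7)) ;;
      .store 9 (.reg 7) (.read 4 (.reg 6 / .reg 15 * .reg 16 + .reg 6 % .reg 15 + .reg 21))) ;;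
    nameP o)

/-- From the names of blocks compute the names of the blocks of double length, register `18`
times. -/
def levelP (o : ℕ) : Prog :=
  .forTo 20 (.reg 18) (
    .forTo 6 (.reg 12) (.store 8 (.reg 6) (.read o (.reg 13 + .reg 6)) ;;
      .store 9 (.reg 6) (.read o (.reg 13 + .reg 6 + .reg 22))) ;;
    .assign 13 (.reg 13 + .const 2 * .reg 12) ;; .assign 22 (.const 2 * .reg 22) ;;
    nameP o)

/-- Round `i` renames the pairs of the name so far and the code of the `i`-th block, so equality of
names records equality of all codes read. All names are `1` at the start, when nothing has been
read. -/
theorem foldP_spec {L b d R M o c₀ : ℕ} {F : ℕ → ℕ} {s : State} (hd : 1 ≤ d)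
    (hF : ∀ t, code F b t + 1 < L)
    (h2 : s.reg 2 = b) (h15 : s.reg 15 = d) (h16 : s.reg 16 = d * d)
    (h17 : s.reg 17 = R) (h12 : s.reg 12 = 2 * M) (h19 : s.reg 19 = M) (h14 : s.reg 14 = c₀)
    (h13 : s.reg 13 = 0)
    (hcode : ∀ t, s.arr 4 t = code F b t) (hslot : ∀ q, s.arr 12 q ≤ c₀) (ho : 12 < o)
    (ho1 : ∀ j < 2 * M, s.arr o j = 1) (hM : 1 ≤ M)
    (hL : 2 * M + 2 < L) (hL1 : M * d + d + R * b < L) (hL2 : R ≤ L)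
    (hL3 : c₀ + R * (2 * M) ≤ L) :
    Wp L (foldP o) s (R * (100 * (2 * M + 1)) + 2) (fun s' =>
      (∀ j < 2 * M, 1 ≤ s'.arr o j ∧ s'.arr o j ≤ 2 * M) ∧
      (∀ j < 2 * M, ∀ j' < 2 * M, s'.arr o j = s'.arr o j' ↔
        ∀ i < R, code F b (pos M d j + i * b) = code F b (pos M d j' + i * b)) ∧
      (∀ j, 2 * M ≤ j → s'.arr o j = s.arr o j) ∧
      s'.reg 14 ≤ c₀ + R * (2 * M) ∧ ∀ q, s'.arr 12 q ≤ s'.reg 14) := by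
  have no4 : (4 : ℕ) ≠ o := by omega
  have no8 : o ≠ 8 := by omega
  have no9 : o ≠ 9 := by omega
  unfold foldP
  refine Wp.mono (k := R * ((1 + ((M * (5 + 2) + 2) + 40 * (2 * M + 1))) + 2) + 2) ?_
    (Nat.add_le_add_right (Nat.mul_le_mul_left _ (by omega)) _) fun _ _ h => h
  refine Wp.forTo (N := R) (fun r s' =>
      (∀ j < 2 * M, 1 ≤ s'.arr o j ∧ s'.arr o j ≤ 2 * M) ∧
      (∀ j < 2 * M, ∀ j' < 2 * M, s'.arr o j = s'.arr o j' ↔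
        ∀ i < r, code F b (pos M d j + i * b) = code F b (pos M d j' + i * b)) ∧
      (∀ j, 2 * M ≤ j → s'.arr o j = s.arr o j) ∧
      s'.reg 14 ≤ c₀ + r * (2 * M) ∧ ∀ q, s'.arr 12 q ≤ s'.reg 14) hL2 rfl ?_ ?_ ?_ ?_
  · intro s' hf
    simp [hf.reg 17 rfl, h17]
  · refine ⟨fun j hj => ?_, fun j hj j' hj' => ?_, fun j hj => rfl, by simp [h14], ?_⟩
    · rw [State.setReg_arr, ho1 j hj]; omega
    · simp [ho1 j hj, ho1 j' hj']
    · intro q; simpa [h14] using hslot q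
  · rintro r s₁ hr hf hrs ⟨hI1, hI2, hI3, hI4, hI5⟩
    have e2 : s₁.reg 2 = b := by rw [hf.reg 2 rfl, h2]
    have e15 : s₁.reg 15 = d := by rw [hf.reg 15 rfl, h15]
    have e16 : s₁.reg 16 = d * d := by rw [hf.reg 16 rfl, h16]
    have e12 : s₁.reg 12 = 2 * M := by rw [hf.reg 12 rfl, h12]
    have e19 : s₁.reg 19 = M := by rw [hf.reg 19 rfl, h19]
    have e13 : s₁.reg 13 = 0 := by rw [hf.reg 13 rfl, h13]
    have e4 : ∀ t, s₁.arr 4 t = code F b t := by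
      rw [hf.arr 4 (by
        simp [writesArr_forTo, Prog.writesArr, nameP, sortP]; omega)]
      exact hcode
    clear hf
    have hrb : r * b ≤ R * b := Nat.mul_le_mul_right _ hr.le
    have hrM : (r + 1) * (2 * M) ≤ R * (2 * M) := Nat.mul_le_mul_right _ hr
    rw [Nat.succ_mul] at hrM
    refine Wp.seq (Wp.assign (by simp) (by simp [hrs, e2]; omega) ?_)
    refine Wp.andThen (R := fun s' => (∀ j < 2 * M, s'.arr 8 j = s₁.arr o j ∧
      s'.arr 9 j = code F b (pos M d j + r * b))) ?_ ?_
    · refine Wp.forTo (N := M) (fun i s' => ∀ j < i, (s'.arr 8 j = s₁.arr o j ∧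
        s'.arr 9 j = code F b (pos M d j + r * b)) ∧ s'.arr 8 (M + j) = s₁.arr o (M + j) ∧
        s'.arr 9 (M + j) = code F b (pos M d (M + j) + r * b)) (by omega) rfl ?_ ?_ ?_ ?_
      · intro s' hf
        simp [hf.reg 19 rfl, e19]
      · intro j hj; omega
      · rintro i s' hi hf his hI
        refine Wp.of_vc' ?_ le_rfl
        have k15 : s'.reg 15 = d := by rw [hf.reg 15 rfl]; simp [e15]
        have k16 : s'.reg 16 = d * d := by rw [hf.reg 16 rfl]; simp [e16]
        have k19 : s'.reg 19 = M := by rw [hf.reg 19 rfl]; simp [e19]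
        have k21 : s'.reg 21 = r * b := by rw [hf.reg 21 rfl]; simp [hrs, e2]
        have k4 : ∀ t, s'.arr 4 t = code F b t := by rw [hf.arr 4 rfl]; exact e4
        have ko : s'.arr o = s₁.arr o := by
          rw [hf.arr o (by simp [writesArr_forTo, Prog.writesArr]; omega)]; rfl
        have p1 : pos M d i = i * d := if_pos hi
        have p2 : pos M d (M + i) = i / d * (d * d) + i % d := by
          unfold pos; rw [if_neg (by omega)]; simp
        have b1 := pos_le (M := M) hd (show i < 2 * M by omega)
        have b2 := pos_le (M := M) hd (show M + i < 2 * M by omega)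
        have b3 := hF (pos M d i + r * b)
        have b4 := hF (pos M d (M + i) + r * b)
        have b5 := hI1 i (by omega)
        have b6 := hI1 (M + i) (by omega)
        simp only [Prog.vc, Expr.eval_read, Expr.eval_reg, Expr.eval_add, Expr.eval_mul,
          Expr.eval_div, Expr.eval_mod, Expr.safe_read, Expr.safe_reg, Expr.safe_add, Expr.safe_mul,
          Expr.safe_div, Expr.safe_mod, State.setReg_reg, State.setReg_arr, State.setArr_arr,
          State.setArr_reg, if_true, his, k15, k16, k19, k21, k4, ko, ← p1, ← p2, no8, no9,
          show (6 : ℕ) ≠ 7 by omega, show (15 : ℕ) ≠ 7 by omega, show (16 : ℕ) ≠ 7 by omega,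
          show (21 : ℕ) ≠ 7 by omega, show (4 : ℕ) ≠ 8 by omega, show (4 : ℕ) ≠ 9 by omega,
          if_false, true_and, and_true]
        refine ⟨by omega, ⟨by omega, by omega⟩, by omega, ⟨by omega, by omega⟩, by omega,
          by omega, ⟨by omega, by omega⟩, by omega, ⟨by omega, by omega⟩, ?_⟩
        intro j hj
        by_cases hji : j = i
        · subst hji
          simp [show M ≠ 0 by omega]
        · obtain ⟨⟨q1, q2⟩, q3, q4⟩ := hI j (by omega)
          simp [hji, show j ≠ M + i by omega, show M + j ≠ i by omega, q1, q2, q3, q4]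
      · intro s' hf hs hI j hj
        rcases Nat.lt_or_ge j M with hjM | hjM
        · exact (hI j hjM).1
        · have := (hI (j - M) (by omega)).2
          rwa [show M + (j - M) = j by omega] at this
    intro s₂ hf₂ h89
    have e14 : s₂.reg 14 = s₁.reg 14 := by rw [hf₂.reg 14 rfl]; simp
    have eo : s₂.arr o = s₁.arr o := by
      rw [hf₂.arr o (by simp [writesArr_forTo, Prog.writesArr]; omega)]; rfl
    refine (nameP_spec (L := L) (T := 2 * M) (off := 0) (c₀ := s₁.reg 14) (o := o) (P := s₂.arr 8)
      (Q := s₂.arr 9) ?_ ?_ e14 rfl rfl ?_ ?_ ?_ ho hL (by omega) (by omega)).mono le_rfl ?_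
    · rw [hf₂.reg 12 rfl]; simp [e12]
    · rw [hf₂.reg 13 rfl]; simp [e13]
    · intro j hj; rw [(h89 j hj).1]; exact (hI1 j hj).2
    · intro j hj; rw [(h89 j hj).2]; have := hF (pos M d j + r * b); omega
    · rw [hf₂.arr 12 rfl]; exact hI5
    · rintro s₃ - ⟨n1, n2, n3, n4, n5⟩
      simp only [State.setReg_arr, State.setReg_reg, show (14 : ℕ) ≠ 20 by omega, if_false]
      simp only [Nat.zero_add] at n1 n2 n3
      refine ⟨n1, ?_, ?_, ?_, n5⟩
      · intro j hj j' hj'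
        rw [n2 j hj j' hj', (h89 j hj).1, (h89 j' hj').1, (h89 j hj).2, (h89 j' hj').2,
          hI2 j hj j' hj']
        constructor
        · rintro ⟨q1, q2⟩ i hi
          rcases Nat.lt_succ_iff_lt_or_eq.1 hi with hlt | rfl
          exacts [q1 i hlt, q2]
        · intro q
          exact ⟨fun i hi => q i (by omega), q r (by omega)⟩
      · intro j hj
        rw [n3 j (Or.inr hj), eo, hI3 j hj]
      · rw [Nat.succ_mul]; omega
  · intro s' hf hs hI
    exact hI

/-- A block of double length is named by the pair of its halves, the items `j` and `j + d 2^r`. Each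
layer has `2 T` cells, of which the second half stays `0`; by `hdK` the index of the second
half-block never leaves the layer. Zero stands for an item past the end and is never a proper name,
which makes the characterization valid without range conditions. -/
theorem levelP_spec {L d K T o c₀ : ℕ} {A : ℕ → ℕ} {s : State}
    (h18 : s.reg 18 = K) (h12 : s.reg 12 = T) (h14 : s.reg 14 = c₀) (h22 : s.reg 22 = d)
    (h13 : s.reg 13 = 0) (hslot : ∀ q, s.arr 12 q ≤ c₀) (ho : 12 < o)
    (hA : ∀ j, s.arr o j = A j) (hA1 : ∀ j < T, 1 ≤ A j ∧ A j ≤ T) (hA0 : ∀ j, T ≤ j → A j = 0)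
    (hdK : d * 2 ^ K ≤ 2 * T)
    (hL : T + 2 < L) (hL1 : (K + 1) * (2 * T) < L) (hL2 : K ≤ L) (hL3 : c₀ + K * T ≤ L) :
    Wp L (levelP o) s (K * (100 * (T + 1)) + 2) (fun s' =>
      (∀ k ≤ K, ∀ j < T, ∀ j' < T, s'.arr o (k * (2 * T) + j) = s'.arr o (k * (2 * T) + j') ↔
        ∀ i < 2 ^ k, A (j + d * i) = A (j' + d * i)) ∧
      s'.reg 14 ≤ c₀ + K * T ∧ ∀ q, s'.arr 12 q ≤ s'.reg 14) := by
  have no8 : o ≠ 8 := by omega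
  have no9 : o ≠ 9 := by omega
  unfold levelP
  refine Wp.mono (k := K * (((T * (2 + 2) + 2) + (1 + (1 + 40 * (T + 1)))) + 2) + 2) ?_
    (Nat.add_le_add_right (Nat.mul_le_mul_left _ (by omega)) _) fun _ _ h => h
  refine Wp.forTo (N := K) (fun r s' => s'.reg 13 = r * (2 * T) ∧ s'.reg 22 = d * 2 ^ r ∧
      (∀ k ≤ r, ∀ j < T, 1 ≤ s'.arr o (k * (2 * T) + j) ∧ s'.arr o (k * (2 * T) + j) ≤ T) ∧
      (∀ k ≤ r, ∀ j < 2 * T, T ≤ j → s'.arr o (k * (2 * T) + j) = 0) ∧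
      (∀ j, (r + 1) * (2 * T) ≤ j → s'.arr o j = 0) ∧
      (∀ k ≤ r, ∀ j < 2 * T, ∀ j' < 2 * T,
        s'.arr o (k * (2 * T) + j) = s'.arr o (k * (2 * T) + j') ↔
        ∀ i < 2 ^ k, A (j + d * i) = A (j' + d * i)) ∧
      s'.reg 14 ≤ c₀ + r * T ∧ ∀ q, s'.arr 12 q ≤ s'.reg 14) hL2 rfl ?_ ?_ ?_ ?_
  · intro s' hf
    simp [hf.reg 18 rfl, h18]
  · refine ⟨by simp [h13], by simp [h22], ?_, ?_, ?_, ?_, by simp [h14], ?_⟩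
    · intro k hk j hj
      obtain rfl : k = 0 := by omega
      simpa [hA] using hA1 j hj
    · intro k hk j hj hj'
      obtain rfl : k = 0 := by omega
      simpa [hA] using hA0 j hj'
    · intro j hj
      simpa [hA] using hA0 j (by omega)
    · intro k hk j hj j' hj'
      obtain rfl : k = 0 := by omega
      simp [hA]
    · intro q; simpa [h14] using hslot q
  · rintro r s₁ hr hf hrs ⟨e13, e22, hI1, hI2, hI3, hI4, hI5, hI6⟩
    have e12 : s₁.reg 12 = T := by rw [hf.reg 12 rfl, h12]
    clear hf
    have hrK : (r + 1 + 1) * (2 * T) ≤ (K + 1) * (2 * T) := Nat.mul_le_mul_right _ (by omega)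
    have hrT : (r + 1) * T ≤ K * T := Nat.mul_le_mul_right _ hr
    have hpw : d * 2 ^ (r + 1) ≤ d * 2 ^ K :=
      Nat.mul_le_mul_left _ (Nat.pow_le_pow_right (by omega) hr)
    have hr1 : (r + 1) * (2 * T) = r * (2 * T) + 2 * T := Nat.succ_mul _ _
    have hr2 : (r + 1 + 1) * (2 * T) = (r + 1) * (2 * T) + 2 * T := Nat.succ_mul _ _
    have hpw2 : d * 2 ^ (r + 1) = 2 * (d * 2 ^ r) := by rw [pow_succ]; ring
    rw [Nat.succ_mul] at hrT
    refine Wp.andThen (R := fun s' => (∀ j < T, s'.arr 8 j = s₁.arr o (r * (2 * T) + j) ∧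
      s'.arr 9 j = s₁.arr o (r * (2 * T) + (j + d * 2 ^ r)))) ?_ ?_
    · refine Wp.forTo (N := T) (fun i s' => ∀ j < i, s'.arr 8 j = s₁.arr o (r * (2 * T) + j) ∧
        s'.arr 9 j = s₁.arr o (r * (2 * T) + (j + d * 2 ^ r))) (by omega) rfl ?_ ?_ ?_ ?_
      · intro s' hf
        simp [hf.reg 12 rfl, e12]
      · intro j hj; omega
      · rintro i s' hi hf his hI
        refine Wp.of_vc' ?_ le_rfl
        have k13 : s'.reg 13 = r * (2 * T) := by rw [hf.reg 13 rfl]; simp [e13]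
        have k22 : s'.reg 22 = d * 2 ^ r := by rw [hf.reg 22 rfl]; simp [e22]
        have ko : s'.arr o = s₁.arr o := by
          rw [hf.arr o (by simp [writesArr_forTo, Prog.writesArr]; omega)]
        have b1 := hI1 r le_rfl i hi
        have b2 : s₁.arr o (r * (2 * T) + (i + d * 2 ^ r)) ≤ T := by
          rcases Nat.lt_or_ge (i + d * 2 ^ r) T with hlt | hge
          · exact (hI1 r le_rfl _ hlt).2
          · rw [hI2 r le_rfl _ (by omega) hge]; omega
        simp only [Prog.vc, Expr.eval_read, Expr.eval_reg, Expr.eval_add, Expr.safe_read,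
          Expr.safe_reg, Expr.safe_add, State.setArr_arr, State.setArr_reg, his, k13, k22, ko,
          no8, if_false, true_and, Nat.add_assoc]
        refine ⟨by omega, ⟨by omega, by omega⟩, by omega, ⟨by omega, by omega⟩, ?_⟩
        intro j hj
        by_cases hji : j = i
        · subst hji
          simp
        · obtain ⟨q1, q2⟩ := hI j (by omega)
          simp [hji, q1, q2]
      · intro s' hf hs hI j hj
        exact hI j hj
    intro s₂ hf₂ h89
    have e14 : s₂.reg 14 = s₁.reg 14 := by rw [hf₂.reg 14 rfl]
    have eo : s₂.arr o = s₁.arr o := by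
      rw [hf₂.arr o (by simp [writesArr_forTo, Prog.writesArr]; omega)]
    have f13 : s₂.reg 13 = r * (2 * T) := by rw [hf₂.reg 13 rfl, e13]
    have f12 : s₂.reg 12 = T := by rw [hf₂.reg 12 rfl, e12]
    have f22 : s₂.reg 22 = d * 2 ^ r := by rw [hf₂.reg 22 rfl, e22]
    have f12' : ∀ q, s₂.arr 12 q ≤ s₁.reg 14 := by rw [hf₂.arr 12 rfl]; exact hI6
    clear hf₂
    refine Wp.seq (Wp.assign (by simp) (by simp [f13, f12]; omega) (Wp.seq (Wp.assign (by simp)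
      (by simp [f22]; omega) ?_)))
    refine (nameP_spec (s := (s₂.setReg 13 _).setReg 22 _) (L := L) (T := T) (off := (r + 1) * (2 * T)) (c₀ := s₁.reg 14) (o := o)
      (P := s₂.arr 8)
      (Q := s₂.arr 9) ?_ ?_ ?_ rfl rfl ?_ ?_ f12' ho hL (by omega) (by omega)).mono le_rfl ?_
    · simp [f12]
    · simp [f13, f12, hr1]
    · simp [e14]
    · intro j hj; rw [(h89 j hj).1]; exact (hI1 r le_rfl j hj).2
    · intro j hj; rw [(h89 j hj).2]
      rcases Nat.lt_or_ge (j + d * 2 ^ r) T with hlt | hge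
      · have := hI1 r le_rfl _ hlt; omega
      · rw [hI2 r le_rfl _ (by omega) hge]; omega
    · rintro s₃ hf₃ ⟨n1, n2, n3, n4, n5⟩
      have g13 : s₃.reg 13 = (r + 1) * (2 * T) := by
        rw [hf₃.reg 13 rfl]; simp [f13, f12, hr1]
      have g22 : s₃.reg 22 = d * 2 ^ (r + 1) := by
        rw [hf₃.reg 22 rfl]; simp [f22, hpw2]
      simp only [State.setReg_arr, State.setReg_reg, show (14 : ℕ) ≠ 20 by omega, if_false,
        show (13 : ℕ) ≠ 20 by omega, show (22 : ℕ) ≠ 20 by omega] at n3 ⊢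
      rw [eo] at n3
      have old : ∀ k ≤ r, ∀ j < 2 * T, s₃.arr o (k * (2 * T) + j) = s₁.arr o (k * (2 * T) + j) := by
        intro k hk j hj
        have : (k + 1) * (2 * T) ≤ (r + 1) * (2 * T) := Nat.mul_le_mul_right _ (by omega)
        rw [Nat.succ_mul k] at this
        exact n3 _ (Or.inl (by omega))
      have zero : ∀ j, T ≤ j → s₃.arr o ((r + 1) * (2 * T) + j) = 0 := by
        intro j hj
        rw [n3 _ (Or.inr (by omega))]
        exact hI3 _ (by omega)
      refine ⟨g13, g22, ?_, ?_, ?_, ?_, ?_, n5⟩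
      · intro k hk j hj
        rcases Nat.le_succ_iff.1 hk with hk | rfl
        · rw [old k hk j (by omega)]; exact hI1 k hk j hj
        · exact n1 j hj
      · intro k hk j hj hj'
        rcases Nat.le_succ_iff.1 hk with hk | rfl
        · rw [old k hk j (by omega)]; exact hI2 k hk j hj hj'
        · exact zero j hj'
      · intro j hj
        obtain ⟨l, rfl⟩ : ∃ l, j = (r + 1) * (2 * T) + l := ⟨j - (r + 1) * (2 * T), by omega⟩
        exact zero l (by omega)
      · intro k hk j hj j' hj'
        rcases Nat.le_succ_iff.1 hk with hk | rfl
        · rw [old k hk j hj, old k hk j' hj']; exact hI4 k hk j hj j' hj'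
        · have base : ∀ j, A j = A (j + d * 0) := fun j => by simp
          have pos2 : 0 < 2 ^ (r + 1) := by positivity
          rcases Nat.lt_or_ge j T with hjT | hjT
          · rcases Nat.lt_or_ge j' T with hjT' | hjT'
            · rw [n2 j hjT j' hjT', (h89 j hjT).1, (h89 j' hjT').1, (h89 j hjT).2, (h89 j' hjT').2,
                hI4 r le_rfl j (by omega) j' (by omega),
                hI4 r le_rfl _ (by omega) _ (by omega)]
              rw [pow_succ]
              constructor
              · rintro ⟨q1, q2⟩ i hi
                rcases Nat.lt_or_ge i (2 ^ r) with hlt | hge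
                · exact q1 i hlt
                · have := q2 (i - 2 ^ r) (by omega)
                  have e : d * i = d * 2 ^ r + d * (i - 2 ^ r) := by
                    rw [← Nat.mul_add]; congr 1; omega
                  rw [e, ← add_assoc, ← add_assoc]
                  exact this
              · intro q
                refine ⟨fun i hi => q i (by omega), fun i hi => ?_⟩
                have := q (2 ^ r + i) (by omega)
                rw [Nat.mul_add, ← add_assoc, ← add_assoc] at this
                exact this
            -- One item is past the end and the other is not: already the base values, zero and
            -- positive, differ at `i = 0`.
            · rw [zero j' hjT']
              have h1 := n1 j hjT
              refine ⟨fun h => absurd h (Nat.pos_iff_ne_zero.1 h1.1), fun h => ?_⟩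
              have h2 := h 0 pos2
              rw [← base, ← base, hA0 j' hjT'] at h2
              have := hA1 j hjT
              omega
          · rw [zero j hjT]
            rcases Nat.lt_or_ge j' T with hjT' | hjT'
            · have h1 := n1 j' hjT'
              refine ⟨fun h => absurd h.symm (Nat.pos_iff_ne_zero.1 h1.1), fun h => ?_⟩
              have h2 := h 0 pos2
              rw [← base, ← base, hA0 j hjT] at h2
              have := hA1 j' hjT'
              omega
            · rw [zero j' hjT']
              simp only [true_iff]
              intro i _
              rw [hA0 _ (by omega), hA0 _ (by omega)]
      · rw [Nat.succ_mul]; omega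
  · rintro s' hf hs ⟨-, -, -, -, -, hI4, hI5, hI6⟩
    exact ⟨fun k hk j hj j' hj' => hI4 k hk j (by omega) j' (by omega), hI5, hI6⟩

end WordRAM


/-! ### The naming scheme at one scale -/

namespace WordRAM

theorem forall_lt_mul {a c : ℕ} {p : ℕ → Prop} :
    (∀ t < a * c, p t) ↔ ∀ i < a, ∀ i' < c, p (i * c + i') := by
  constructor
  · intro h i hi i' hi'
    refine h _ ?_
    have : (i + 1) * c ≤ a * c := Nat.mul_le_mul_right _ hi
    rw [Nat.succ_mul] at this
    omega
  · intro h t ht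
    have hc : 0 < c := by
      rcases Nat.eq_zero_or_pos c with rfl | hc
      · omega
      · exact hc
    have := h (t / c) ((Nat.div_lt_iff_lt_mul hc).2 ht) (t % c) (Nat.mod_lt _ hc)
    rwa [mul_comm, Nat.div_add_mod] at this

/-- Compute into array `o` the names of the blocks of lengths `d² 2^k`, `k ≤ K`, at the sampled
positions, where `d`, `d²`, `K` are in registers `15`, `16`, `18`. -/
def schemeP (o : ℕ) : Prog :=
  .assign 19 (.reg 0 / .reg 15 + .reg 15 + .const 1) ;; .assign 12 (.const 2 * .reg 19) ;;
  .forTo 6 (.reg 12) (.store o (.reg 6) (.const 1)) ;; .assign 13 (.const 0) ;;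
  foldP o ;; .assign 22 (.reg 15) ;; levelP o

/-- The array `N` contains the names of the blocks of lengths `d² 2^k`, `k ≤ K`. -/
def Names (F : ℕ → ℕ) (n d M K : ℕ) (N : ℕ → ℕ) : Prop :=
  ∀ k ≤ K, ∀ j < 2 * M, ∀ j' < 2 * M, pos M d j + 2 ^ k * (d * d) ≤ n →
    pos M d j' + 2 ^ k * (d * d) ≤ n →
    (N (k * (4 * M) + j) = N (k * (4 * M) + j') ↔
      ∀ t < 2 ^ k * (d * d), F (pos M d j + t) = F (pos M d j' + t))

/-- A block of `d² 2^k` letters at item `j` splits into `2^k` blocks of `d²` letters at the items `j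
+ d i` (by `pos_add`), and each of these into `R` coded blocks of `b` letters; equality of names
unfolds through these levels. -/
theorem schemeP_spec {L n b d R K M o c₀ : ℕ} {F : ℕ → ℕ} {s : State} (hd : 1 ≤ d)
    (hF : ∀ t, F t < 4) (h0 : s.reg 0 = n)
    (h2 : s.reg 2 = b) (h15 : s.reg 15 = d) (h16 : s.reg 16 = d * d)
    (h17 : s.reg 17 = R) (h18 : s.reg 18 = K) (h14 : s.reg 14 = c₀) (hM : M = n / d + d + 1)
    (hRb : d * d = R * b)
    (hcode : ∀ t, s.arr 4 t = code F b t) (hslot : ∀ q, s.arr 12 q ≤ c₀) (ho : 12 < o)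
    (hz : ∀ j, s.arr o j = 0) (hdK : d * 2 ^ K ≤ 4 * M)
    (hL : 2 * M + 2 < L) (hL0 : 4 ^ b < L) (hL1 : M * d + d + R * b < L) (hL2 : R ≤ L) (hL2' : K ≤ L)
    (hL3 : (K + 1) * (4 * M) < L) (hL4 : c₀ + (R + K) * (2 * M) ≤ L) :
    Wp L (schemeP o) s ((R + K + 1) * (100 * (2 * M + 1))) (fun s' =>
      s'.reg 12 = 2 * M ∧ s'.reg 19 = M ∧
      s'.reg 14 ≤ c₀ + (R + K) * (2 * M) ∧ (∀ q, s'.arr 12 q ≤ s'.reg 14) ∧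
      Names F n d M K (s'.arr o)) := by
  have hcl : ∀ t, code F b t + 1 < L := fun t => by
    have := code_lt hF b t
    omega
  have hM1 : d + 1 ≤ M := by
    rw [hM]
    exact Nat.succ_le_succ (Nat.le_add_left _ _)
  rw [Nat.add_mul] at hL4
  unfold schemeP
  refine Wp.mono (k := 1 + (1 + ((2 * M * (1 + 2) + 2) + (1 + ((R * (100 * (2 * M + 1)) + 2) +
    (1 + (K * (100 * (2 * M + 1)) + 2))))))) ?_ (by
      have : (R + K + 1) * (100 * (2 * M + 1)) =
        R * (100 * (2 * M + 1)) + K * (100 * (2 * M + 1)) + 100 * (2 * M + 1) := by ring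
      omega) fun _ _ h => h
  have hMe : (Expr.reg 0 / .reg 15 + .reg 15 + .const 1 : Expr).eval s = M := by
    simp [h0, h15, hM]
  refine Wp.seq (Wp.assign (by simp) (by rw [hMe]; omega) ?_)
  rw [hMe]
  refine Wp.seq (Wp.assign (by simp) (by simp; omega) ?_)
  have hTe : (Expr.const 2 * .reg 19 : Expr).eval (s.setReg 19 M) = 2 * M := by simp
  rw [hTe]
  refine Wp.andThen (R := fun s' => (∀ j < 2 * M, s'.arr o j = 1) ∧ ∀ j, 2 * M ≤ j → s'.arr o j = 0)
    ?_ ?_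
  · refine Wp.forTo (N := 2 * M) (fun i s' => (∀ j < i, s'.arr o j = 1) ∧
      ∀ j, i ≤ j → s'.arr o j = 0) (by omega) rfl ?_ ?_ ?_ ?_
    · intro s' hf
      simp [hf.reg 12 rfl]
    · exact ⟨fun j hj => by omega, fun j _ => hz j⟩
    · rintro i s' hi hf his ⟨hI1, hI2⟩
      refine Wp.of_vc' ⟨⟨by simp, by simp [his]; omega⟩, ⟨by simp, by simp; omega⟩, ?_, ?_⟩ le_rfl
      · intro j hj
        by_cases hji : j = i
        · simp [his, hji]
        · simpa [his, hji] using hI1 j (by omega)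
      · intro j hj
        simpa [his, show j ≠ i by omega] using hI2 j (by omega)
    · intro s' _ _ h
      exact h
  rintro s₁ hf₁ ⟨ho1, hoz⟩
  have no4 : (4 : ℕ) ≠ o := by omega
  have no12 : (12 : ℕ) ≠ o := by omega
  have hfa : ∀ a, a ≠ o → s₁.arr a = s.arr a := fun a ha => by
    rw [hf₁.arr a (by simp [writesArr_forTo, Prog.writesArr]; omega)]; rfl
  have f0 : s₁.reg 0 = n := by rw [hf₁.reg 0 rfl]; simp [h0]
  have f2 : s₁.reg 2 = b := by rw [hf₁.reg 2 rfl]; simp [h2]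
  have f12 : s₁.reg 12 = 2 * M := by rw [hf₁.reg 12 rfl]; simp
  have f14 : s₁.reg 14 = c₀ := by rw [hf₁.reg 14 rfl]; simp [h14]
  have f15 : s₁.reg 15 = d := by rw [hf₁.reg 15 rfl]; simp [h15]
  have f16 : s₁.reg 16 = d * d := by rw [hf₁.reg 16 rfl]; simp [h16]
  have f17 : s₁.reg 17 = R := by rw [hf₁.reg 17 rfl]; simp [h17]
  have f18 : s₁.reg 18 = K := by rw [hf₁.reg 18 rfl]; simp [h18]
  have f19 : s₁.reg 19 = M := by rw [hf₁.reg 19 rfl]; simp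
  have fcode : ∀ t, s₁.arr 4 t = code F b t := by rw [hfa 4 no4]; exact hcode
  have fslot : ∀ q, s₁.arr 12 q ≤ c₀ := by rw [hfa 12 no12]; exact hslot
  clear hf₁ hfa
  refine Wp.seq (Wp.assign (by simp) (by simp) ?_)
  refine Wp.andThen (foldP_spec (M := M) (R := R) (c₀ := c₀) (F := F) hd hcl ?_ ?_ ?_ ?_ ?_ ?_ ?_ ?_
    fcode fslot ho ho1 (by omega) hL hL1 hL2 (by omega)) ?_
  · simp [f2]
  · simp [f15]
  · simp [f16]
  · simp [f17]
  · simp [f12]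
  · simp [f19]
  · simp [f14]
  · simp
  rintro s₂ hf₂ ⟨n1, n2, n3, n4, n5⟩
  have g12 : s₂.reg 12 = 2 * M := by rw [hf₂.reg 12 rfl]; simp [f12]
  have g13 : s₂.reg 13 = 0 := by rw [hf₂.reg 13 rfl]; simp
  have g15 : s₂.reg 15 = d := by rw [hf₂.reg 15 rfl]; simp [f15]
  have g18 : s₂.reg 18 = K := by rw [hf₂.reg 18 rfl]; simp [f18]
  have g19 : s₂.reg 19 = M := by rw [hf₂.reg 19 rfl]; simp [f19]
  clear hf₂
  set A : ℕ → ℕ := s₂.arr o with hA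
  have hA0 : ∀ j, 2 * M ≤ j → A j = 0 := fun j hj => by
    rw [n3 j hj]; exact hoz j hj
  have hdn : n / d ≤ n := Nat.div_le_self _ _
  have hdL : d ≤ L := by omega
  refine Wp.seq (Wp.assign (by simp) (by simp [g15, hdL]) ?_)
  refine (levelP_spec (s := s₂.setReg 22 _) (d := d) (K := K) (T := 2 * M) (c₀ := s₂.reg 14) (A := A)
    ?_ ?_ ?_ ?_ ?_ n5 ho (fun _ => rfl) n1 hA0 (by omega) hL ?_ hL2' (by omega)).mono le_rfl ?_
  · simp [g18]
  · simp [g12]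
  · simp
  · simp [g15]
  · simp [g13]
  · rwa [show 2 * (2 * M) = 4 * M by ring]
  rintro s₃ hf₃ ⟨l1, l2, l3⟩
  have i12 : s₃.reg 12 = 2 * M := by rw [hf₃.reg 12 rfl]; simp [g12]
  have i19 : s₃.reg 19 = M := by rw [hf₃.reg 19 rfl]; simp [g19]
  clear hf₃
  refine ⟨i12, i19, by rw [Nat.add_mul]; omega, l3, ?_⟩
  intro k hk j hj j' hj' hjn hjn'
  have := l1 k hk j hj j' hj'
  rw [show 2 * (2 * M) = 4 * M by ring] at this
  rw [this, forall_lt_mul]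
  refine forall_congr' fun i => ?_
  refine forall_congr' fun hi => ?_
  have hdd : 0 < d * d := Nat.mul_pos hd hd
  have hik : (i + 1) * (d * d) ≤ 2 ^ k * (d * d) := Nat.mul_le_mul_right _ hi
  rw [Nat.succ_mul] at hik
  obtain ⟨p1, p2⟩ := pos_add (n := n) (i := i) hd (by omega) hj (by omega)
  obtain ⟨p3, p4⟩ := pos_add (n := n) (i := i) hd (by omega) hj' (by omega)
  rw [n2 _ p1 _ p3, p2, p4, hRb, forall_lt_mul]
  refine forall_congr' fun i' => ?_
  refine forall_congr' fun hi' => ?_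
  rw [code_eq_iff hF]
  refine forall_congr' fun i'' => ?_
  refine forall_congr' fun hi'' => ?_
  simp only [add_assoc]

end WordRAM


/-! ## Longest common prefixes with the suffixes -/

namespace WordRAM

/-- `k` is the length of the longest common prefix of `A 0, …, A (n-1)` and its suffix from
position `p`. -/
def IsLcp (A : ℕ → ℕ) (n p k : ℕ) : Prop :=
  p + k ≤ n ∧ (∀ i < k, A i = A (p + i)) ∧ (p + k < n → A k ≠ A (p + k))

/-- The invariant of the computation of the longest common prefixes: `Z` is correct below `p`,
`k` letters agree at `p`, the segment from `l` to `r` agrees with a prefix, and `j` steps are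
done. -/
structure LcpInv (A Z : ℕ → ℕ) (n j p k l r : ℕ) : Prop where
  pos : 1 ≤ p
  done : ∀ q, 1 ≤ q → q < p → q < n → IsLcp A n q (Z q)
  bound : p < n → p + k ≤ n
  agree : p < n → ∀ i < k, A i = A (p + i)
  left : l < p
  left_pos : r = 0 ∨ 1 ≤ l
  right : r ≤ n
  segment : ∀ i, l + i < r → A i = A (l + i)
  mismatch : p + k < r → A k ≠ A (p + k)
  steps : n ≤ p ∨ (j + 2 ≤ p + r ∨ j + 2 ≤ p + (p + k))

namespace LcpInv
variable {A Z : ℕ → ℕ} {n j p k l r : ℕ}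

/-- A successful comparison cannot happen inside the known segment, by `mismatch`; so `p + k` passes
beyond `r`, and progress is made. -/
theorem extend (h : LcpInv A Z n j p k l r) (hk : p + k < n) (he : A k = A (p + k)) :
    LcpInv A Z n (j + 1) p (k + 1) l r := by
  have hr : r ≤ p + k := by
    by_contra hr
    exact h.mismatch (by omega) he
  refine ⟨h.pos, h.done, fun _ => by omega, fun hp i hi => ?_, h.left, h.left_pos, h.right,
    h.segment, fun _ => by omega, ?_⟩
  · rcases Nat.lt_succ_iff_lt_or_eq.1 hi with hi | rfl
    exacts [h.agree hp i hi, he]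
  · have := h.steps
    omega

theorem isLcp (h : LcpInv A Z n j p k l r) (hp : p < n) (hk : p + k < n → A k ≠ A (p + k)) :
    IsLcp A n p k := ⟨h.bound hp, h.agree hp, hk⟩

/-- The matched segment is a copy of a prefix, so what is known about the position `p + 1 - l'`
carries over to `p + 1` as far as the segment reaches; this is the minimum. If the old value ends
before the segment does, its mismatch carries over too and gives the field `mismatch`. -/
theorem next {l' r' : ℕ} (h : LcpInv A Z n j p k l r) (hp : p < n)
    (hk : p + k < n → A k ≠ A (p + k))
    (hlr : (l' = l ∧ r' = r ∧ p + k ≤ r) ∨ (l' = p ∧ r' = p + k ∧ r < p + k)) {k' : ℕ}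
    (hk' : (r' ≤ p + 1 ∧ k' = 0) ∨ (p + 1 < r' ∧
      k' = min (r' - (p + 1)) ((Function.update Z p k) (p + 1 - l')))) :
    LcpInv A (Function.update Z p k) n (j + 1) (p + 1) k' l' r' := by
  have hd : ∀ q, 1 ≤ q → q < p + 1 → q < n → IsLcp A n q (Function.update Z p k q) := by
    intro q h1 hq hqn
    rcases Nat.lt_succ_iff_lt_or_eq.1 hq with hq | rfl
    · rw [Function.update_of_ne hq.ne]
      exact h.done q h1 hq hqn
    · rw [Function.update_self]
      exact h.isLcp hp hk
  have hb := h.bound hp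
  have hl := h.left
  have hl0 := h.left_pos
  have hr := h.right
  have hp1 := h.pos
  have hs : ∀ i, l' + i < r' → A i = A (l' + i) := by
    rcases hlr with ⟨rfl, rfl, -⟩ | ⟨rfl, rfl, -⟩
    · exact h.segment
    · exact fun i hi => h.agree hp i (by omega)
  have hst := h.steps
  rcases hk' with ⟨h1, rfl⟩ | ⟨h1, hk'⟩
  · exact ⟨by omega, hd, fun _ => by omega, fun _ i hi => by omega, by omega, by omega, by omega, hs,
      fun _ => by omega, by omega⟩
  · obtain ⟨e1, e2, e3⟩ := hd (p + 1 - l') (by omega) (by omega) (by omega)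
    set K := Function.update Z p k (p + 1 - l')
    have shift : ∀ i, p + 1 + i < r' → A (p + 1 - l' + i) = A (p + 1 + i) := fun i hi => by
      rw [hs _ (by omega)]
      congr 1
      omega
    refine ⟨by omega, hd, fun _ => by omega, fun _ i hi => ?_, by omega, by omega, by omega, hs,
      fun hlt => ?_, by omega⟩
    · rw [e2 i (by omega), shift i (by omega)]
    · obtain rfl : k' = K := by omega
      rw [← shift _ hlt]
      exact e3 (by omega)

end LcpInv

theorem State.setArr_arr_self (s : State) (a i v : ℕ) :
    (s.setArr a i v).arr a = Function.update (s.arr a) i v := by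
  simp [State.setArr]

/-- Compute into array `z` the longest common prefixes of array `a` and its suffixes. -/
def lcpP (a z : ℕ) : Prog :=
  .assign 23 (.const 1) ;; .assign 24 (.const 0) ;; .assign 25 (.const 0) ;; .assign 26 (.const 0) ;;
  .forTo 6 (.const 2 * .reg 0)
    (.cond ((Expr.reg 23).lt (.reg 0))
      (.cond ((Expr.reg 23 + .reg 24).lt (.reg 0) *
          (Expr.read a (.reg 24)).eq (.read a (.reg 23 + .reg 24)))
        (.assign 24 (.reg 24 + .const 1))
        (.store z (.reg 23) (.reg 24) ;;
          .cond ((Expr.reg 26).lt (.reg 23 + .reg 24))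
            (.assign 25 (.reg 23) ;; .assign 26 (.reg 23 + .reg 24)) .skip ;;
          .assign 23 (.reg 23 + .const 1) ;;
          .cond ((Expr.reg 23).lt (.reg 26))
            (.assign 24 (.read z (.reg 23 - .reg 25)) ;;
              .cond ((Expr.reg 26 - .reg 23).lt (.reg 24)) (.assign 24 (.reg 26 - .reg 23)) .skip)
            (.assign 24 (.const 0))))
      .skip)

/-- In each round either `p`, or the maximum of `r` and `p + k`, grows while the other does not
shrink. As their sum is less than `2 n` while `p < n`, `2 n` rounds suffice. -/
theorem lcpP_spec {L n a z : ℕ} {A : ℕ → ℕ} {s : State} (haz : a ≠ z) (hn : s.reg 0 = n)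
    (hL : 2 * n + 2 ≤ L) (hA : s.arr a = A) :
    Wp L (lcpP a z) s (30 * (n + 1)) (fun s' => ∀ p, 1 ≤ p → p < n → IsLcp A n p (s'.arr z p)) := by
  unfold lcpP
  refine Wp.mono (k := 1 + (1 + (1 + (1 + (2 * n * (11 + 2) + 2))))) ?_ (by omega) fun _ _ h => h
  refine Wp.seq (Wp.assign (by simp) (by simp; omega) (Wp.seq (Wp.assign (by simp) (by simp) (Wp.seq
    (Wp.assign (by simp) (by simp) (Wp.seq (Wp.assign (by simp) (by simp) ?_)))))))
  refine Wp.forTo (N := 2 * n) (fun j s' => LcpInv A (s'.arr z) n j (s'.reg 23) (s'.reg 24)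
    (s'.reg 25) (s'.reg 26)) (by omega) rfl ?_ ?_ ?_ ?_
  · intro s' hf
    simp [hf.reg 0 rfl, hn]
  · constructor <;> simp
    · intro q h1 h2; omega
    · omega
  · rintro j s' hj hf hs hI
    refine Wp.of_vc' ?_ le_rfl
    have h0 : s'.reg 0 = n := by rw [hf.reg 0 rfl]; simp [hn]
    have ha : s'.arr a = A := by
      rw [hf.arr a (by simp [writesArr_forTo, Prog.writesArr, haz.symm])]; exact hA
    generalize hp : s'.reg 23 = p at hI
    generalize hk : s'.reg 24 = k at hI
    generalize hl : s'.reg 25 = l at hI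
    generalize hr : s'.reg 26 = r at hI
    generalize hZ : s'.arr z = Z at hI
    simp only [Prog.vc, Expr.eval_lt, Expr.eval_eq, Expr.eval_add, Expr.eval_sub, Expr.eval_mul,
      Expr.eval_const, Expr.eval_reg, Expr.eval_read, h0, hp, hk, hl, hr, ha,
      Expr.safe_lt, Expr.safe_add, Expr.safe_mul, Expr.safe_reg, Expr.safe_const, Expr.safe_sub,
      Expr.safe_eq, Expr.safe_read, State.setReg_reg, State.setReg_arr, State.setArr_reg, ne_eq,
      ite_eq_right_iff, one_ne_zero, imp_false, not_not, mul_eq_zero, true_and, and_true, not_or, reduceIte, Nat.reduceEqDiff,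
      State.setArr_arr_self, hZ]
    clear hf
    refine ⟨fun hpn => ?_, fun hpn => ?_⟩
    swap
    · exact ⟨hI.pos, hI.done, hI.bound, hI.agree, hI.left, hI.left_pos, hI.right, hI.segment,
        hI.mismatch, Or.inl (by omega)⟩
    have hb := hI.bound hpn
    have hl := hI.left
    have hr := hI.right
    have hp1 := hI.pos
    have hle : ∀ q, 1 ≤ q → q ≤ p → Function.update Z p k q ≤ n := by
      intro q h1 hq
      rcases hq.lt_or_eq with hq | rfl
      · rw [Function.update_of_ne hq.ne]
        have := (hI.done q h1 hq (by omega)).1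
        omega
      · rw [Function.update_self]
        omega
    refine ⟨by omega, fun h => ⟨by omega, hI.extend h.1 h.2⟩, fun h => ?_⟩
    have hk : p + k < n → A k ≠ A (p + k) := fun h1 h2 => by
      rcases h with h | h <;> contradiction
    refine ⟨by omega, by omega, fun hr' => ⟨by omega, by omega, by omega, fun h1 => ?_, fun h1 => ?_⟩,
      fun hr' => ⟨by omega, fun h1 => ?_, fun h1 => ?_⟩⟩
    · have := hle (p + 1 - p) (by omega) (by omega)
      refine ⟨by omega, by omega, fun h2 => ⟨by omega, ?_⟩, fun h2 => ?_⟩ <;>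
        exact hI.next hpn hk (by omega) (Or.inr ⟨h1, by omega⟩)
    · exact ⟨by omega, hI.next hpn hk (by omega) (Or.inl (by omega))⟩
    · have := hle (p + 1 - l) (by omega) (by have := hI.left_pos; omega)
      refine ⟨by omega, by omega, fun h2 => ⟨by omega, ?_⟩, fun h2 => ?_⟩ <;>
        exact hI.next hpn hk (by omega) (Or.inr ⟨h1, by omega⟩)
    · exact ⟨by omega, hI.next hpn hk (by omega) (Or.inl (by omega))⟩
  · intro s' hf hs h p hp hpn
    have h1 := h.right
    have h2 := h.bound
    have h3 := h.steps
    exact h.done p hp (by omega) hpn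

end WordRAM


/-! ## Comparing a block with its translate -/

namespace WordRAM

/-- Clear the flag in register `31` unless the expressions are equal. -/
def checkP (e e' : Expr) : Prog := .cond (e.eq e') .skip (.assign 31 (.const 0))

theorem checkP_spec {L : ℕ} {e e' : Expr} {s : State} (h : e.Safe L s) (h' : e'.Safe L s)
    (P : Prop) (hP : e.eval s = e'.eval s ↔ P) :
    Wp L (checkP e e') s 2 (fun s' => s'.reg 31 ≠ 0 ↔ s.reg 31 ≠ 0 ∧ P) := by
  refine Wp.of_vc' ⟨⟨h, h'⟩, fun h1 => ?_, fun h1 => ⟨trivial, by simp, ?_⟩⟩ le_rfl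
  · have : P := hP.1 (by by_contra h2; simp [h2] at h1)
    simp [this, Prog.vc]
  · have : ¬ P := fun h2 => by simp [hP.2 h2] at h1
    simp [this]

/-- The predicate depends only on the first `31` registers and on the arrays. -/
def Stable (E : State → Prop) : Prop :=
  ∀ s s', (∀ x < 31, s'.reg x = s.reg x) → s'.arr = s.arr → E s → E s'

theorem Stable.setReg {E : State → Prop} (h : Stable E) {s : State} {x v : ℕ} (hx : 31 ≤ x)
    (hs : E s) : E (s.setReg x v) :=
  h s _ (fun y hy => by simp [show y ≠ x by omega]) rfl hs

theorem Stable.frame {E : State → Prop} (h : Stable E) {p : Prog} (hr : ∀ x < 31, p.writesReg x = false)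
    (ha : ∀ a, p.writesArr a = false) {s s' : State} (hf : Frame p s s') (hs : E s) : E s' :=
  h s s' (fun x hx => hf.reg x (hr x hx)) (funext fun a => hf.arr a (ha a)) hs

/-- In states satisfying `E`, the program finds out whether a block of length less than `m` agrees
with its translate by `p`. Its first position and its length are in registers `x` and `x + 1`. -/
def EqTest (L : ℕ) (F : ℕ → ℕ) (n p : ℕ) (E : State → Prop) (prog : Prog) (x m k : ℕ) : Prop :=
  ∀ s X N, E s → s.reg x = X → s.reg (x + 1) = N → N < m → X + N + p ≤ n →
    Wp L prog s k (fun s' => s'.reg 31 ≠ 0 ↔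
      (s.reg 31 ≠ 0 ∧ ∀ t < N, F (X + t) = F (X + p + t)))

/-- The test of short blocks by their codes. -/
def shortP : Prog :=
  .cond ((Expr.reg 2).lt (.reg 33))
    (checkP (.read 4 (.reg 32)) (.read 4 (.reg 32 + .reg 30)) ;;
      checkP (.read 4 (.reg 32 + .reg 33 - .reg 2)) (.read 4 (.reg 32 + .reg 33 - .reg 2 + .reg 30)))
    (checkP (.read 4 (.reg 32) % .read 5 (.reg 33))
      (.read 4 (.reg 32 + .reg 30) % .read 5 (.reg 33)))

/-- A block of length between `b` and `2 b` is covered by its first and its last `b` letters; a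
shorter one is compared by truncated codes. -/
theorem shortP_spec {L n p b : ℕ} {F : ℕ → ℕ} {E : State → Prop} (hF : ∀ t, F t < 4)
    (hE : ∀ s, E s → s.reg 2 = b ∧ s.reg 30 = p ∧ (∀ t, s.arr 4 t = code F b t) ∧
      ∀ i ≤ b, s.arr 5 i = 4 ^ i)
    (hL : n < L) : EqTest L F n p E shortP 32 (2 * b) 5 := by
  intro s X N hs hX hN hNb hXN
  obtain ⟨h2, h30, h4, h5⟩ := hE s hs
  unfold shortP
  refine (Wp.cond (k := 2 + 2) (k' := 2) (by simp) (fun hlt => ?_) fun hlt => ?_).mono le_rfl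
    fun _ _ h => h
  · have hlt : b < N := by
      by_contra h
      simp [h2, hN, h] at hlt
    refine Wp.andThen (checkP_spec ?_ ?_ (∀ t < b, F (X + t) = F (X + p + t)) ?_) ?_
    · simp [hX]; omega
    · simp [hX, h30]; omega
    · simp only [Expr.eval_read, Expr.eval_reg, Expr.eval_add, hX, h30, h4, code_eq_iff hF]
    intro s' hf h1
    have g2 : s'.reg 2 = b := by rw [hf.reg 2 rfl, h2]
    have g30 : s'.reg 30 = p := by rw [hf.reg 30 rfl, h30]
    have g32 : s'.reg 32 = X := by rw [hf.reg 32 rfl, hX]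
    have g33 : s'.reg 33 = N := by rw [hf.reg 33 rfl, hN]
    have g4 : ∀ t, s'.arr 4 t = code F b t := by rw [hf.arr 4 rfl]; exact h4
    refine (checkP_spec (by simp [g2, g32, g33]; omega) (by simp [g2, g30, g32, g33]; omega)
      (∀ t < b, F (X + N - b + t) = F (X + N - b + p + t)) ?_).mono le_rfl ?_
    · simp only [Expr.eval_read, Expr.eval_reg, Expr.eval_add, Expr.eval_sub, g2, g30, g32, g33, g4,
        code_eq_iff hF]
    intro s'' _ h3
    rw [h3, h1, and_assoc]
    refine and_congr_right fun _ => ⟨fun ⟨a1, a2⟩ t ht => ?_, fun a => ⟨fun t ht => a t (by omega),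
      fun t ht => ?_⟩⟩
    · rcases Nat.lt_or_ge t b with h | h
      · exact a1 t h
      · have := a2 (t + b - N) (by omega)
        rwa [show X + N - b + (t + b - N) = X + t by omega,
          show X + N - b + p + (t + b - N) = X + p + t by omega] at this
    · have := a (N - b + t) (by omega)
      rwa [show X + (N - b + t) = X + N - b + t by omega,
        show X + p + (N - b + t) = X + N - b + p + t by omega] at this
  · have hle : N ≤ b := by
      by_contra h
      simp [h2, hN, show b < N by omega] at hlt
    refine checkP_spec (by simp [hX, hN]; omega) (by simp [hX, hN, h30]; omega) _ ?_
    simp only [Expr.eval_read, Expr.eval_reg, Expr.eval_add, Expr.eval_mod, hX, hN, h30, h4, h5 N hle,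
      code_mod hF hle, code_eq_iff hF]

/-- Test the block at the position in register `c + 4` with length `d² 2^k`, up to a shift by less
than `d²`, and the letters before; `k` is in register `c + 2`. -/
def blockP (D B M o c c' : ℕ) (small : Prog) : Prog :=
  .assign c' (.reg (c + 4)) ;; .assign (c' + 1) (.reg B) ;; small ;;
  .assign (c + 5) ((.reg 30 % .reg D + .reg B - (.reg (c + 4) + .reg 30) % .reg B) % .reg B) ;;
  checkP (.read o (.reg (c + 2) * (.const 4 * .reg M) + (.reg (c + 4) + .reg (c + 5)) / .reg D))
    (.read o (.reg (c + 2) * (.const 4 * .reg M) + (.reg M +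
      ((.reg (c + 4) + .reg (c + 5) + .reg 30) / .reg B * .reg D +
        (.reg (c + 4) + .reg (c + 5) + .reg 30) % .reg B))))

/-- The test of longer blocks by their names. -/
def longP (D B M o c c' : ℕ) (small : Prog) : Prog :=
  .cond ((Expr.reg (c + 1)).lt (.const 2 * .reg B))
    (.assign c' (.reg c) ;; .assign (c' + 1) (.reg (c + 1)) ;; small)
    (.assign (c + 2) (.read 6 (.reg (c + 1) / .reg B - .const 1)) ;;
      .assign (c + 3) (.read 7 (.reg (c + 1) / .reg B - .const 1) * .reg B) ;;
      .assign (c + 4) (.reg c) ;; blockP D B M o c c' small ;;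
      .assign (c + 4) (.reg c + .reg (c + 1) - .reg (c + 3) - .reg B) ;; blockP D B M o c c' small ;;
      .assign c' (.reg c + .reg (c + 1) - .reg B) ;; .assign (c' + 1) (.reg B) ;; small)

/-- The data used by the test of longer blocks. -/
structure NameEnv (F : ℕ → ℕ) (n p d K : ℕ) (D B M o : ℕ) (s : State) : Prop where
  shift : s.reg 30 = p
  base : s.reg D = d
  sq : s.reg B = d * d
  num : s.reg M = n / d + d + 1
  log : ∀ q ≤ n, s.arr 6 q = Nat.log 2 q ∧ s.arr 7 q = 2 ^ Nat.log 2 q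
  names : Names F n d (n / d + d + 1) K (s.arr o)

/-- The choice of `δ` makes `z + δ + p` congruent to `p % d` mod `d²`, so this position is of the
second kind. Reduced mod `d`, the congruence says that `d` divides `z + δ`, a position of the first
kind. -/
theorem exists_sampled {n d p z w : ℕ} (hd : 1 ≤ d) (hzw : z + w + d * d + p ≤ n) {δ : ℕ}
    (hδ : δ = (p % d + d * d - (z + p) % (d * d)) % (d * d)) :
    δ < d * d ∧ (z + δ) / d < n / d + d + 1 ∧ pos (n / d + d + 1) d ((z + δ) / d) = z + δ ∧
    (z + δ + p) / (d * d) * d + (z + δ + p) % (d * d) < n / d + d + 1 ∧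
    pos (n / d + d + 1) d (n / d + d + 1 +
      ((z + δ + p) / (d * d) * d + (z + δ + p) % (d * d))) = z + δ + p := by
  have hB : 0 < d * d := Nat.mul_pos hd hd
  have hlt : δ < d * d := hδ ▸ Nat.mod_lt _ hB
  have hr : p % d < d := Nat.mod_lt _ hd
  have hdd : d ≤ d * d := Nat.le_mul_of_pos_left _ hd
  have hmod : (z + δ + p) % (d * d) = p % d := by
    have h1 := Nat.mod_lt (z + p) hB
    have h2 : (z + p) % (d * d) + (p % d + d * d - (z + p) % (d * d)) = p % d + d * d := by omega
    rw [show z + δ + p = z + p + δ by omega, hδ, Nat.add_mod_mod, ← Nat.mod_add_mod, h2,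
      Nat.add_mod_right, Nat.mod_eq_of_lt (by omega)]
  have hdvd : d ∣ z + δ := by
    have h1 : (z + δ + p) % d = p % d := by
      rw [← Nat.mod_mod_of_dvd (z + δ + p) (Dvd.intro d rfl : d ∣ d * d), hmod, Nat.mod_mod]
    have h2 : z + δ + p ≡ 0 + p [MOD d] := by simpa [Nat.ModEq] using h1
    exact (Nat.modEq_zero_iff_dvd).1 (Nat.ModEq.add_right_cancel' p h2)
  have hle : (z + δ) / d ≤ n / d := Nat.div_le_div_right (by omega)
  have hle' : (z + δ + p) / (d * d) * d ≤ n / d := by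
    rw [← Nat.div_div_eq_div_mul]
    exact (Nat.div_mul_le_self _ _).trans (Nat.div_le_div_right (by omega))
  refine ⟨hlt, by omega, ?_, by omega, ?_⟩
  · rw [pos, if_pos (by omega), Nat.div_mul_cancel hdvd]
  · rw [pos, if_neg (by omega), Nat.add_sub_cancel_left, hmod, Nat.mul_add_mod_of_lt hr,
      Nat.mul_comm _ d, Nat.mul_add_div hd, Nat.div_eq_of_lt hr, Nat.add_zero, ← hmod,
      Nat.div_add_mod']

section
variable {L n p d K D B M o c c' m k : ℕ} {F : ℕ → ℕ} {E : State → Prop} {small : Prog}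

/-- The names compare the blocks only from `z + δ` on; the letters skipped are among the first `d²`,
which the test `small` has compared. So the test settles a segment of length `2 ^ i d² + δ`, where
only `δ < d²` is known. -/
theorem blockP_spec (hd : 1 ≤ d) (hE : Stable E) (hEn : ∀ s, E s → NameEnv F n p d K D B M o s)
    (hD : D < 31) (hB : B < 31) (hM : M < 31) (hc' : 32 ≤ c') (hc : c' + 1 < c)
    (hsmall : EqTest L F n p E small c' (2 * (d * d)) k)
    (hw : ∀ x, x < 31 ∨ c ≤ x → small.writesReg x = false) (ha : ∀ a, small.writesArr a = false)
    (hL : n < L) (hL3 : (K + 1) * (4 * (n / d + d + 1)) < L) {s : State} {z i : ℕ} (hs : E s)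
    (hz : s.reg (c + 4) = z) (hi : s.reg (c + 2) = i) (hiK : i ≤ K)
    (hzn : z + 2 ^ i * (d * d) + d * d + p ≤ n) :
    Wp L (blockP D B M o c c' small) s (k + 5) (fun s' => ∃ δ < d * d, (s'.reg 31 ≠ 0 ↔
      (s.reg 31 ≠ 0 ∧ ∀ t < 2 ^ i * (d * d) + δ, F (z + t) = F (z + p + t)))) := by
  have hdd : 1 ≤ d * d := Nat.mul_pos hd hd
  have hBB : d * d ≤ 2 ^ i * (d * d) := Nat.le_mul_of_pos_left _ (Nat.two_pow_pos i)
  unfold blockP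
  refine Wp.mono (k := 1 + (1 + (k + (1 + 2)))) ?_ (by omega) fun _ _ h => h
  have h1 := hEn s hs
  refine Wp.seq (Wp.assign (by simp) (by simp [hz]; omega) ?_)
  refine Wp.seq (Wp.assign (by simp) (by simp [h1.sq, show B ≠ c' by omega]; omega) ?_)
  refine Wp.andThen (hsmall _ z (d * d) ?_ ?_ ?_ (by omega) (by omega)) ?_
  · exact hE.setReg (by omega) (hE.setReg (by omega) hs)
  · simp [hz]
  · simp [h1.sq, show B ≠ c' by omega]
  intro s₁ hf₁ hs₁
  have hs₁E : E s₁ := hE.frame (fun x hx => hw x (by omega)) ha hf₁ (hE.setReg (by omega) (hE.setReg (by omega) hs))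
  have g2 : s₁.reg (c + 2) = i := by
    rw [hf₁.reg _ (hw _ (by omega))]
    simp [hi, show c + 2 ≠ c' by omega, show c + 2 ≠ c' + 1 by omega]
  have g4 : s₁.reg (c + 4) = z := by
    rw [hf₁.reg _ (hw _ (by omega))]
    simp [hz, show c + 4 ≠ c' by omega, show c + 4 ≠ c' + 1 by omega]
  simp only [State.setReg_reg, show 31 ≠ c' by omega, show 31 ≠ c' + 1 by omega,
    if_false] at hs₁
  clear hf₁ h1
  obtain ⟨e30, eD, eB, eM, -, eN⟩ := hEn s₁ hs₁E
  generalize hδ : (p % d + d * d - (z + p) % (d * d)) % (d * d) = δ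
  obtain ⟨q1, q2, q3, q4, q5⟩ := exists_sampled hd hzn hδ.symm
  have hev : ((.reg 30 % .reg D + .reg B - (.reg (c + 4) + .reg 30) % .reg B) % .reg B :
      Expr).eval s₁ = δ := by
    simp [e30, eD, eB, g4, hδ]
  refine Wp.seq (Wp.assign (by simp) (by rw [hev]; omega) ?_)
  rw [hev]
  have hidx : ∀ j < 2 * (n / d + d + 1), i * (4 * (n / d + d + 1)) + j < L := by
    intro j hj
    have : i * (4 * (n / d + d + 1)) ≤ K * (4 * (n / d + d + 1)) := Nat.mul_le_mul_right _ hiK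
    rw [Nat.succ_mul] at hL3
    omega
  have a1 := hidx ((z + δ) / d) (by omega)
  have a2 := hidx (n / d + d + 1 +
      ((z + δ + p) / (d * d) * d + (z + δ + p) % (d * d))) (by omega)
  refine (checkP_spec ?_ ?_ (∀ t < 2 ^ i * (d * d), F (z + δ + t) = F (z + δ + p + t)) ?_).mono le_rfl ?_
  · simp [eM, eD, g2, g4, show D ≠ c + 5 by omega, show M ≠ c + 5 by omega, a1]
  · simp [eM, eD, eB, e30, g2, g4, show D ≠ c + 5 by omega, show M ≠ c + 5 by omega,
      show B ≠ c + 5 by omega, show 30 ≠ c + 5 by omega, a2]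
  · simp only [Expr.eval_read, Expr.eval_add, Expr.eval_mul, Expr.eval_div, Expr.eval_mod,
      Expr.eval_const, Expr.eval_reg, State.setReg_reg, State.setReg_arr, eM, eD, eB, e30, g2, g4,
      show D ≠ c + 5 by omega, show M ≠ c + 5 by omega, show c + 2 ≠ c + 5 by omega,
      show c + 4 ≠ c + 5 by omega, show B ≠ c + 5 by omega, show 30 ≠ c + 5 by omega, if_true,
      if_false]
    rw [eN i hiK _ (by omega) _ (by omega) (by rw [q3]; omega) (by rw [q5]; omega), q3, q5]
  · intro s₂ _ hs₂
    refine ⟨δ, q1, ?_⟩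
    rw [hs₂]
    simp only [State.setReg_reg, show 31 ≠ c + 5 by omega, if_false]
    rw [hs₁, and_assoc]
    refine and_congr_right fun _ => ⟨fun ⟨r1, r2⟩ t ht => ?_, fun r => ⟨fun t ht => r t (by omega),
      fun t ht => ?_⟩⟩
    · rcases Nat.lt_or_ge t (d * d) with h | h
      · exact r1 t h
      · have := r2 (t - δ) (by omega)
        rwa [show z + δ + (t - δ) = z + t by omega,
          show z + δ + p + (t - δ) = z + p + t by omega] at this
    · have := r (δ + t) (by omega)
      rwa [← add_assoc, show z + p + (δ + t) = z + δ + p + t by omega] at this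

/-- Two segments of length at least `w` near the ends and the last `B` places cover a segment of
length at most `2 w + B`. -/
theorem forall_lt_iff_cover {F : ℕ → ℕ} {X p N w B δ₁ δ₂ : ℕ} (h1 : δ₁ < B) (h2 : δ₂ < B)
    (w1 : w + B ≤ N) (w2 : N ≤ 2 * w + B) :
    ((∀ t < w + δ₁, F (X + t) = F (X + p + t)) ∧
      (∀ t < w + δ₂, F (X + N - w - B + t) = F (X + N - w - B + p + t)) ∧
      ∀ t < B, F (X + N - B + t) = F (X + N - B + p + t)) ↔
    ∀ t < N, F (X + t) = F (X + p + t) := by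
  refine ⟨fun ⟨r1, r2, r3⟩ t ht => ?_, fun r => ⟨fun t ht => r t (by omega),
    fun t ht => ?_, fun t ht => ?_⟩⟩
  · by_cases h1 : t < w
    · exact r1 t (by omega)
    by_cases h2 : t < N - B
    · have := r2 (t + w + B - N) (by omega)
      rwa [show X + N - w - B + (t + w + B - N) = X + t by omega,
        show X + N - w - B + p + (t + w + B - N) = X + p + t by omega] at this
    · have := r3 (t + B - N) (by omega)
      rwa [show X + N - B + (t + B - N) = X + t by omega,
        show X + N - B + p + (t + B - N) = X + p + t by omega] at this
  · have := r (N - w - B + t) (by omega)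
    rwa [show X + (N - w - B + t) = X + N - w - B + t by omega,
      show X + p + (N - w - B + t) = X + N - w - B + p + t by omega] at this
  · have := r (N - B + t) (by omega)
    rwa [show X + (N - B + t) = X + N - B + t by omega,
      show X + p + (N - B + t) = X + N - B + p + t by omega] at this

-- With `i` the logarithm of `N / d² - 1`, the length `w = 2 ^ i d²` satisfies `w + d² ≤ N ≤ 2 w +
-- d²`. One segment begins at `X`, one at `X + N - w - d²`, and the last `d²` letters are tested
-- directly; together they cover the block. The reserve `d²` keeps the shifted segments inside it.
-- The test `small` is run three times, hence `3 * k`.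
set_option maxHeartbeats 1000000 in
theorem longP_spec (hd : 1 ≤ d) (hE : Stable E) (hEn : ∀ s, E s → NameEnv F n p d K D B M o s)
    (hD : D < 31) (hB : B < 31) (hM : M < 31) (hc' : 32 ≤ c') (hc : c' + 1 < c)
    (hsmall : EqTest L F n p E small c' (2 * (d * d)) k)
    (hw : ∀ x, x < 31 ∨ c ≤ x → small.writesReg x = false) (ha : ∀ a, small.writesArr a = false)
    (hL : n < L) (hL3 : (K + 1) * (4 * (n / d + d + 1)) < L)
    (hm : ∀ N < m, N ≤ n → Nat.log 2 (N / (d * d) - 1) ≤ K) :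
    EqTest L F n p E (longP D B M o c c' small) c m (3 * k + 20) := by
  intro s X N hs hX hN hNm hXN
  have hdd : 1 ≤ d * d := Nat.mul_pos hd hd
  have hbw : ∀ x, x < 31 ∨ (c ≤ x ∧ x ≠ c + 5) →
      (blockP D B M o c c' small).writesReg x = false := fun x hx => by
    simp [blockP, checkP, Prog.writesReg, hw x (by omega)]
    omega
  have hba : ∀ a, (blockP D B M o c c' small).writesArr a = false := fun a => by
    simp [blockP, checkP, Prog.writesArr, ha a]
  have hblock : ∀ {s s'}, Frame (blockP D B M o c c' small) s s' → E s → E s' :=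
    fun hf hs => hE.frame (fun x hx => hbw x (by omega)) hba hf hs
  obtain ⟨-, -, eB, -, eT, -⟩ := hEn s hs
  have eB' : ∀ {s}, E s → s.reg B = d * d := fun hs => (hEn _ hs).sq
  unfold longP
  refine Wp.mono (k := max (1 + (1 + k))
    (1 + (1 + (1 + ((k + 5) + (1 + ((k + 5) + (1 + (1 + k)))))))) + 1) ?_ (by omega) fun _ _ h => h
  refine Wp.cond (by simp) (fun hlt => ?_) fun hlt => ?_
  · have hlt : N < 2 * (d * d) := by
      by_contra h
      simp [eB, hN, h] at hlt
    refine Wp.seq (Wp.assign (by simp) (by simp [hX]; omega) ?_)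
    refine Wp.seq (Wp.assign (by simp) (by simp [hN, show c + 1 ≠ c' by omega]; omega) ?_)
    refine (hsmall _ X N (hE.setReg (by omega) (hE.setReg (by omega) hs)) (by simp [hX])
      (by simp [hN, show c + 1 ≠ c' by omega]) hlt hXN).mono le_rfl fun s' _ h => ?_
    simpa [show 31 ≠ c' by omega, show 31 ≠ c' + 1 by omega] using h
  have hge : 2 * (d * d) ≤ N := by
    by_contra h
    simp [eB, hN, show N < 2 * (d * d) by omega] at hlt
  have hQ2 : 2 ≤ N / (d * d) := (Nat.le_div_iff_mul_le hdd).2 hge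
  have hQN : N / (d * d) * (d * d) ≤ N := Nat.div_mul_le_self _ _
  have hNQ : N < (N / (d * d) + 1) * (d * d) := (Nat.div_lt_iff_lt_mul hdd).1 (Nat.lt_succ_self _)
  have hQle : N / (d * d) ≤ N := Nat.div_le_self _ _
  obtain ⟨t6, t7⟩ := eT (N / (d * d) - 1) (by omega)
  have hiK := hm N hNm (by omega)
  have l1 := Nat.pow_log_le_self 2 (show N / (d * d) - 1 ≠ 0 by omega)
  have l2 := Nat.lt_pow_succ_log_self (b := 2) (by omega) (N / (d * d) - 1)
  generalize Nat.log 2 (N / (d * d) - 1) = i at t6 t7 hiK l1 l2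
  have hil : i < 2 ^ i := Nat.lt_two_pow_self
  have w1 : 2 ^ i * (d * d) + d * d ≤ N := by
    have : (2 ^ i + 1) * (d * d) ≤ N / (d * d) * (d * d) := Nat.mul_le_mul_right _ (by omega)
    rw [Nat.succ_mul] at this
    omega
  have w2 : N ≤ 2 * (2 ^ i * (d * d)) + d * d := by
    have : (N / (d * d) + 1) * (d * d) ≤ (2 * 2 ^ i + 1) * (d * d) :=
      Nat.mul_le_mul_right _ (by rw [pow_succ] at l2; omega)
    rw [Nat.succ_mul (2 * 2 ^ i), mul_assoc] at this
    omega
  generalize hwd : 2 ^ i * (d * d) = w at w1 w2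
  refine Wp.seq (Wp.assign (by simp [hN, eB]; omega) (by simp [hN, eB, t6]; omega) ?_)
  have ev1 : (Expr.read 6 (.reg (c + 1) / .reg B - .const 1)).eval s = i := by simp [hN, eB, t6]
  rw [ev1]
  have ev2 : (Expr.read 7 (.reg (c + 1) / .reg B - .const 1) * .reg B : Expr).eval
      (s.setReg (c + 2) i) = w := by
    simp [hN, eB, t7, show B ≠ c + 2 by omega, hwd]
  refine Wp.seq (Wp.assign ?_ (by rw [ev2]; omega) ?_)
  · simp [hN, eB, show B ≠ c + 2 by omega]; omega
  rw [ev2]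
  have ev3 : (Expr.reg c).eval ((s.setReg (c + 2) i).setReg (c + 3) w) = X := by simp [hX]
  refine Wp.seq (Wp.assign (by simp) (by rw [ev3]; omega) ?_)
  rw [ev3]
  generalize hS : (((s.setReg (c + 2) i).setReg (c + 3) w).setReg (c + 4) X) = S
  have hSE : E S := by
    rw [← hS]
    exact hE.setReg (by omega) (hE.setReg (by omega) (hE.setReg (by omega) hs))
  refine Wp.andThen (blockP_spec (i := i) (z := X) hd hE hEn hD hB hM hc' hc hsmall hw ha hL hL3 hSE
    ?_ ?_ hiK (by omega)) ?_
  · simp [← hS]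
  · simp [← hS]
  rintro s₁ hf₁ ⟨δ₁, hδ₁, hs₁⟩
  have E₁ := hblock hf₁ hSE
  have a0 : s₁.reg c = X := by rw [hf₁.reg _ (hbw _ (by omega))]; simp [← hS, hX]
  have a1 : s₁.reg (c + 1) = N := by rw [hf₁.reg _ (hbw _ (by omega))]; simp [← hS, hN]
  have a2 : s₁.reg (c + 2) = i := by rw [hf₁.reg _ (hbw _ (by omega))]; simp [← hS]
  have a3 : s₁.reg (c + 3) = w := by rw [hf₁.reg _ (hbw _ (by omega))]; simp [← hS]
  have a31 : S.reg 31 = s.reg 31 := by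
    simp [← hS, show 31 ≠ c + 2 by omega, show 31 ≠ c + 3 by omega, show 31 ≠ c + 4 by omega]
  rw [a31] at hs₁
  clear hf₁
  have ev4 : (Expr.reg c + .reg (c + 1) - .reg (c + 3) - .reg B : Expr).eval s₁ =
      X + N - w - d * d := by simp [a0, a1, a3, eB' E₁]
  refine Wp.seq (Wp.assign (by simp) (by rw [ev4]; omega) ?_)
  rw [ev4]
  have E₁' : E (s₁.setReg (c + 4) (X + N - w - d * d)) := hE.setReg (by omega) E₁
  refine Wp.andThen (blockP_spec (i := i) (z := X + N - w - d * d) hd hE hEn hD hB hM hc' hc hsmall hw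
    ha hL hL3 E₁' (by simp) (by simp [a2]) hiK (by omega)) ?_
  rintro s₂ hf₂ ⟨δ₂, hδ₂, hs₂⟩
  have E₂ := hblock hf₂ E₁'
  have b0 : s₂.reg c = X := by rw [hf₂.reg _ (hbw _ (by omega))]; simp [a0]
  have b1 : s₂.reg (c + 1) = N := by rw [hf₂.reg _ (hbw _ (by omega))]; simp [a1]
  clear hf₂
  have ev5 : (Expr.reg c + .reg (c + 1) - .reg B : Expr).eval s₂ = X + N - d * d := by
    simp [b0, b1, eB' E₂]
  refine Wp.seq (Wp.assign (by simp) (by rw [ev5]; omega) ?_)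
  refine Wp.seq (Wp.assign (by simp) (by simp [eB' E₂, show B ≠ c' by omega]; omega) ?_)
  refine (hsmall _ (X + N - d * d) (d * d) (hE.setReg (by omega) (hE.setReg (by omega) E₂))
    (by simp [b0, b1, eB' E₂]) (by simp [eB' E₂, show B ≠ c' by omega]) (by omega)
    (by omega)).mono le_rfl fun s₃ _ hs₃ => ?_
  simp only [State.setReg_reg, show 31 ≠ c' by omega, show 31 ≠ c' + 1 by omega,
    show 31 ≠ c + 4 by omega, if_false] at hs₂ hs₃
  rw [hs₃, hs₂, hs₁, and_assoc, and_assoc, hwd]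
  exact and_congr_right fun _ => forall_lt_iff_cover hδ₁ hδ₂ w1 w2
end

end WordRAM


/-! ## Errors of letters -/

namespace WordRAM
open BitWord

/-- Of the pairs of letters of `F 0, …, F (n-1)` at distance `p`, one is at Lee distance `2`, or two
are at Lee distance `1`, and the other ones are equal. -/
def TwoErr (F : ℕ → ℕ) (n p : ℕ) : Prop :=
  (∃ i, i + p < n ∧ F i ≠ F (i + p) ∧ (F i + F (i + p)) % 2 = 0 ∧
    ∀ t, t + p < n → t ≠ i → F t = F (t + p)) ∨
  ∃ i j, i < j ∧ j + p < n ∧ (F i + F (i + p)) % 2 = 1 ∧ (F j + F (j + p)) % 2 = 1 ∧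
    ∀ t, t + p < n → t ≠ i → t ≠ j → F t = F (t + p)

theorem gray_eq_iff : ∀ a b : ZMod 4, a.val = b.val ↔ (gray a 0 = gray b 0 ∧ gray a 1 = gray b 1) := by
  decide

theorem gray_ne_iff : ∀ a b : ZMod 4, (a.val ≠ b.val ∧ (a.val + b.val) % 2 = 0) ↔
    (gray a 0 ≠ gray b 0 ∧ gray a 1 ≠ gray b 1) := by
  decide

theorem gray_odd_iff : ∀ a b : ZMod 4, (a.val + b.val) % 2 = 1 ↔
    (gray a 0 ≠ gray b 0 ∧ gray a 1 = gray b 1) ∨ (gray a 0 = gray b 0 ∧ gray a 1 ≠ gray b 1) := by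
  decide

theorem forall_bits_iff {n p e₁ e₂ : ℕ} {G : ℕ → ZMod 4} :
    (∀ t, t + 2 * p < 2 * n →
      (seqBits G t ≠ seqBits G (t + 2 * p) ↔ t = e₁ ∨ t = e₂)) ↔
    ∀ t, t + p < n → (gray (G t) 0 ≠ gray (G (t + p)) 0 ↔ 2 * t = e₁ ∨ 2 * t = e₂) ∧
      (gray (G t) 1 ≠ gray (G (t + p)) 1 ↔ 2 * t + 1 = e₁ ∨ 2 * t + 1 = e₂) := by
  constructor
  · intro h t ht
    have h0 := h (2 * t) (by omega)
    have h1 := h (2 * t + 1) (by omega)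
    rw [show 2 * t + 2 * p = 2 * (t + p) by ring, seqBits_two_mul, seqBits_two_mul] at h0
    rw [show 2 * t + 1 + 2 * p = 2 * (t + p) + 1 by ring, seqBits_two_mul_add_one,
      seqBits_two_mul_add_one] at h1
    exact ⟨h0, h1⟩
  · intro h t ht
    obtain ⟨h0, h1⟩ := h (t / 2) (by omega)
    rcases Nat.mod_two_eq_zero_or_one t with h2 | h2
    · obtain ⟨u, rfl⟩ : ∃ u, t = 2 * u := ⟨t / 2, by omega⟩
      rw [show 2 * u + 2 * p = 2 * (u + p) by ring, seqBits_two_mul, seqBits_two_mul]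
      rwa [show 2 * u / 2 = u by omega] at h0
    · obtain ⟨u, rfl⟩ : ∃ u, t = 2 * u + 1 := ⟨t / 2, by omega⟩
      rw [show 2 * u + 1 + 2 * p = 2 * (u + p) + 1 by ring, seqBits_two_mul_add_one,
        seqBits_two_mul_add_one]
      rwa [show (2 * u + 1) / 2 = u by omega] at h1

/-- Two wrong bits belong to one letter, then at Lee distance `2`, or to two letters, each at Lee
distance `1`. The parity of the sum of two letters tells the odd distance from the even ones. -/
theorem err2_seqBits_iff {G : ℕ → ZMod 4} {n : ℕ} :
    Err2 (seqBits G) (2 * n) ↔ ∃ p, 0 < p ∧ p < n ∧ TwoErr (fun t => (G t).val) n p := by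
  constructor
  · rintro ⟨q, e₁, e₂, ⟨p, hp⟩, h0, h12, h2, h⟩
    obtain rfl : q = 2 * p := by omega
    rw [forall_bits_iff] at h
    refine ⟨p, by omega, by omega, ?_⟩
    by_cases hij : e₁ / 2 = e₂ / 2
    · refine Or.inl ⟨e₁ / 2, by omega, ?_⟩
      obtain ⟨a, b⟩ := h (e₁ / 2) (by omega)
      rw [← and_assoc]
      refine ⟨(gray_ne_iff _ _).2 ⟨a.2 (by omega), b.2 (by omega)⟩, fun t ht hti => ?_⟩
      obtain ⟨a, b⟩ := h t ht
      rw [gray_eq_iff]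
      constructor <;> by_contra hc
      · have := a.1 hc; omega
      · have := b.1 hc; omega
    · have key : ∀ i, i + p < n → (i = e₁ / 2 ∨ i = e₂ / 2) →
          ((G i).val + (G (i + p)).val) % 2 = 1 := by
        intro i hi hie
        obtain ⟨a, b⟩ := h i hi
        rw [gray_odd_iff]
        by_cases h3 : 2 * i = e₁ ∨ 2 * i = e₂
        · refine Or.inl ⟨a.2 h3, ?_⟩
          by_contra hc
          have := b.1 hc
          omega
        · refine Or.inr ⟨?_, b.2 (by omega)⟩
          by_contra hc
          exact h3 (a.1 hc)
      refine Or.inr ⟨e₁ / 2, e₂ / 2, by omega, by omega, key _ (by omega) (Or.inl rfl),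
        key _ (by omega) (Or.inr rfl), fun t ht hti htj => ?_⟩
      obtain ⟨a, b⟩ := h t ht
      rw [gray_eq_iff]
      constructor <;> by_contra hc
      · have := a.1 hc; omega
      · have := b.1 hc; omega
  · rintro ⟨p, h0, hpn, h⟩
    rcases h with ⟨i, hi, h1, h2, h3⟩ | ⟨i, j, hij, hj, h1, h2, h3⟩
    · refine ⟨2 * p, 2 * i, 2 * i + 1, by simp, by omega, by omega, by omega, ?_⟩
      rw [forall_bits_iff]
      intro t ht
      by_cases hti : t = i
      · subst hti
        have := (gray_ne_iff _ _).1 ⟨h1, h2⟩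
        simp [this.1, this.2]
      · have := (gray_eq_iff _ _).1 (h3 t ht hti)
        simp [this.1, this.2]
        omega
    · have key : ∀ i, (fun t => (G t).val) i + (fun t => (G t).val) (i + p) ≡ 1 [MOD 2] →
          ∃ e, (e = 2 * i ∨ e = 2 * i + 1) ∧
          (gray (G i) 0 ≠ gray (G (i + p)) 0 ↔ 2 * i = e) ∧
          (gray (G i) 1 ≠ gray (G (i + p)) 1 ↔ 2 * i + 1 = e) := by
        intro i hi
        rcases (gray_odd_iff _ _).1 hi with ⟨h1, h2⟩ | ⟨h1, h2⟩
        · exact ⟨2 * i, by simp, by simp [h1], by simp [h2]⟩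
        · exact ⟨2 * i + 1, by simp, by simp [h1], by simp [h2]⟩
      obtain ⟨e₁, a1, a2, a3⟩ := key i h1
      obtain ⟨e₂, b1, b2, b3⟩ := key j h2
      refine ⟨2 * p, e₁, e₂, by simp, by omega, by omega, by omega, ?_⟩
      rw [forall_bits_iff]
      intro t ht
      by_cases hti : t = i
      · subst hti
        rw [a2, a3]
        omega
      by_cases htj : t = j
      · subst htj
        rw [b2, b3]
        omega
      have := (gray_eq_iff _ _).1 (h3 t ht hti htj)
      simp only [this.1, this.2, ne_eq, not_true_eq_false, false_iff]
      omega

/-- The description of the errors by the first and the last one. -/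
theorem twoErr_iff {F : ℕ → ℕ} {n p a c : ℕ} (hp : p < n) (ha : IsLcp F n p a)
    (hc : IsLcp (fun t => F (n - 1 - t)) n p c) :
    TwoErr F n p ↔ a + p < n ∧
      ((a = n - 1 - p - c ∧ F a ≠ F (a + p) ∧ (F a + F (a + p)) % 2 = 0) ∨
      (a < n - 1 - p - c ∧ (F a + F (a + p)) % 2 = 1 ∧
        (F (n - 1 - p - c) + F (n - 1 - p - c + p)) % 2 = 1 ∧
        ∀ t < n - 1 - p - c - a - 1, F (a + 1 + t) = F (a + 1 + p + t))) := by
  obtain ⟨a1, a2, a3⟩ := ha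
  obtain ⟨c1, c2, c3⟩ := hc
  have a2' : ∀ t < a, F t = F (t + p) := fun t ht => by rw [a2 t ht, add_comm]
  have a3' : a + p < n → F a ≠ F (a + p) := fun h => by
    have := a3 (by omega)
    rwa [add_comm p a] at this
  -- Read backwards, the common prefix of length `c` says that the last disagreement is at `n - 1 -
  -- p - c`.
  have c2' : ∀ t, t + p < n → n - 1 - p - c < t → F t = F (t + p) := fun t ht htc => by
    have := c2 (n - 1 - p - t) (by omega)
    simp only at this
    rw [show n - 1 - (n - 1 - p - t) = t + p by omega,
      show n - 1 - (p + (n - 1 - p - t)) = t by omega] at this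
    exact this.symm
  have c3' : p + c < n → F (n - 1 - p - c) ≠ F (n - 1 - p - c + p) := fun h => by
    have := c3 h
    simp only at this
    rw [show n - 1 - c = n - 1 - p - c + p by omega, show n - 1 - (p + c) = n - 1 - p - c by omega] at this
    exact this.symm
  have hac : a + p < n → a ≤ n - 1 - p - c := fun h => by
    by_contra hlt
    exact a3' h (c2' a h (by omega))
  have hac' : a + p < n → p + c < n := fun h => by
    by_contra hlt
    have := c2 (n - 1 - p - a) (by omega)
    simp only at this
    rw [show n - 1 - (n - 1 - p - a) = a + p by omega,
      show n - 1 - (p + (n - 1 - p - a)) = a by omega] at this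
    exact a3' h this.symm
  have amin : ∀ t, t + p < n → F t ≠ F (t + p) → a + p < n ∧ a ≤ t ∧ t ≤ n - 1 - p - c := by
    intro t ht hne
    refine ⟨?_, ?_, ?_⟩ <;> by_contra hlt
    · exact hne (a2' t (by omega))
    · exact hne (a2' t (by omega))
    · exact hne (c2' t ht (by omega))
  have odd_ne : ∀ t, (F t + F (t + p)) % 2 = 1 → F t ≠ F (t + p) := fun t h he => by omega
  constructor
  · rintro (⟨i, hi, h1, h2, h3⟩ | ⟨i, j, hij, hj, h1, h2, h3⟩)
    · obtain ⟨b1, b2, b3⟩ := amin i hi h1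
      have e1 : a = i := by
        by_contra hne
        exact a3' b1 (h3 a b1 hne)
      have e2 : n - 1 - p - c = i := by
        by_contra hne
        exact c3' (hac' b1) (h3 _ (by omega) hne)
      rw [e2, e1]
      exact ⟨hi, Or.inl ⟨rfl, h1, h2⟩⟩
    · obtain ⟨b1, b2, b3⟩ := amin i (by omega) (odd_ne i h1)
      obtain ⟨-, b4, b5⟩ := amin j hj (odd_ne j h2)
      have e1 : a = i := by
        by_contra hne
        exact a3' b1 (h3 a b1 hne (by omega))
      have e2 : n - 1 - p - c = j := by
        by_contra hne
        exact c3' (hac' b1) (h3 _ (by omega) (by omega) hne)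
      rw [e2, e1]
      refine ⟨by omega, Or.inr ⟨hij, h1, h2, fun t ht => ?_⟩⟩
      rw [h3 (i + 1 + t) (by omega) (by omega) (by omega)]
      congr 1
      omega
  · rintro ⟨h, ⟨h1, h2, h3⟩ | ⟨h1, h2, h3, h4⟩⟩
    · refine Or.inl ⟨a, h, h2, h3, fun t ht hta => ?_⟩
      rcases Nat.lt_or_gt_of_ne hta with h5 | h5
      · exact a2' t h5
      · exact c2' t ht (by omega)
    · refine Or.inr ⟨a, n - 1 - p - c, h1, by have := hac' h; omega, h2, h3, fun t ht hta htc => ?_⟩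
      rcases Nat.lt_or_gt_of_ne hta with h5 | h5
      · exact a2' t h5
      rcases Nat.lt_or_gt_of_ne htc with h6 | h6
      · have := h4 (t - a - 1) (by omega)
        rwa [show a + 1 + (t - a - 1) = t by omega, show a + 1 + p + (t - a - 1) = t + p by omega] at this
      · exact c2' t ht h6

end WordRAM


/-! ## The search for an error -/

namespace WordRAM

/-- The data of the tests for equality, for all shifts. -/
def TestEnv (F : ℕ → ℕ) (n d K₁ K₂ : ℕ) (s : State) : Prop :=
  s.reg 0 = n ∧ s.reg 1 = d ∧ s.reg 2 = d * d ∧ s.reg 29 = d * d * (d * d) ∧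
  s.reg 28 = n / d + d + 1 ∧ s.reg 27 = n / (d * d) + d * d + 1 ∧
  (∀ t, s.arr 4 t = code F (d * d) t) ∧ (∀ i ≤ d * d, s.arr 5 i = 4 ^ i) ∧
  (∀ q ≤ n, s.arr 6 q = Nat.log 2 q ∧ s.arr 7 q = 2 ^ Nat.log 2 q) ∧
  Names F n d (n / d + d + 1) K₁ (s.arr 13) ∧
  Names F n (d * d) (n / (d * d) + d * d + 1) K₂ (s.arr 14)

theorem TestEnv.congr {F : ℕ → ℕ} {n d K₁ K₂ : ℕ} {s s' : State} (h : TestEnv F n d K₁ K₂ s)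
    (hr : ∀ x < 30, s'.reg x = s.reg x) (ha : s'.arr = s.arr) : TestEnv F n d K₁ K₂ s' := by
  simpa [TestEnv, hr, ha] using h

/-- The test of blocks of any length. -/
def testP : Prog := longP 2 29 27 14 42 34 (longP 1 2 28 13 34 32 shortP)

theorem testP_writesReg : ∀ x, x < 31 ∨ 48 ≤ x → testP.writesReg x = false := by
  intro x hx
  simp [testP, longP, blockP, shortP, checkP, Prog.writesReg]
  omega

theorem testP_writesArr (a : ℕ) : testP.writesArr a = false := rfl

/-- Three nested tests: codes for lengths below `2 d²`, names at scale `d` below `2 d⁴`, names at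
scale `d²` for all lengths. The step counts are `5`, `3 * 5 + 20 = 35` and `3 * 35 + 20 = 125`. -/
theorem testP_spec {L n p d K₁ K₂ : ℕ} {F : ℕ → ℕ} (hF : ∀ t, F t < 4) (hd : 1 ≤ d) (hL : n < L)
    (hK₁ : ∀ N < 2 * (d * d * (d * d)), Nat.log 2 (N / (d * d) - 1) ≤ K₁)
    (hK₂ : Nat.log 2 (n / (d * d * (d * d))) ≤ K₂)
    (hL₁ : (K₁ + 1) * (4 * (n / d + d + 1)) < L)
    (hL₂ : (K₂ + 1) * (4 * (n / (d * d) + d * d + 1)) < L) :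
    EqTest L F n p (fun s => TestEnv F n d K₁ K₂ s ∧ s.reg 30 = p) testP 42 (n + 1) 125 := by
  have hst : Stable (fun s => TestEnv F n d K₁ K₂ s ∧ s.reg 30 = p) := fun s s' hr ha h =>
    ⟨h.1.congr (fun x hx => hr x (by omega)) ha, by rw [hr 30 (by omega)]; exact h.2⟩
  have h1 := shortP_spec (L := L) (n := n) (p := p) (b := d * d) (F := F)
    (E := fun s => TestEnv F n d K₁ K₂ s ∧ s.reg 30 = p) hF
    (fun s hs => ⟨hs.1.2.2.1, hs.2, hs.1.2.2.2.2.2.2.1, hs.1.2.2.2.2.2.2.2.1⟩) hL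
  have n1 : ∀ s, TestEnv F n d K₁ K₂ s ∧ s.reg 30 = p → NameEnv F n p d K₁ 1 2 28 13 s := by
    rintro s ⟨⟨_, b1, b2, _, b4, _, _, _, b8, b9, _⟩, hp⟩
    exact ⟨hp, b1, b2, b4, b8, b9⟩
  have n2 : ∀ s, TestEnv F n d K₁ K₂ s ∧ s.reg 30 = p → NameEnv F n p (d * d) K₂ 2 29 27 14 s := by
    rintro s ⟨⟨_, _, b2, b3, _, b5, _, _, b8, _, b10⟩, hp⟩
    exact ⟨hp, b2, b3, b5, b8, b10⟩
  have w1 : ∀ x, x < 31 ∨ 34 ≤ x → shortP.writesReg x = false := by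
    intro x hx; simp [shortP, checkP, Prog.writesReg]; omega
  have w2 : ∀ x, x < 31 ∨ 42 ≤ x → (longP 1 2 28 13 34 32 shortP).writesReg x = false := by
    intro x hx; simp [longP, blockP, shortP, checkP, Prog.writesReg]; omega
  have a1 : ∀ a, shortP.writesArr a = false := fun a => by simp [shortP, checkP, Prog.writesArr]
  have a2 : ∀ a, (longP 1 2 28 13 34 32 shortP).writesArr a = false := fun a => by
    simp [longP, blockP, a1, checkP, Prog.writesArr]
  have h2 := longP_spec (m := 2 * (d * d * (d * d))) hd hst n1 (by omega) (by omega) (by omega)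
    (by omega) (by omega) h1 w1 a1 hL hL₁ (fun N hN _ => hK₁ N hN)
  have h3 := longP_spec (m := n + 1) (Nat.mul_pos hd hd) hst n2 (by omega) (by omega) (by omega)
    (by omega) (by omega) h2 w2 a2 hL hL₂
    (fun N _ hNn => (Nat.log_mono_right ((Nat.sub_le _ _).trans (Nat.div_le_div_right hNn))).trans hK₂)
  exact h3

/-- The part of the search for the shift in register `30`. -/
def shiftP : Prog :=
  .cond ((Expr.const 0).lt (.reg 30))
    (.assign 50 (.read 2 (.reg 30)) ;;
      .cond ((Expr.reg 50 + .reg 30).lt (.reg 0))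
        (.assign 51 (.reg 0 - .const 1 - .reg 30 - .read 3 (.reg 30)) ;;
          .cond ((Expr.reg 50).lt (.reg 51))
            (.cond ((Expr.read 0 (.reg 50) + .read 0 (.reg 50 + .reg 30)) % .const 2 *
                ((Expr.read 0 (.reg 51) + .read 0 (.reg 51 + .reg 30)) % .const 2))
              (.assign 31 (.const 1) ;; .assign 42 (.reg 50 + .const 1) ;;
                .assign 43 (.reg 51 - .reg 50 - .const 1) ;; testP ;;
                .cond (.reg 31) (.assign 52 (.const 1)) .skip)
              .skip)
            (.cond ((Expr.reg 50).eq (.reg 51))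
              (.cond ((Expr.read 0 (.reg 50) + .read 0 (.reg 50 + .reg 30)) % .const 2) .skip
                (.assign 52 (.const 1)))
              .skip))
        .skip)
    .skip

/-- Search for an error; let register `0` be `1` if there is none and `0` otherwise. -/
def searchP : Prog :=
  .assign 52 (.const 0) ;; .forTo 30 (.reg 0) shiftP ;; .assign 0 ((Expr.reg 52).eq (.const 0))

/-- Follows `twoErr_iff`. If the first and the last disagreement coincide, an even sum of the
letters means Lee distance `2`. If not, both sums must be odd, and the stretch strictly between them
goes to `testP`. -/
theorem shiftP_spec {L n p d K₁ K₂ : ℕ} {F : ℕ → ℕ} (hF : ∀ t, F t < 4) (hd : 1 ≤ d) (hL : n + 2 < L)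
    (hK₁ : ∀ N < 2 * (d * d * (d * d)), Nat.log 2 (N / (d * d) - 1) ≤ K₁)
    (hK₂ : Nat.log 2 (n / (d * d * (d * d))) ≤ K₂)
    (hL₁ : (K₁ + 1) * (4 * (n / d + d + 1)) < L)
    (hL₂ : (K₂ + 1) * (4 * (n / (d * d) + d * d + 1)) < L) {s : State} (hE : TestEnv F n d K₁ K₂ s)
    (hp : s.reg 30 = p) (hpn : p < n) (h0 : s.arr 0 = F)
    (h2 : 1 ≤ p → IsLcp F n p (s.arr 2 p))
    (h3 : 1 ≤ p → IsLcp (fun t => F (n - 1 - t)) n p (s.arr 3 p)) :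
    Wp L shiftP s 140 (fun s' => s'.reg 52 ≠ 0 ↔ (s.reg 52 ≠ 0 ∨ (0 < p ∧ TwoErr F n p))) := by
  unfold shiftP
  have hn : s.reg 0 = n := hE.1
  refine (Wp.cond (k := 1 + (max (1 + (max (max (1 + (1 + (1 + (125 + 2)))) 1 + 1) 4 + 1)) 1 + 1)) (k' := 1) (by simp)
    (fun hc => ?_) fun hc => Wp.skip ?_).mono (by simp) fun _ _ h => h
  swap
  · have : p = 0 := by
      by_contra h
      simp [hp, show 0 < p by omega] at hc
    simp [this]
  have hp0 : 0 < p := by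
    by_contra h
    simp [hp, h] at hc
  replace h2 := h2 hp0
  replace h3 := h3 hp0
  have htwo := twoErr_iff hpn h2 h3
  have hne := h2.2.2
  have hb := h2.1
  simp only [hp0, true_and]
  refine Wp.seq (Wp.assign (by simp [hp]; omega) (by simp [hp]; omega) ?_)
  have e1 : (Expr.read 2 (.reg 30)).eval s = s.arr 2 p := by simp [hp]
  rw [e1]
  generalize s.arr 2 p = i at *
  refine Wp.cond (by simp) (fun hc => ?_) fun hc => Wp.skip ?_
  swap
  · have : ¬ i + p < n := fun h => by simp [hp, hn, h] at hc
    simp [htwo, this]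
  have hin : i + p < n := by
    by_contra h
    simp [hp, hn, h] at hc
  clear hc
  simp only [hin, true_and] at htwo
  have e2 : (Expr.reg 0 - .const 1 - .reg 30 - .read 3 (.reg 30) : Expr).eval (s.setReg 50 i) =
      n - 1 - p - s.arr 3 p := by simp [hp, hn]
  refine Wp.seq (Wp.assign (by simp [hp]; omega) (by rw [e2]; omega) ?_)
  rw [e2]
  generalize hj : n - 1 - p - s.arr 3 p = j at htwo
  refine Wp.cond (by simp) (fun hc => ?_) fun hc => ?_
  · have hij : i < j := by
      by_contra h
      simp [h] at hc
    clear hc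
    simp only [hij, hij.ne, false_and, false_or, true_and] at htwo
    refine Wp.cond (by simp [hp]; omega) (fun hc => ?_) fun hc => Wp.skip ?_
    swap
    · have : ¬ ((F i + F (i + p)) % 2 = 1 ∧ (F j + F (j + p)) % 2 = 1) := fun h => by
        simp [hp, h0, h.1, h.2] at hc
      simp only [State.setReg_reg]
      rw [htwo, ← and_assoc]
      simp [this]
    have hodd : (F i + F (i + p)) % 2 = 1 ∧ (F j + F (j + p)) % 2 = 1 := by
      simp [hp, h0] at hc
      omega
    clear hc
    simp only [hodd, true_and] at htwo
    refine Wp.seq (Wp.assign (by simp) (by simp; omega) ?_)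
    refine Wp.seq (Wp.assign (by simp) (by simp; omega) ?_)
    refine Wp.seq (Wp.assign (by simp) (by simp; omega) ?_)
    refine Wp.andThen (testP_spec (p := p) hF hd (by omega) hK₁ hK₂ hL₁ hL₂ _ (i + 1) (j - i - 1)
      ⟨hE.congr ?_ rfl, ?_⟩ ?_ ?_ (by omega) (by omega)) ?_
    · intro x hx
      simp only [State.setReg_reg, show x ≠ 50 by omega, show x ≠ 51 by omega, show x ≠ 31 by omega,
        show x ≠ 42 by omega, show x ≠ 43 by omega, if_false]
    · simp [hp]
    · simp
    · simp
    intro s₁ hf₁ hs₁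
    have h52 : s₁.reg 52 = s.reg 52 := by
      rw [hf₁.reg 52 (testP_writesReg 52 (by omega))]
      simp
    clear hf₁
    simp at hs₁
    rw [← htwo] at hs₁
    refine Wp.of_vc' ⟨by simp, fun hc => ⟨by simp, by simp; omega, ?_⟩, fun hc => ?_⟩ le_rfl
    · simp [hs₁.1 hc]
    · show s₁.reg 52 ≠ 0 ↔ _
      have : ¬ TwoErr F n p := fun h => hs₁.2 h hc
      simp [h52, this]
  · have hij : ¬ i < j := fun h => by simp [h] at hc
    clear hc
    simp only [hij, false_and, or_false] at htwo
    refine Wp.of_vc' ⟨by simp, fun hc => ⟨by simp [hp]; omega, fun h => ?_, fun h =>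
      ⟨by simp, by simp; omega, ?_⟩⟩, fun hc => ?_⟩ ?_
    · simp [hp, h0] at h
      show _ ↔ _
      rw [htwo]
      simp
      omega
    · have hij : i = j := by
        by_contra h
        simp [h] at hc
      simp [hp, h0] at h
      have := hne (by omega)
      rw [add_comm p i] at this
      simp [htwo, hij] at *
      right
      omega
    · have : i ≠ j := fun h => by simp [h] at hc
      show _ ↔ _
      rw [htwo]
      simp [this]
    · decide

theorem shiftP_writesReg : ∀ x < 31, shiftP.writesReg x = false := by
  intro x hx
  simp [shiftP, testP_writesReg x (by omega), Prog.writesReg]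
  omega

theorem shiftP_writesArr (a : ℕ) : shiftP.writesArr a = false := by
  simp [shiftP, Prog.writesArr, testP_writesArr a]

theorem searchP_spec {L n d K₁ K₂ : ℕ} {F : ℕ → ℕ} (hF : ∀ t, F t < 4) (hd : 1 ≤ d) (hL : n + 2 < L)
    (hK₁ : ∀ N < 2 * (d * d * (d * d)), Nat.log 2 (N / (d * d) - 1) ≤ K₁)
    (hK₂ : Nat.log 2 (n / (d * d * (d * d))) ≤ K₂)
    (hL₁ : (K₁ + 1) * (4 * (n / d + d + 1)) < L)
    (hL₂ : (K₂ + 1) * (4 * (n / (d * d) + d * d + 1)) < L) {s : State} (hE : TestEnv F n d K₁ K₂ s)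
    (h0 : s.arr 0 = F) (h2 : ∀ p, 1 ≤ p → p < n → IsLcp F n p (s.arr 2 p))
    (h3 : ∀ p, 1 ≤ p → p < n → IsLcp (fun t => F (n - 1 - t)) n p (s.arr 3 p)) :
    Wp L searchP s (200 * (n + 1)) (fun s' =>
      ((∃ p, 0 < p ∧ p < n ∧ TwoErr F n p) → s'.reg 0 = 0) ∧
      ((¬ ∃ p, 0 < p ∧ p < n ∧ TwoErr F n p) → s'.reg 0 = 1)) := by
  unfold searchP
  refine Wp.mono (k := 1 + ((n * (140 + 2) + 2) + 1)) ?_ (by omega) fun _ _ h => h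
  refine Wp.seq (Wp.assign (by simp) (by simp) ?_)
  refine Wp.andThen (R := fun s' => s'.reg 52 ≠ 0 ↔ ∃ p, 0 < p ∧ p < n ∧ TwoErr F n p) ?_ ?_
  · have hfr : ∀ s', Frame (.forTo 30 (.reg 0) shiftP) (s.setReg 52 ((Expr.const 0).eval s)) s' →
        (∀ x < 30, s'.reg x = s.reg x) ∧ s'.arr = s.arr := by
      refine fun s' hf => ⟨fun x hx => ?_, funext fun a => ?_⟩
      · rw [hf.reg x]
        · simp [show x ≠ 52 by omega]
        · rw [writesReg_forTo, shiftP_writesReg x (by omega)]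
          simp
          omega
      · rw [hf.arr a (by rw [writesArr_forTo, shiftP_writesArr])]
        rfl
    refine Wp.forTo (N := n) (fun j s' => s'.reg 52 ≠ 0 ↔ ∃ p, 0 < p ∧ p < j ∧ TwoErr F n p) (by omega)
      (shiftP_writesReg 30 (by omega)) ?_ ?_ ?_ ?_
    · intro s' hf
      simp [(hfr s' hf).1 0 (by omega), hE.1]
    · simp
    · intro p s' hp hf hsp hI
      obtain ⟨g1, g2⟩ := hfr s' hf
      refine (shiftP_spec hF hd hL hK₁ hK₂ hL₁ hL₂ (hE.congr g1 g2) hsp hp (by rw [g2, h0])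
        (fun h => by rw [g2]; exact h2 p h hp) (fun h => by rw [g2]; exact h3 p h hp)).mono le_rfl ?_
      intro s'' _ h
      simp only [State.setReg_reg, show (52 : ℕ) ≠ 30 by omega, if_false]
      rw [h, hI]
      constructor
      · rintro (⟨q, q0, q1, q2⟩ | ⟨p0, p1⟩)
        exacts [⟨q, q0, by omega, q2⟩, ⟨p, p0, by omega, p1⟩]
      · rintro ⟨q, q0, q1, q2⟩
        rcases Nat.lt_succ_iff_lt_or_eq.1 q1 with h1 | rfl
        exacts [Or.inl ⟨q, q0, h1, q2⟩, Or.inr ⟨q0, q2⟩]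
    · intro s' _ _ h
      exact h
  intro s' _ h
  refine Wp.assign (by simp) (by simp only [Expr.eval_eq]; split_ifs <;> omega) ?_
  rw [← h]
  constructor <;> intro h1
  · simp [h1]
  · simp [not_not.1 h1]

end WordRAM


/-! ## The program for Lee-isometric words -/

namespace WordRAM

theorem Expr.Fits.mono {S S' W : ℕ} {s : State} (h : S ≤ S') {e : Expr} (he : e.Fits S W s) :
    e.Fits S' W s := by
  induction e with
  | const k => exact he
  | reg x => exact he
  | read a i ih => exact ⟨ih he.1, he.2.1.trans_le h, he.2.2⟩
  | bin o e₁ e₂ ih₁ ih₂ => exact ⟨ih₁ he.1, ih₂ he.2.1, he.2.2⟩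

theorem Exec.mono {S S' W : ℕ} (h : S ≤ S') {p : Prog} {s s' : State} {t : ℕ}
    (he : Exec S W p s s' t) : Exec S' W p s s' t := by
  induction he with
  | skip s => exact .skip s
  | assign x e s he => exact .assign x e s (he.mono h)
  | store a i e s hi hS he => exact .store a i e s (hi.mono h) (hS.trans_le h) (he.mono h)
  | seq _ _ ih₁ ih₂ => exact ih₁.seq ih₂
  | condTrue he hc _ ih => exact .condTrue (he.mono h) hc ih
  | condFalse he hc _ ih => exact .condFalse (he.mono h) hc ih
  | loopTrue he hc _ _ ih₁ ih₂ => exact .loopTrue (he.mono h) hc ih₁ ih₂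
  | loopFalse he hc => exact .loopFalse (he.mono h) hc

theorem mul_self_le_four_pow (b : ℕ) : b * b ≤ 4 ^ b := by
  rw [show 4 = 2 * 2 by rfl, Nat.mul_pow]
  exact Nat.mul_le_mul Nat.lt_two_pow_self.le Nat.lt_two_pow_self.le

/-- The number of samples times `d` is linear in `n` as long as `d²` is; the whole time and space
budget rests on this. -/
theorem mul_samples_le {n d : ℕ} (hd : d * d ≤ 4 * (n + 1)) :
    d * (n / d + d + 1) ≤ 9 * (n + 1) := by
  have h1 : d * (n / d) ≤ n := Nat.mul_div_le n d
  have h2 : d ≤ d * d := Nat.le_mul_self d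
  rw [Nat.mul_succ, Nat.mul_add]
  omega

theorem le_mul_succ_div {n d : ℕ} (hd : 1 ≤ d) : n + 1 ≤ d * (n / d + 1) := Nat.lt_mul_div_succ n hd

/-- Decide whether a word is Lee-isometric: build the tables, name the blocks at two scales, compute
the longest common prefixes of the word and of its reversal, and search for an error. -/
def leeP : Prog :=
  paramP ;; tableP ;;
  .assign 15 (.reg 1) ;; .assign 16 (.reg 2) ;; .assign 17 (.const 1) ;; .assign 18 (.reg 3) ;;
  schemeP 13 ;;
  .assign 28 (.reg 19) ;; .assign 29 (.reg 2 * .reg 2) ;; .assign 15 (.reg 2) ;;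
  .assign 16 (.reg 29) ;; .assign 17 (.reg 2) ;; .assign 18 (.read 6 (.reg 0 / .reg 29)) ;;
  schemeP 14 ;;
  .assign 27 (.reg 19) ;; lcpP 0 2 ;; lcpP 1 3 ;; searchP

theorem leeP_small : leeP.small 60 = true := by decide

theorem TestEnv.frame {F : ℕ → ℕ} {n d K₁ K₂ : ℕ} {p : Prog} {s s' : State}
    (h : TestEnv F n d K₁ K₂ s) (hf : Frame p s s')
    (hr : ∀ x ∈ [0, 1, 2, 27, 28, 29], p.writesReg x = false)
    (ha : ∀ a ∈ [4, 5, 6, 7, 13, 14], p.writesArr a = false) : TestEnv F n d K₁ K₂ s' := by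
  have hr' := fun x hx => hf.reg x (hr x hx)
  have ha' := fun a hx => hf.arr a (ha a hx)
  simp only [List.mem_cons, List.not_mem_nil, or_false, forall_eq_or_imp, forall_eq] at hr' ha'
  simpa [TestEnv, hr', ha'] using h

theorem IsLcp.congr {A A' : ℕ → ℕ} {n p k : ℕ}
    (h : ∀ t < n, A t = A' t) (hk : IsLcp A n p k) :
    IsLcp A' n p k := by
  obtain ⟨h1, h2, h3⟩ := hk
  refine ⟨h1, fun i hi => ?_, fun hlt => ?_⟩
  · rw [← h i (by omega), ← h (p + i) (by omega)]
    exact h2 i hi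
  · rw [← h k (by omega), ← h (p + k) hlt]
    exact h3 hlt

/-- The two scales of samples: `d = 2^a` and `d² = 4^a`, about the square root of `log n` and
`log n`. -/
theorem scales {n a d : ℕ} (hd : 2 ^ a = d) (h : a = 0 ∨ 4 ^ 4 ^ a ≤ n + 1)
    (h' : n + 1 < 4 ^ (4 * 4 ^ a)) :
    4 ^ a = d * d ∧ a + 1 ≤ d ∧ 4 ^ (d * d) ≤ 4 * (n + 1) ∧ d * d * (d * d) ≤ 4 * (n + 1) ∧
    d * 2 ^ (2 * a) ≤ 4 * (n / d + d + 1) ∧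
    d * d * 2 ^ Nat.log 2 (n / (d * d * (d * d))) ≤ 4 * (n / (d * d) + d * d + 1) ∧
    Nat.log 2 (n / (d * d * (d * d))) < 8 * (d * d) ∧
    ∀ N < 2 * (d * d * (d * d)), Nat.log 2 (N / (d * d) - 1) ≤ 2 * a := by
  have hb : 4 ^ a = d * d := by rw [← hd, ← Nat.mul_pow]
  rw [hb] at h h'
  have had : a + 1 ≤ d := hd ▸ Nat.lt_two_pow_self
  have hdd : 1 ≤ d * d := Nat.mul_pos (by omega) (by omega)
  -- The factor `4` is needed for `a = 0`, when `d = 1` however small `n` is.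
  have h4 : 4 ^ (d * d) ≤ 4 * (n + 1) := by
    rcases h with rfl | h
    · rw [← hd]
      simp
    · omega
  have hbb := (mul_self_le_four_pow (d * d)).trans h4
  have h2a : 2 ^ (2 * a) = d * d := by rw [pow_mul]; exact hb
  refine ⟨hb, had, h4, hbb, ?_, ?_, ?_, ?_⟩
  · rw [h2a]
    have h1 := le_mul_succ_div (n := n) (d := d) (by omega)
    refine Nat.le_of_mul_le_mul_left (c := d) ?_ (by omega)
    calc d * (d * (d * d)) = d * d * (d * d) := by ring
      _ ≤ 4 * (n + 1) := hbb
      _ ≤ 4 * (d * (n / d + 1)) := Nat.mul_le_mul_left _ h1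
      _ = d * (4 * (n / d + 1)) := by ring
      _ ≤ d * (4 * (n / d + d + 1)) := Nat.mul_le_mul_left _ (by omega)
  · rcases Nat.eq_zero_or_pos (n / (d * d * (d * d))) with h0 | h0
    · rw [h0, Nat.log_zero_right, pow_zero, mul_one]
      exact (Nat.le_add_left _ _).trans ((Nat.le_succ _).trans (Nat.le_mul_of_pos_left _ (by omega)))
    · have h1 := Nat.pow_log_le_self 2 h0.ne'
      have h2 : d * d * 2 ^ Nat.log 2 (n / (d * d * (d * d))) ≤ n / (d * d) := by
        refine (Nat.mul_le_mul_left _ h1).trans ?_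
        rw [← Nat.div_div_eq_div_mul]
        exact Nat.mul_div_le _ _
      omega
  · refine Nat.log_lt_of_lt_pow' (by omega) ?_
    calc n / (d * d * (d * d)) ≤ n := Nat.div_le_self _ _
      _ < 4 ^ (4 * (d * d)) := by omega
      _ = 2 ^ (8 * (d * d)) := by rw [show 4 = 2 ^ 2 by rfl, ← pow_mul]; ring_nf
  -- `2 ^ (2 a) = d²`, so `2 a` doublings of `d²` reach `d⁴`, where the second scale takes over.
  · intro N hN
    refine Nat.le_of_lt_succ (Nat.log_lt_of_lt_pow' (by omega) ?_)
    have h1 : N / (d * d) < 2 * (d * d) := by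
      rw [Nat.div_lt_iff_lt_mul hdd]
      linarith
    rw [pow_succ, h2a]
    omega

-- At the first scale there are `O(n/d)` samples and `1 + 2 a` naming rounds, at the second one
-- `O(n/d²)` samples and `d² + K` rounds. Since `a + 1 ≤ d` and `K < 8 d²`, the products are linear
-- in `n`. They bound the time, the cells used and the counter of names alike.
set_option maxHeartbeats 1000000 in
theorem leeP_spec {n : ℕ} {F : ℕ → ℕ} {s : State} (hF : ∀ t, F t < 4) (hF0 : ∀ t, n ≤ t → F t = 0)
    (hn : s.reg 0 = n) (h14 : s.reg 14 = 0) (h0 : s.arr 0 = F)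
    (hz : ∀ a, a ≠ 0 → ∀ i, s.arr a i = 0) :
    Wp (1000 * (n + 1)) leeP s (30000 * (n + 1)) (fun s' =>
      ((∃ p, 0 < p ∧ p < n ∧ TwoErr F n p) → s'.reg 0 = 0) ∧
      ((¬ ∃ p, 0 < p ∧ p < n ∧ TwoErr F n p) → s'.reg 0 = 1)) := by
  generalize hLL : 1000 * (n + 1) = L
  unfold leeP
  refine Wp.mono (k := 20 * (n + 1) + (40 * (n + 1) + (1 + (1 + (1 + (1 + (4400 * (n + 1) +
    (1 + (1 + (1 + (1 + (1 + (1 + (19800 * (n + 1) + (1 + (30 * (n + 1) + (30 * (n + 1) +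
    200 * (n + 1)))))))))))))))))) ?_ (by omega) fun _ _ h => h
  refine Wp.andThen (paramP_spec hn (by omega)) ?_
  rintro s₁ hf₁ ⟨a, r1, r2, r3, hor, hlt⟩
  generalize hd : 2 ^ a = d at r1
  obtain ⟨hb, had, h4, hbb, hK₁, hK₂, hK₂', hlog⟩ := scales hd hor hlt
  rw [hb] at r2
  have hd1 : 1 ≤ d := by omega
  have hdd : d ≤ d * d := Nat.le_mul_self d
  have hddd : d * d ≤ d * d * (d * d) := Nat.le_mul_self _
  have hM₁ := mul_samples_le (n := n) (d := d) (by omega)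
  have hM₂ := mul_samples_le (n := n) (d := d * d) hbb
  have hM₁' : n / d + d + 1 ≤ d * (n / d + d + 1) := Nat.le_mul_of_pos_left _ hd1
  have hM₂' : n / (d * d) + d * d + 1 ≤ d * d * (n / (d * d) + d * d + 1) :=
    Nat.le_mul_of_pos_left _ (by omega)
  clear hor hlt
  have q0 : s₁.reg 0 = n := by rw [hf₁.reg 0 rfl, hn]
  have q14 : s₁.reg 14 = 0 := by rw [hf₁.reg 14 rfl, h14]
  have qa : ∀ a, s₁.arr a = s.arr a := fun a => hf₁.arr a rfl
  clear hf₁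
  refine Wp.andThen (tableP_spec hF hF0 q0 r2 (by omega) h4 (by omega) (by rw [qa, h0])
    (fun a ha i => by rw [qa, hz a ha])) ?_
  rintro s₂ hf₂ ⟨t5, t67, t4, t1⟩
  have u0 : s₂.reg 0 = n := by rw [hf₂.reg 0 rfl, q0]
  have u1 : s₂.reg 1 = d := by rw [hf₂.reg 1 rfl, r1]
  have u2 : s₂.reg 2 = d * d := by rw [hf₂.reg 2 rfl, r2]
  have u3 : s₂.reg 3 = 2 * a := by rw [hf₂.reg 3 rfl, r3]
  have u14 : s₂.reg 14 = 0 := by rw [hf₂.reg 14 rfl, q14]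
  have v0 : s₂.arr 0 = F := by rw [hf₂.arr 0 rfl, qa, h0]
  have v12 : ∀ i, s₂.arr 12 i = 0 := fun i => by rw [hf₂.arr 12 rfl, qa, hz 12 (by omega)]
  have v13 : ∀ i, s₂.arr 13 i = 0 := fun i => by rw [hf₂.arr 13 rfl, qa, hz 13 (by omega)]
  have v14 : ∀ i, s₂.arr 14 i = 0 := fun i => by rw [hf₂.arr 14 rfl, qa, hz 14 (by omega)]
  clear hf₂ qa q0 q14 r1 r2 r3
  refine Wp.seq (Wp.assign (by simp) (by simp [u1]; omega) ?_)
  refine Wp.seq (Wp.assign (by simp) (by simp [u2]; omega) ?_)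
  refine Wp.seq (Wp.assign (by simp) (by simp; omega) ?_)
  refine Wp.seq (Wp.assign (by simp) (by simp [u3]; omega) ?_)
  have x1 : (2 * a + 1) * (4 * (n / d + d + 1)) ≤ 72 * (n + 1) := by
    calc (2 * a + 1) * (4 * (n / d + d + 1)) ≤ (2 * d) * (4 * (n / d + d + 1)) :=
          Nat.mul_le_mul_right _ (by omega)
      _ = 8 * (d * (n / d + d + 1)) := by ring
      _ ≤ 72 * (n + 1) := by omega
  have x2 : (1 + 2 * a) * (2 * (n / d + d + 1)) ≤ 36 * (n + 1) := by
    have : (1 + 2 * a) * (2 * (n / d + d + 1)) * 2 = (2 * a + 1) * (4 * (n / d + d + 1)) := by ring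
    omega
  have x3 : (1 + 2 * a + 1) * (100 * (2 * (n / d + d + 1) + 1)) ≤ 4400 * (n + 1) := by
    calc (1 + 2 * a + 1) * (100 * (2 * (n / d + d + 1) + 1)) ≤
          (2 * d) * (100 * (2 * (n / d + d + 1) + 1)) := Nat.mul_le_mul_right _ (by omega)
      _ = 400 * (d * (n / d + d + 1)) + 200 * d := by ring
      _ ≤ 4400 * (n + 1) := by omega
  have x4 : (n / d + d + 1) * d ≤ 9 * (n + 1) := by rwa [mul_comm]
  -- A block of the initial length `d²` is a single code here, so one fold suffices. At the second
  -- scale the initial length is `d⁴`, that is, `d²` codes.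
  refine Wp.andThen ((schemeP_spec (L := L) (n := n) (b := d * d) (d := d) (R := 1) (K := 2 * a)
    (M := n / d + d + 1) (c₀ := 0) hd1 hF ?_ ?_ ?_ ?_ ?_ ?_ ?_ rfl (one_mul _).symm ?_
    ?_ (by omega) ?_ hK₁ (by omega) (by omega) (by omega) (by omega) (by omega)
    (by omega) (by omega)).mono x3 fun _ _ h => h) ?_
  · simp [u0]
  · simp [u2]
  · simp [u1]
  · simp [u2]
  · simp
  · simp [u3]
  · simp [u14]
  · exact t4
  · exact fun q => (v12 q).le
  · exact v13
  rintro s₃ hf₃ ⟨-, y19, y14, y12, hN₁⟩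
  have w0 : s₃.reg 0 = n := by rw [hf₃.reg 0 rfl]; simp [u0]
  have w1 : s₃.reg 1 = d := by rw [hf₃.reg 1 rfl]; simp [u1]
  have w2 : s₃.reg 2 = d * d := by rw [hf₃.reg 2 rfl]; simp [u2]
  have b0 : s₃.arr 0 = F := by rw [hf₃.arr 0 rfl]; exact v0
  have b1 : ∀ t < n, s₃.arr 1 t = F (n - 1 - t) := by rw [hf₃.arr 1 rfl]; exact t1
  have b4 : ∀ t, s₃.arr 4 t = code F (d * d) t := by rw [hf₃.arr 4 rfl]; exact t4
  have b5 : ∀ i ≤ d * d, s₃.arr 5 i = 4 ^ i := by rw [hf₃.arr 5 rfl]; exact t5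
  have b67 : ∀ q ≤ n, s₃.arr 6 q = Nat.log 2 q ∧ s₃.arr 7 q = 2 ^ Nat.log 2 q := by
    rw [hf₃.arr 6 rfl, hf₃.arr 7 rfl]; exact t67
  have b14 : ∀ i, s₃.arr 14 i = 0 := by rw [hf₃.arr 14 rfl]; exact v14
  clear hf₃ t1 t4 t5 t67 v0 v12 v13 v14 u0 u1 u2 u3 u14
  have hlogn : n / (d * d * (d * d)) ≤ n := Nat.div_le_self _ _
  have b6 := (b67 _ hlogn).1
  generalize hK : Nat.log 2 (n / (d * d * (d * d))) = K at b6 hK₂ hK₂'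
  refine Wp.seq (Wp.assign (by simp) (by simp [y19]; omega) ?_)
  refine Wp.seq (Wp.assign (by simp) (by simp [w2]; omega) ?_)
  refine Wp.seq (Wp.assign (by simp) (by simp [w2]; omega) ?_)
  refine Wp.seq (Wp.assign (by simp) (by simp [w2]; omega) ?_)
  refine Wp.seq (Wp.assign (by simp) (by simp [w2]; omega) ?_)
  refine Wp.seq (Wp.assign (by simp [w0, w2]; omega) (by simp [w0, w2, b6]; omega) ?_)
  have z1 : (K + 1) * (4 * (n / (d * d) + d * d + 1)) ≤ 288 * (n + 1) := by
    calc (K + 1) * (4 * (n / (d * d) + d * d + 1)) ≤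
          (8 * (d * d)) * (4 * (n / (d * d) + d * d + 1)) := Nat.mul_le_mul_right _ (by omega)
      _ = 32 * (d * d * (n / (d * d) + d * d + 1)) := by ring
      _ ≤ 288 * (n + 1) := by omega
  have z2 : (d * d + K) * (2 * (n / (d * d) + d * d + 1)) ≤ 162 * (n + 1) := by
    calc (d * d + K) * (2 * (n / (d * d) + d * d + 1)) ≤
          (9 * (d * d)) * (2 * (n / (d * d) + d * d + 1)) := Nat.mul_le_mul_right _ (by omega)
      _ = 18 * (d * d * (n / (d * d) + d * d + 1)) := by ring
      _ ≤ 162 * (n + 1) := by omega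
  have z3 : (d * d + K + 1) * (100 * (2 * (n / (d * d) + d * d + 1) + 1)) ≤ 19800 * (n + 1) := by
    calc (d * d + K + 1) * (100 * (2 * (n / (d * d) + d * d + 1) + 1)) ≤
          (9 * (d * d)) * (100 * (2 * (n / (d * d) + d * d + 1) + 1)) :=
            Nat.mul_le_mul_right _ (by omega)
      _ = 1800 * (d * d * (n / (d * d) + d * d + 1)) + 900 * (d * d) := by ring
      _ ≤ 19800 * (n + 1) := by omega
  have z4 : (n / (d * d) + d * d + 1) * (d * d) ≤ 9 * (n + 1) := by rwa [mul_comm]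
  -- The counter of names continues from the first scale, so the slots left over there count as
  -- obsolete.
  refine Wp.andThen ((schemeP_spec (L := L) (n := n) (b := d * d) (d := d * d) (R := d * d) (K := K)
    (M := n / (d * d) + d * d + 1) (c₀ := s₃.reg 14) (by omega) hF ?_ ?_ ?_ ?_ ?_ ?_ ?_ rfl rfl ?_
    ?_ (by omega) ?_ hK₂ (by omega) (by omega) (by omega) (by omega) (by omega)
    (by omega) (by omega)).mono z3 fun _ _ h => h) ?_
  · simp [w0]
  · simp [w2]
  · simp [w2]
  · simp [w2]
  · simp [w2]
  · simp [w0, w2, b6]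
  · simp
  · exact b4
  · exact y12
  · exact b14
  rintro s₄ hf₄ ⟨-, y19', -, -, hN₂⟩
  have c0 : s₄.reg 0 = n := by rw [hf₄.reg 0 rfl]; simp [w0]
  have c1 : s₄.reg 1 = d := by rw [hf₄.reg 1 rfl]; simp [w1]
  have c2 : s₄.reg 2 = d * d := by rw [hf₄.reg 2 rfl]; simp [w2]
  have c28 : s₄.reg 28 = n / d + d + 1 := by rw [hf₄.reg 28 rfl]; simp [y19]
  have c29 : s₄.reg 29 = d * d * (d * d) := by rw [hf₄.reg 29 rfl]; simp [w2]
  have e0 : s₄.arr 0 = F := by rw [hf₄.arr 0 rfl]; exact b0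
  have e1 : ∀ t < n, s₄.arr 1 t = F (n - 1 - t) := by rw [hf₄.arr 1 rfl]; exact b1
  have e4 : ∀ t, s₄.arr 4 t = code F (d * d) t := by rw [hf₄.arr 4 rfl]; exact b4
  have e5 : ∀ i ≤ d * d, s₄.arr 5 i = 4 ^ i := by rw [hf₄.arr 5 rfl]; exact b5
  have e67 : ∀ q ≤ n, s₄.arr 6 q = Nat.log 2 q ∧ s₄.arr 7 q = 2 ^ Nat.log 2 q := by
    rw [hf₄.arr 6 rfl, hf₄.arr 7 rfl]; exact b67
  have e13 : Names F n d (n / d + d + 1) (2 * a) (s₄.arr 13) := by rw [hf₄.arr 13 rfl]; exact hN₁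
  clear hf₄ b0 b1 b4 b5 b67 b14 hN₁ w0 w1 w2 y19 y14 y12
  refine Wp.seq (Wp.assign (by simp) (by simp [y19']; omega) ?_)
  generalize hs₅ : s₄.setReg 27 ((Expr.reg 19).eval s₄) = s₅
  have hE : TestEnv F n d (2 * a) K s₅ := by
    rw [← hs₅]
    exact ⟨by simp [c0], by simp [c1], by simp [c2], by simp [c29], by simp [c28], by simp [y19'], e4, e5,
      e67, e13, hN₂⟩
  have g0 : s₅.arr 0 = F := by rw [← hs₅]; exact e0
  have g1 : ∀ t < n, s₅.arr 1 t = F (n - 1 - t) := by rw [← hs₅]; exact e1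
  refine Wp.andThen (lcpP_spec (by omega) hE.1 (by omega) g0) ?_
  intro s₆ hf₆ h2
  have hE₆ := hE.frame hf₆ (by decide) (by decide)
  have i0 : s₆.arr 0 = F := by rw [hf₆.arr 0 rfl, g0]
  have i1 : ∀ t < n, s₆.arr 1 t = F (n - 1 - t) := by rw [hf₆.arr 1 rfl]; exact g1
  clear hf₆
  refine Wp.andThen (lcpP_spec (by omega) hE₆.1 (by omega) rfl) ?_
  intro s₇ hf₇ h3
  refine searchP_spec hF hd1 (by omega) hlog hK.le (by omega) (by omega)
    (hE₆.frame hf₇ (by decide) (by decide)) (by rw [hf₇.arr 0 rfl, i0]) ?_ ?_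
  · rw [hf₇.arr 2 rfl]
    exact h2
  · exact fun p hp hpn => (h3 p hp hpn).congr i1

end WordRAM


theorem mainTheorem4 :
    CheckableInLinearTimeAndSpace (fun f : List (ZMod 4) => LeeIsometric f) := by
  -- No statement of `leeP` has expressions of cost above `60`, so each of the `30000 (n + 1)` steps
  -- takes at most `61` units, and `61 * 30000 = 1830000`. Words must exceed `(1000 (n + 1) + 4) ^
  -- 60`, which is at most `1004 ^ 60 * (n + 1) ^ 60`.
  obtain ⟨C, h1, h2, h3⟩ : ∃ C : ℕ, 1830000 ≤ C ∧ 60 ≤ C ∧ 1004 ^ 60 < C :=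
    ⟨1830000 + 1004 ^ 60, by omega, by omega, by omega⟩
  refine ⟨WordRAM.leeP, C, fun f => ?_⟩
  have hF : (WordRAM.State.init (f.map ZMod.val)).arr 0 = fun t => (f.getD t 0).val := by
    funext t
    by_cases ht : t < f.length
    · simp [WordRAM.State.init, List.getD, ht]
    · simp [WordRAM.State.init, List.getD, List.getElem?_eq_none (Nat.le_of_not_lt ht)]
  have hn : 1 ≤ f.length + 1 := by omega
  obtain ⟨s', t, he, ht, -, hQ⟩ := WordRAM.leeP_spec (n := f.length)
    (s := WordRAM.State.init (f.map ZMod.val)) (fun t => ZMod.val_lt (f.getD t 0))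
    (fun t ht => by simp [List.getD, List.getElem?_eq_none ht]) (by simp [WordRAM.State.init])
    (by simp [WordRAM.State.init]) hF (fun a ha i => by simp [WordRAM.State.init, ha])
    60 (C * (f.length + 1) ^ C) WordRAM.leeP_small (by
      calc (1000 * (f.length + 1) + 4) ^ 60 ≤ (1004 * (f.length + 1)) ^ 60 :=
            Nat.pow_le_pow_left (by omega) 60
        _ = 1004 ^ 60 * (f.length + 1) ^ 60 := Nat.mul_pow _ _ _
        _ ≤ 1004 ^ 60 * (f.length + 1) ^ C := Nat.mul_le_mul_left _ (Nat.pow_le_pow_right hn h2)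
        _ < C * (f.length + 1) ^ C := Nat.mul_lt_mul_of_pos_right h3 (Nat.pow_pos hn)) (by
      constructor
      · intro x
        by_cases hx : x = 0 <;> simp [WordRAM.State.init, hx]
        omega
      · intro a i
        by_cases ha : a = 0
        · rw [ha, hF]
          have := ZMod.val_lt (f.getD i 0)
          simp only
          omega
        · simp [WordRAM.State.init, ha])
  have hCn : 1830000 * (f.length + 1) ≤ C * (f.length + 1) := Nat.mul_le_mul_right _ h1
  refine ⟨s', t, he.mono (Nat.mul_le_mul_right _ (by omega)), by omega, ?_⟩
  beta_reduce
  rw [BitWord.leeIsometric_iff, WordRAM.err2_seqBits_iff, not_not]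
  exact ⟨hQ.2, hQ.1⟩
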